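/- **Theorem.** Let $\delta>0$ and let $d:\mathbb N\to\mathbb N$ satisfy $d(n)=\omega(\log n)$, where, as usual for a dimension bound, $d(n)$ can be computed from $n$ in truly subquadratic time, i.e. in time $O(n^{2-\epsilon'})$ for some $\epsilon'>0$. Suppose that for some $\epsilon>0$ there is a (possibly randomized) algorithm running in time $O(n^{2-\epsilon})$ which, given two sets $A,B\subseteq\{0,1\}^{d(n)}$ with $|A|=|B|=n$, outputs with probability at least $2/3$ a bijection $\pi:A\to B$ with $$\sum_{a\in A}\|a-\pi(a)\|_2\le\Bigl(1+\frac1{n^{\delta}}\Bigr)\min_{\sigma:A\to B\text{ bijective}}\ \sum_{a\in A}\|a-\sigma(a)\|_2 .$$ Then the Hitting Set Conjecture is false. Here the Hitting Set Conjecture states: for every $d'(n)=\omega(\log n)$ and every $\epsilon>0$, no randomized algorithm decides in time $O(n^{2-\epsilon})$, with success probability at least $2/3$ on every input, whether for two given sets $A,B\subseteq\{0,1\}^{d'(n)}$ with $|A|=|B|=n$ there is some $a\in A$ with $a\cdot b\ne0$ for every $b\in B$. Algorithms are programs for the randomized word RAM with words of $O(\log n)$ bits and unit cost per instruction; running times are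 worst-case over inputs and over random choices. -/

import Mathlib

open Filter Asymptotics
open scoped ENNReal Topology

/-! Randomized word RAM: finitely many registers and arrays, read-only input arrays, unit cost per
instruction, random words, and words of `O(log n)` bits. -/

namespace WordRAM

/-- Arithmetic and bitwise word operations (`sub` is truncated at `0`, `x / 0 = 0`, `x % 0 = x`). -/
inductive BinOp
  | add | sub | mul | div | mod | land | lor | xor | shl | shr

/-- The value of a word operation. -/
def BinOp.eval : BinOp → ℕ → ℕ → ℕ
  | .add, u, v => u + v
  | .sub, u, v => u - v
  | .mul, u, v => u * v
  | .div, u, v => u / v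
  | .mod, u, v => u % v
  | .land, u, v => Nat.land u v
  | .lor, u, v => Nat.lor u v
  | .xor, u, v => Nat.xor u v
  | .shl, u, v => Nat.shiftLeft u v
  | .shr, u, v => Nat.shiftRight u v

/-- Programs. The letters `x`, `y`, `z` are register names, and `a` is the name of an array; since a
program is a finite object, it mentions finitely many of them. -/
inductive Prog
  /-- do nothing -/
  | skip
  /-- `x := c` -/
  | const (x c : ℕ)
  /-- `x := y op z` -/
  | op (o : BinOp) (x y z : ℕ)
  /-- `x := a[y]` -/
  | load (x a y : ℕ)
  /-- `a[y] := z` -/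
  | store (a y z : ℕ)
  /-- `x := input_a[y]`, the entry of index `y` of the read-only input array `a` -/
  | read (x a y : ℕ)
  /-- `x :=` a fresh uniformly random element of `{0, …, y}` -/
  | rand (x y : ℕ)
  /-- first `p`, then `q` -/
  | seq (p q : Prog)
  /-- if `x ≠ 0` then `p` else `q` -/
  | branch (x : ℕ) (p q : Prog)
  /-- while `x ≠ 0` do `p` -/
  | loop (x : ℕ) (p : Prog)

/-- The contents of the registers and of the arrays. -/
structure State where
  reg : ℕ → ℕ
  arr : ℕ → ℕ → ℕ

/-- Initially everything is `0`. -/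
def State.zero : State := ⟨fun _ => 0, fun _ _ => 0⟩

/-- Assign the value `v` to the register `x`. -/
def State.setReg (s : State) (x v : ℕ) : State :=
  { s with reg := Function.update s.reg x v }

/-- Assign the value `v` to the entry of index `i` of the array `a`. -/
def State.setArr (s : State) (a i v : ℕ) : State :=
  { s with arr := Function.update s.arr a (Function.update (s.arr a) i v) }

/-- All registers and array entries hold numbers below `m`. -/
def State.BoundedBy (s : State) (m : ℕ) : Prop :=
  (∀ x, s.reg x < m) ∧ ∀ a i, s.arr a i < m

/-- A configuration: the stack of what remains to be executed, and the current state. The machine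
has halted when the stack is empty. -/
abbrev Config := List Prog × State

/-- One step of the machine on the input arrays `inp`. -/
noncomputable def step (inp : ℕ → ℕ → ℕ) : Config → PMF Config
  | ([], s) => PMF.pure ([], s)
  | (.skip :: K, s) => PMF.pure (K, s)
  | (.const x c :: K, s) => PMF.pure (K, s.setReg x c)
  | (.op o x y z :: K, s) => PMF.pure (K, s.setReg x (o.eval (s.reg y) (s.reg z)))
  | (.load x a y :: K, s) => PMF.pure (K, s.setReg x (s.arr a (s.reg y)))
  | (.store a y z :: K, s) => PMF.pure (K, s.setArr a (s.reg y) (s.reg z))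
  | (.read x a y :: K, s) => PMF.pure (K, s.setReg x (inp a (s.reg y)))
  | (.rand x y :: K, s) =>
      (PMF.uniformOfFintype (Fin (s.reg y + 1))).map fun v : Fin (s.reg y + 1) =>
        (K, s.setReg x v.val)
  | (.seq p q :: K, s) => PMF.pure (p :: q :: K, s)
  | (.branch x p q :: K, s) => PMF.pure (if s.reg x ≠ 0 then (p :: K, s) else (q :: K, s))
  | (.loop x p :: K, s) =>
      PMF.pure (if s.reg x ≠ 0 then (p :: .loop x p :: K, s) else (K, s))

/-- The distribution of the configuration after `t` steps. -/
noncomputable def run (inp : ℕ → ℕ → ℕ) : ℕ → Config → PMF Config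
  | 0, c => PMF.pure c
  | t + 1, c => (step inp c).bind (run inp t)

/-- A computational problem: instances with their size, their encoding in the input arrays, and
the final states that count as a correct answer. -/
structure Problem where
  Inst : Type
  size : Inst → ℕ
  input : Inst → ℕ → ℕ → ℕ
  Correct : Inst → State → Prop

/-- The program `p` solves `P` in worst-case time `T`: on every instance of size `n` it halts within
`T n` steps whatever the random choices, all numbers that ever occur are below `(n + 2) ^ k` (words of
`O(log n)` bits), and the answer is correct with probability at least `q`. -/
def Solves (P : Problem) (q : ℝ≥0∞) (p : Prog) (k : ℕ) (T : ℕ → ℕ) : Prop :=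
  ∀ x : P.Inst,
    (∀ t, ∀ c ∈ (run (P.input x) t ([p], State.zero)).support,
      c.2.BoundedBy ((P.size x + 2) ^ k)) ∧
    (∀ c ∈ (run (P.input x) (T (P.size x)) ([p], State.zero)).support, c.1 = []) ∧
    q ≤ (run (P.input x) (T (P.size x)) ([p], State.zero)).toOuterMeasure
      {c | P.Correct x c.2}

/-- Some algorithm solves `P`, with success probability at least `q` on each instance, in time
`O(f(n))`. -/
def SolvableInTime (P : Problem) (q : ℝ≥0∞) (f : ℕ → ℝ) : Prop :=
  ∃ (p : Prog) (k : ℕ) (T : ℕ → ℕ),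
    Solves P q p k T ∧ (fun n => (T n : ℝ)) =O[atTop] f

/-- Solvable in time `O(n ^ (2 - ε))` by a randomized algorithm (success probability `2/3`), for the
given `ε`. -/
def RandomizedSolvable (P : Problem) (ε : ℝ) : Prop :=
  SolvableInTime P (2 / 3) fun n => (n : ℝ) ^ (2 - ε)

end WordRAM

open WordRAM

/-- `d(n) = ω(log n)`. -/
def IsOmegaLog (d : ℕ → ℕ) : Prop :=
  (fun n : ℕ => Real.log n) =o[atTop] fun n : ℕ => (d n : ℝ)

/-- The `n × d` bits of a list of `n` vectors in `{0,1}^d`, in row-major order. -/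
def bitArray {n d : ℕ} (A : Fin n → Fin d → Bool) (y : ℕ) : ℕ :=
  if h : y < n * d then
    (A (finProdFinEquiv.symm ⟨y, h⟩).1 (finProdFinEquiv.symm ⟨y, h⟩).2).toNat
  else 0

/-- Two sets `A, B ⊆ {0,1}^{d(n)}` with `|A| = |B| = n`, each listed in some order without
repetitions. -/
structure VectorPair (d : ℕ → ℕ) where
  n : ℕ
  A : Fin n → Fin (d n) → Bool
  B : Fin n → Fin (d n) → Bool
  injA : Function.Injective A
  injB : Function.Injective B

/-- Input array `0` holds `n` and `d(n)`, input arrays `1` and `2` hold the vectors of `A` and `B`. -/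
def VectorPair.input {d : ℕ → ℕ} (x : VectorPair d) : ℕ → ℕ → ℕ
  | 0, 0 => x.n
  | 0, 1 => d x.n
  | 1, y => bitArray x.A y
  | 2, y => bitArray x.B y
  | _, _ => 0

/-- The inner product of two `0/1`-vectors, in `ℕ`. -/
def bdot {m : ℕ} (a b : Fin m → Bool) : ℕ := ∑ j, (a j).toNat * (b j).toNat

/-- The Hitting Set problem in `d(n)` dimensions: is there `a ∈ A` with `a · b ≠ 0` for every
`b ∈ B`? The answer is yes if register `0` is nonzero at the end. -/
abbrev hittingSet (d : ℕ → ℕ) : Problem where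
  Inst := VectorPair d
  size x := x.n
  input := VectorPair.input
  Correct x s := s.reg 0 ≠ 0 ↔ ∃ i, ∀ j, bdot (x.A i) (x.B j) ≠ 0

/-- The Hitting Set Conjecture. -/
def HittingSetConjecture : Prop :=
  ∀ d : ℕ → ℕ, IsOmegaLog d → ∀ ε : ℝ, 0 < ε → ¬ RandomizedSolvable (hittingSet d) ε

/-- A `0/1`-vector as a point of Euclidean space. -/
noncomputable def toPoint {m : ℕ} (a : Fin m → Bool) : EuclideanSpace ℝ (Fin m) :=
  WithLp.toLp 2 fun j => if a j then 1 else 0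

/-- The cost of the matching `π` between `A` and `B`. -/
noncomputable def matchingCost {n m : ℕ} (A B : Fin n → Fin m → Bool) (π : Equiv.Perm (Fin n)) : ℝ :=
  ∑ i, ‖toPoint (A i) - toPoint (B (π i))‖

/-- The Earth Mover Distance between `A` and `B`. -/
noncomputable def emd {n m : ℕ} (A B : Fin n → Fin m → Bool) : ℝ :=
  Finset.univ.inf' Finset.univ_nonempty (matchingCost A B)

/-- The `(1 + η(n))`-approximate EMD matching problem in `d(n)` dimensions: output, in array `0`, a
bijection `π` whose cost is at most `1 + η(n)` times the optimal one. -/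
noncomputable abbrev approxEMDMatching (η : ℕ → ℝ) (d : ℕ → ℕ) : Problem where
  Inst := VectorPair d
  size x := x.n
  input := VectorPair.input
  Correct x s := ∃ π : Equiv.Perm (Fin x.n), (∀ i : Fin x.n, s.arr 0 i = π i) ∧
    matchingCost x.A x.B π ≤ (1 + η x.n) * emd x.A x.B

/-- The problem of computing `d(n)` (in register `0`) from the number `n`. -/
abbrev evalProblem (d : ℕ → ℕ) : Problem where
  Inst := ℕ
  size n := n
  input n := fun _ _ => n
  Correct n s := s.reg 0 = d n

/-- The function `d` can be computed without error in truly subquadratic time. -/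
def SubquadraticallyComputable (d : ℕ → ℕ) : Prop :=
  ∃ ε : ℝ, 0 < ε ∧ SolvableInTime (evalProblem d) 1 fun n => (n : ℝ) ^ (2 - ε)

/-!
An approximate matching algorithm is turned into an algorithm for Hitting Set. Call a vector of `A`
dead once some vector of `B` orthogonal to it is known, and alive otherwise; the answer is yes if and
only if some vector can never be declared dead. The relation of orthogonality between the living
vectors and `B` is a bipartite graph, and there are two ways to make progress.

*Small matchings.* Take a living vector `a`, find by brute force some `b` orthogonal to it (if there
is none, the answer is yes), and declare all vectors orthogonal to `b` dead. The pairs `(a, b)` found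
in this way form a matching, so if the graph has no matching of size `2 (n / g)`, this ends within
`2 (n / g)` steps of time `O(n d)` each (`WordRAM.HS.run_searchPhase`).

*Large matchings.* The vectors are extended by gadgets so that the distance between `a` and `b` is
`√(M + 2 ⟨a, b⟩)` with `M = 3 d + 1`. Dead vectors have inner product `0` with everything, and
dummies on the side of `B` have inner product `1` with all living vectors; blocks of binary digits
make the `2 n` vectors on either side distinct. The optimal cost is then determined by the size of
a maximum matching of orthogonal pairs, and a cost within the factor `1 + 1 / (2 n) ^ δ` loses only
few of these pairs (`Gadget.card_add_le_of_matchingCost_le`). Hence a successful call removes `n / g`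
living vectors, as long as a matching of size `2 (n / g)` exists. As calls fail with probability at
most `1 / 3` and never do any harm, the expected progress shows that `9 g` of them leave a large
matching with probability at most `1 / 3` (`WordRAM.HS.drift_step`, `WordRAM.HS.ok_rounds`).

With `g` the integer `h`-th root of `n` for a large constant `h`, both phases take truly subquadratic
time (`WordRAM.HS.isBigO_mainCost`). The dimension of the Hitting Set instances is
`min (d(2 n) / 12) (log₂ n) ^ 2`, which is `ω(log n)`, and small enough for the brute force and for
the gadgets to fit into dimension `d(2 n)`.

On the word RAM, the given algorithm is simulated as a subroutine (`WordRAM.OK.simulate`). Its input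
is not written down, since in dimension `d(2 n)` it may be too long, but computed whenever a bit of
it is read. Nor is its memory cleared between the calls: each array entry carries the number of the
call that wrote it, and entries of earlier calls count as `0`. Programs are verified in continuation
passing style with respect to `WordRAM.Safe`, which combines worst-case time, the bound on the words
and the expectation of a loss; `WordRAM.OK` is its version for states up to the temporaries of
compiled expressions, and `WordRAM.HS.ok_mainProg` sums up the algorithm.
-/

namespace WordRAM

variable {inp : ℕ → ℕ → ℕ} {m : ℕ} {F : State → ℝ≥0∞}

/-! ### Worst-case safety together with an expected cost -/

/-- Started in `c`, the machine surely halts within `t` steps, all numbers that ever occur are below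
`m`, and the expectation of `F` at the final state is at most `e`. -/
def Safe (inp : ℕ → ℕ → ℕ) (m : ℕ) (F : State → ℝ≥0∞) (t : ℕ) (c : Config) (e : ℝ≥0∞) : Prop :=
  (∀ t', ∀ c' ∈ (run inp t' c).support, c'.2.BoundedBy m) ∧
  (∀ c' ∈ (run inp t c).support, c'.1 = []) ∧
  ∑' c', run inp t c c' * F c'.2 ≤ e

theorem tsum_pure_mul {α : Type*} (a : α) (f : α → ℝ≥0∞) : ∑' x, PMF.pure a x * f x = f a := by
  rw [tsum_eq_single a]
  · simp
  · intro b hb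
    simp [hb]

theorem tsum_bind_mul {α β : Type*} (p : PMF α) (q : α → PMF β) (f : β → ℝ≥0∞) :
    ∑' y, p.bind q y * f y = ∑' x, p x * ∑' y, q x y * f y := by
  simp_rw [PMF.bind_apply, ← ENNReal.tsum_mul_right, ← ENNReal.tsum_mul_left]
  rw [ENNReal.tsum_comm]
  simp_rw [mul_assoc]

theorem run_succ_eq (t : ℕ) (c : Config) :
    run inp (t + 1) c = (run inp t c).bind (step inp) := by
  induction t generalizing c with
  | zero =>
    change (step inp c).bind (fun c => PMF.pure c) = (PMF.pure c).bind (step inp)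
    rw [PMF.bind_pure, PMF.pure_bind]
  | succ t ih =>
    change (step inp c).bind (run inp (t + 1)) = ((step inp c).bind (run inp t)).bind (step inp)
    rw [PMF.bind_bind]
    congr 1
    funext c'
    exact ih c'

theorem bind_congr_support {α β : Type*} (p : PMF α) {q r : α → PMF β}
    (h : ∀ a ∈ p.support, q a = r a) : p.bind q = p.bind r := by
  ext b
  simp only [PMF.bind_apply]
  refine tsum_congr fun a => ?_
  by_cases ha : p a = 0
  · simp [ha]
  · rw [h a ((PMF.mem_support_iff _ _).2 ha)]

/-- A machine that has surely halted does not move any more. -/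
theorem run_succ_of_halted {t : ℕ} {c : Config} (h : ∀ c' ∈ (run inp t c).support, c'.1 = []) :
    run inp (t + 1) c = run inp t c := by
  rw [run_succ_eq]
  conv_rhs => rw [← PMF.bind_pure (run inp t c)]
  refine bind_congr_support _ fun a ha => ?_
  obtain ⟨K, s⟩ := a
  obtain rfl : K = [] := h _ ha
  rfl

theorem run_eq_of_halted {t t' : ℕ} {c : Config} (h : ∀ c' ∈ (run inp t c).support, c'.1 = [])
    (ht : t ≤ t') : run inp t' c = run inp t c := by
  induction t', ht using Nat.le_induction with
  | base => rfl
  | succ k _ ih => rw [run_succ_of_halted (by rw [ih]; exact h), ih]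

theorem Safe.mono {t t' : ℕ} {c : Config} {e e' : ℝ≥0∞} (h : Safe inp m F t c e) (ht : t ≤ t')
    (he : e ≤ e') : Safe inp m F t' c e' := by
  obtain ⟨h1, h2, h3⟩ := h
  refine ⟨h1, ?_, ?_⟩
  · rwa [run_eq_of_halted h2 ht]
  · rw [run_eq_of_halted h2 ht]
    exact h3.trans he

theorem Safe.nil {s : State} (hs : s.BoundedBy m) : Safe inp m F 0 ([], s) (F s) := by
  have h : ∀ t, run inp t ([], s) = PMF.pure ([], s) := by
    intro t
    induction t with
    | zero => rfl
    | succ t ih => exact (PMF.pure_bind _ _).trans ih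
  refine ⟨?_, ?_, ?_⟩
  · intro t c' hc'
    rw [h] at hc'
    simp only [PMF.support_pure, Set.mem_singleton_iff] at hc'
    rw [hc']
    exact hs
  · intro c' hc'
    rw [h] at hc'
    simp only [PMF.support_pure, Set.mem_singleton_iff] at hc'
    rw [hc']
  · rw [h, tsum_pure_mul]

/-- One step whose outcome is `f v` for a random `v`. -/
theorem Safe.of_step_map {α : Type} {t : ℕ} {c : Config} (hc : c.2.BoundedBy m) (p : PMF α)
    (f : α → Config) (hstep : step inp c = p.map f) (E : α → ℝ≥0∞)
    (h : ∀ v ∈ p.support, Safe inp m F t (f v) (E v)) :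
    Safe inp m F (t + 1) c (∑' v, p v * E v) := by
  have hrun : ∀ t, run inp (t + 1) c = p.bind fun v => run inp t (f v) := by
    intro t
    change (step inp c).bind (run inp t) = _
    rw [hstep, PMF.bind_map]
    rfl
  refine ⟨?_, ?_, ?_⟩
  · intro t' c' hc'
    cases t' with
    | zero =>
      change c' ∈ (PMF.pure c).support at hc'
      simp only [PMF.support_pure, Set.mem_singleton_iff] at hc'
      rw [hc']
      exact hc
    | succ t' =>
      rw [hrun, PMF.mem_support_bind_iff] at hc'
      obtain ⟨v, hv, hv'⟩ := hc'
      exact (h v hv).1 t' c' hv'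
  · intro c' hc'
    rw [hrun, PMF.mem_support_bind_iff] at hc'
    obtain ⟨v, hv, hv'⟩ := hc'
    exact (h v hv).2.1 c' hv'
  · rw [hrun, tsum_bind_mul]
    refine ENNReal.tsum_le_tsum fun v => ?_
    by_cases hv : p v = 0
    · simp [hv]
    · exact mul_le_mul_right ((h v ((PMF.mem_support_iff _ _).2 hv)).2.2) _

theorem Safe.of_step_pure {t : ℕ} {c c' : Config} {e : ℝ≥0∞} (hc : c.2.BoundedBy m)
    (hstep : step inp c = PMF.pure c') (h : Safe inp m F t c' e) : Safe inp m F (t + 1) c e := by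
  have := Safe.of_step_map (F := F) (t := t) hc (PMF.pure c') id (by rw [hstep, PMF.map_id])
    (fun _ => e) (by
      intro v hv
      simp only [PMF.support_pure, Set.mem_singleton_iff] at hv
      rw [hv]
      exact h)
  rwa [tsum_pure_mul] at this

theorem State.BoundedBy.setReg {s : State} {M x v : ℕ} (hs : s.BoundedBy M) (hv : v < M) :
    (s.setReg x v).BoundedBy M := by
  refine ⟨fun y => ?_, hs.2⟩
  by_cases h : y = x
  · subst h
    simpa [State.setReg] using hv
  · simpa [State.setReg, h] using hs.1 y

theorem State.BoundedBy.setArr {s : State} {M a i v : ℕ} (hs : s.BoundedBy M) (hv : v < M) :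
    (s.setArr a i v).BoundedBy M := by
  refine ⟨hs.1, fun b j => ?_⟩
  by_cases h : b = a
  · subst h
    by_cases h' : j = i
    · subst h'
      simpa [State.setArr] using hv
    · simpa [State.setArr, h'] using hs.2 b j
  · simpa [State.setArr, h] using hs.2 b j

/-- Failure bounds turn into success probabilities. -/
theorem solves_of_safe {P : Problem} {p : Prog} {k : ℕ} {T : ℕ → ℕ} {q : ℝ≥0∞} (hq : q ≤ 1)
    (h : ∀ x : P.Inst, ∃ F : State → ℝ≥0∞, (∀ s, ¬ P.Correct x s → 1 ≤ F s) ∧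
      Safe (P.input x) ((P.size x + 2) ^ k) F (T (P.size x)) ([p], State.zero) (1 - q)) :
    Solves P q p k T := by
  intro x
  obtain ⟨F, hF, h1, h2, h3⟩ := h x
  refine ⟨h1, h2, ?_⟩
  set r := run (P.input x) (T (P.size x)) ([p], State.zero) with hr
  have hsum : r.toOuterMeasure {c | P.Correct x c.2} + r.toOuterMeasure {c | P.Correct x c.2}ᶜ
      = 1 := by
    rw [PMF.toOuterMeasure_apply, PMF.toOuterMeasure_apply, ← ENNReal.tsum_add, ← r.tsum_coe]
    refine tsum_congr fun c => ?_
    by_cases hc : P.Correct x c.2 <;> simp [Set.indicator, hc]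
  have hle : r.toOuterMeasure {c | P.Correct x c.2}ᶜ ≤ 1 - q := by
    refine le_trans ?_ h3
    rw [PMF.toOuterMeasure_apply]
    refine ENNReal.tsum_le_tsum fun c => ?_
    by_cases hc : P.Correct x c.2
    · simp [Set.indicator, hc]
    · simpa [Set.indicator, hc] using mul_le_mul_right (hF c.2 hc) (r c)
  have hfin : (1 - q : ℝ≥0∞) ≠ ⊤ := ENNReal.sub_ne_top ENNReal.one_ne_top
  refine (ENNReal.add_le_add_iff_right hfin).1 ?_
  calc q + (1 - q) = 1 := add_tsub_cancel_of_le hq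
    _ = _ := hsum.symm
    _ ≤ _ := add_le_add le_rfl hle

end WordRAM

namespace WordRAM

/-! ### Compiled expressions and structured programs -/

/-- Register for the temporary value at stack height `t`. Registers fall into three classes modulo
`3`: named variables, temporaries of compiled expressions, registers of a simulated machine. -/
abbrev tmp (t : ℕ) : ℕ := 3 * t + 1

/-- The word operations allowed in expressions. The values of these are at most the sum or the
product of the arguments, in contrast to that of a left shift. -/
def BinOp.Tame : BinOp → Bool
  | .shl | .lor | .xor => false
  | _ => true

/-- Expressions over registers, arrays and the input. -/
inductive Expr
  | lit (c : ℕ)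
  | reg (x : ℕ)
  | bin (o : BinOp) (a b : Expr)
  | arr (a : ℕ) (i : Expr)
  | inp (a : ℕ) (i : Expr)
  | ite (c a b : Expr)

namespace Expr

/-- The value of an expression; `ite` tests for being nonzero. -/
def val (I : ℕ → ℕ → ℕ) (s : State) : Expr → ℕ
  | lit c => c
  | reg x => s.reg x
  | bin o a b => o.eval (a.val I s) (b.val I s)
  | arr a i => s.arr a (i.val I s)
  | inp a i => I a (i.val I s)
  | ite c a b => if c.val I s ≠ 0 then a.val I s else b.val I s

/-- A program that computes the expression into `tmp t`, using only temporaries from `t` on. -/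
def comp : Expr → ℕ → Prog
  | lit c, t => .const (tmp t) c
  | reg x, t => .op .land (tmp t) x x
  | bin o a b, t => .seq (a.comp t) (.seq (b.comp (t + 1)) (.op o (tmp t) (tmp t) (tmp (t + 1))))
  | arr a i, t => .seq (i.comp t) (.load (tmp t) a (tmp t))
  | inp a i, t => .seq (i.comp t) (.read (tmp t) a (tmp t))
  | ite c a b, t => .seq (c.comp t) (.branch (tmp t) (a.comp t) (b.comp t))

/-- An upper bound for the running time of `comp`. -/
def cost : Expr → ℕ
  | lit _ => 1
  | reg _ => 1
  | bin _ a b => a.cost + b.cost + 3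
  | arr _ i => i.cost + 2
  | inp _ i => i.cost + 2
  | ite c a b => c.cost + a.cost + b.cost + 2

/-- The number of leaves: the degree with which values can grow. -/
def size : Expr → ℕ
  | lit _ => 1
  | reg _ => 1
  | bin _ a b => a.size + b.size
  | arr _ i => i.size
  | inp _ i => i.size
  | ite c a b => c.size + a.size + b.size

/-- Tame operations only, no large constants, no temporaries: such an expression takes only
polynomially larger values than those occurring in it. -/
def Tame : Expr → Bool
  | lit c => c < 16
  | reg x => x % 3 != 1
  | bin o a b => o.Tame && (a.Tame && b.Tame)
  | arr _ i => i.Tame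
  | inp _ i => i.Tame
  | ite c a b => c.Tame && (a.Tame && b.Tame)

theorem size_pos (e : Expr) : 1 ≤ e.size := by
  induction e <;> simp only [size] <;> omega

end Expr

theorem BinOp.eval_lt_pow {o : BinOp} (ho : o.Tame)
    {B a b u v : ℕ} (hB : 2 ≤ B) (ha : 1 ≤ a) (hb : 1 ≤ b) (hu : u < B ^ a) (hv : v < B ^ b) :
    o.eval u v < B ^ (a + b) := by
  have h1 : 2 ≤ B ^ a := hB.trans (Nat.le_self_pow (by omega) B)
  have h2 : 2 ≤ B ^ b := hB.trans (Nat.le_self_pow (by omega) B)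
  have hle : B ^ a ≤ B ^ (a + b) := Nat.pow_le_pow_right (by omega) (by omega)
  have hsum : u + v < B ^ (a + b) := by
    rw [pow_add]
    nlinarith
  cases o with
  | add => exact hsum
  | sub => exact (Nat.sub_le u v).trans_lt (hu.trans_le hle)
  | mul =>
    change u * v < _
    rw [pow_add]
    exact Nat.mul_lt_mul'' hu hv
  | div => exact (Nat.div_le_self u v).trans_lt (hu.trans_le hle)
  | mod => exact (Nat.mod_le u v).trans_lt (hu.trans_le hle)
  | land => exact (Nat.and_le_left (n := u) (m := v)).trans_lt (hu.trans_le hle)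
  | lor | xor | shl => simp [BinOp.Tame] at ho
  | shr => exact (Nat.shiftRight_le u v).trans_lt (hu.trans_le hle)

/-- The setting of a computation: the input, a bound `B` for the numbers in input, variables and
arrays, and the bound `m` on all words, which leaves room for intermediate results of expressions
of size at most `S`. -/
structure Env where
  inp : ℕ → ℕ → ℕ
  B : ℕ
  S : ℕ
  m : ℕ
  le_B : 16 ≤ B
  inp_lt : ∀ a y, inp a y < B
  pow_le : B ^ S ≤ m
  one_le : 1 ≤ S

theorem Env.B_le (E : Env) : E.B ≤ E.m :=
  (Nat.le_self_pow (by have := E.one_le; omega) E.B).trans E.pow_le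

/-- Equality of states up to the temporaries. -/
def Sim (s s' : State) : Prop := (∀ r, r % 3 ≠ 1 → s.reg r = s'.reg r) ∧ s.arr = s'.arr

theorem Sim.refl (s : State) : Sim s s := ⟨fun _ _ => rfl, rfl⟩

theorem Sim.setTmp {s s' : State} (h : Sim s s') (t v : ℕ) : Sim (s.setReg (tmp t) v) s' := by
  refine ⟨fun r hr => ?_, h.2⟩
  have : r ≠ tmp t := by unfold tmp; omega
  simpa [State.setReg, this] using h.1 r hr

theorem Sim.setReg {s s' : State} (h : Sim s s') (x v : ℕ) :
    Sim (s.setReg x v) (s'.setReg x v) := by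
  refine ⟨fun r hr => ?_, h.2⟩
  by_cases hx : r = x
  · subst hx
    simp [State.setReg]
  · simpa [State.setReg, hx] using h.1 r hr

theorem Sim.setArr {s s' : State} (h : Sim s s') (a i v : ℕ) :
    Sim (s.setArr a i v) (s'.setArr a i v) := by
  refine ⟨h.1, ?_⟩
  simp only [State.setArr, h.2]

theorem Expr.val_lt (E : Env) {s : State} (hs : s.BoundedBy E.B) (e : Expr) (he : e.Tame) :
    e.val E.inp s < E.B ^ e.size := by
  have hB := E.le_B
  have hB1 : ∀ (e : Expr), E.B ≤ E.B ^ e.size := fun e =>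
    Nat.le_self_pow (by have := e.size_pos; omega) _
  induction e with
  | lit c =>
    simp only [Tame, decide_eq_true_eq] at he
    exact (by simp only [val]; omega : _ < E.B).trans_le (hB1 (lit c))
  | reg x => exact (hs.1 x).trans_le (hB1 (reg x))
  | bin o a b iha ihb =>
    simp only [Tame, Bool.and_eq_true] at he
    exact BinOp.eval_lt_pow he.1 (by omega) a.size_pos b.size_pos (iha he.2.1) (ihb he.2.2)
  | arr a i ih => exact (hs.2 _ _).trans_le (hB1 (arr a i))
  | inp a i ih => exact (E.inp_lt _ _).trans_le (hB1 (inp a i))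
  | ite c a b ihc iha ihb =>
    simp only [Tame, Bool.and_eq_true] at he
    have h1 := iha he.2.1
    have h2 := ihb he.2.2
    simp only [val, size]
    split
    · exact h1.trans_le (Nat.pow_le_pow_right (by omega) (by omega))
    · exact h2.trans_le (Nat.pow_le_pow_right (by omega) (by omega))

theorem Expr.val_lt_m (E : Env) {s : State} (hs : s.BoundedBy E.B) (e : Expr) (he : e.Tame)
    (hS : e.size ≤ E.S) : e.val E.inp s < E.m :=
  (e.val_lt E hs he).trans_le
    ((Nat.pow_le_pow_right (by have := E.le_B; omega) hS).trans E.pow_le)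

/-- Correctness of compiled expressions. -/
theorem Expr.safe_comp (E : Env) {F : State → ℝ≥0∞} {s : State} (hs : s.BoundedBy E.B)
    {ε : ℝ≥0∞} (e : Expr) (he : e.Tame) (hS : e.size ≤ E.S) {t k : ℕ} {K : List Prog} {s₁ : State}
    (h₁ : Sim s₁ s) (hb : s₁.BoundedBy E.m)
    (h : ∀ s₂, Sim s₂ s → s₂.BoundedBy E.m → s₂.reg (tmp t) = e.val E.inp s →
      (∀ u < t, s₂.reg (tmp u) = s₁.reg (tmp u)) → Safe E.inp E.m F k (K, s₂) ε) :
    Safe E.inp E.m F (k + e.cost) (e.comp t :: K, s₁) ε := by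
  induction e generalizing t k K s₁ with
  | lit c =>
    refine Safe.of_step_pure hb rfl ?_
    refine h _ (h₁.setTmp t c) (hb.setReg ?_) (by simp [State.setReg, val]) ?_
    · exact (lit c).val_lt_m E hs he hS
    · intro u hu
      have : tmp u ≠ tmp t := by unfold tmp; omega
      simp [State.setReg, hu.ne]
  | reg x =>
    refine Safe.of_step_pure hb rfl ?_
    simp only [Tame, bne_iff_ne] at he
    have hv : BinOp.land.eval (s₁.reg x) (s₁.reg x) = s.reg x := by
      change s₁.reg x &&& s₁.reg x = _
      rw [Nat.and_self, h₁.1 x he]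
    rw [hv]
    refine h _ (h₁.setTmp t _) (hb.setReg ((hs.1 x).trans_le E.B_le))
      (by simp [State.setReg, val]) ?_
    intro u hu
    simp [State.setReg, hu.ne]
  | bin o a b iha ihb =>
    have he' := he
    simp only [Tame, Bool.and_eq_true] at he
    have hS' : a.size + b.size ≤ E.S := hS
    have e1 : k + (bin o a b).cost = k + 1 + b.cost + 1 + a.cost + 1 := by
      simp only [cost]; ring
    rw [e1]
    refine Safe.of_step_pure hb rfl (iha he.2.1 (by omega) h₁ hb ?_)
    intro s₂ h₂ hb₂ hv₂ hu₂
    refine Safe.of_step_pure hb₂ rfl (ihb he.2.2 (by omega) h₂ hb₂ ?_)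
    intro s₃ h₃ hb₃ hv₃ hu₃
    refine Safe.of_step_pure hb₃ rfl ?_
    have hv : o.eval (s₃.reg (tmp t)) (s₃.reg (tmp (t + 1))) = (bin o a b).val E.inp s := by
      rw [hv₃, hu₃ t (by omega), hv₂]
      rfl
    rw [hv]
    refine h _ (h₃.setTmp t _) (hb₃.setReg ((bin o a b).val_lt_m E hs he' hS))
      (by simp [State.setReg]) ?_
    intro u hu
    rw [← hu₂ u hu, ← hu₃ u (by omega)]
    simp [State.setReg, hu.ne]
  | arr a i ih =>
    have e1 : k + (arr a i).cost = k + 1 + i.cost + 1 := by simp only [cost]; ring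
    rw [e1]
    refine Safe.of_step_pure hb rfl (ih he hS h₁ hb ?_)
    intro s₂ h₂ hb₂ hv₂ hu₂
    refine Safe.of_step_pure hb₂ rfl ?_
    have hv : s₂.arr a (s₂.reg (tmp t)) = (arr a i).val E.inp s := by
      rw [hv₂, h₂.2]
      rfl
    rw [hv]
    refine h _ (h₂.setTmp t _) (hb₂.setReg ((hs.2 _ _).trans_le E.B_le))
      (by simp [State.setReg]) ?_
    intro u hu
    rw [← hu₂ u hu]
    simp [State.setReg, hu.ne]
  | inp a i ih =>
    have e1 : k + (inp a i).cost = k + 1 + i.cost + 1 := by simp only [cost]; ring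
    rw [e1]
    refine Safe.of_step_pure hb rfl (ih he hS h₁ hb ?_)
    intro s₂ h₂ hb₂ hv₂ hu₂
    refine Safe.of_step_pure hb₂ rfl ?_
    have hv : E.inp a (s₂.reg (tmp t)) = (inp a i).val E.inp s := by
      rw [hv₂]
      rfl
    rw [hv]
    refine h _ (h₂.setTmp t _) (hb₂.setReg ((E.inp_lt _ _).trans_le E.B_le))
      (by simp [State.setReg]) ?_
    intro u hu
    rw [← hu₂ u hu]
    simp [State.setReg, hu.ne]
  | ite c a b ihc iha ihb =>
    simp only [Tame, Bool.and_eq_true] at he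
    have hS' : c.size + a.size + b.size ≤ E.S := hS
    have e1 : k + (ite c a b).cost = k + (a.cost + b.cost) + 1 + c.cost + 1 := by
      simp only [cost]; ring
    rw [e1]
    refine Safe.of_step_pure hb rfl (ihc he.1 (by omega) h₁ hb ?_)
    intro s₂ h₂ hb₂ hv₂ hu₂
    refine Safe.of_step_pure hb₂ rfl ?_
    by_cases hc : c.val E.inp s = 0
    · simp only [hv₂, hc, ne_eq, not_true_eq_false, if_false]
      refine (ihb he.2.2 (by omega) h₂ hb₂ ?_).mono (t := k + b.cost) (by omega) le_rfl
      intro s₃ h₃ hb₃ hv₃ hu₃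
      exact h _ h₃ hb₃ (by simp [val, hc, hv₃]) fun u hu => (hu₃ u hu).trans (hu₂ u hu)
    · simp only [hv₂, ne_eq, hc, not_false_eq_true, if_true]
      refine (iha he.2.1 (by omega) h₂ hb₂ ?_).mono (t := k + a.cost) (by omega) le_rfl
      intro s₃ h₃ hb₃ hv₃ hu₃
      exact h _ h₃ hb₃ (by simp [val, hc, hv₃]) fun u hu => (hu₃ u hu).trans (hu₂ u hu)

/-- `x := e`. -/
def assign (x : ℕ) (e : Expr) : Prog := .seq (e.comp 0) (.op .land x (tmp 0) (tmp 0))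

/-- `a[i] := v`. -/
def put (a : ℕ) (i v : Expr) : Prog :=
  .seq (i.comp 0) (.seq (v.comp 1) (.store a (tmp 0) (tmp 1)))

/-- If `e ≠ 0` then `p` else `q`. -/
def ifExpr (e : Expr) (p q : Prog) : Prog := .seq (e.comp 0) (.branch (tmp 0) p q)

/-- The body of `countdown`. -/
def countdownBody (x : ℕ) (p : Prog) : Prog :=
  .seq (assign x (.bin .sub (.reg x) (.lit 1))) p

/-- Execute `p` for `x = e - 1, …, 1, 0`. -/
def countdown (x : ℕ) (e : Expr) (p : Prog) : Prog :=
  .seq (assign x e) (.loop x (countdownBody x p))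

/-- Safety from an idealized state, which determines the actual one up to the temporaries. -/
def OK (E : Env) (F : State → ℝ≥0∞) (K : List Prog) (s : State) (k : ℕ) (ε : ℝ≥0∞) : Prop :=
  s.BoundedBy E.B → ∀ s₁, Sim s₁ s → s₁.BoundedBy E.m → Safe E.inp E.m F k (K, s₁) ε

/-- The deterministic program `p` leads from `s` to `s'` in at most `c` steps. -/
def Run (E : Env) (p : Prog) (s s' : State) (c : ℕ) : Prop :=
  ∀ (F : State → ℝ≥0∞) (K : List Prog) (k : ℕ) (ε : ℝ≥0∞),
    OK E F K s' k ε → OK E F (p :: K) s (k + c) ε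

theorem OK.mono {E : Env} {F : State → ℝ≥0∞} {K : List Prog} {s : State} {k k' : ℕ} {ε ε' : ℝ≥0∞}
    (h : OK E F K s k ε) (hk : k ≤ k') (hε : ε ≤ ε') : OK E F K s k' ε' :=
  fun hs s₁ h₁ hb => (h hs s₁ h₁ hb).mono hk hε

theorem Run.mono {E : Env} {p : Prog} {s s' : State} {c c' : ℕ} (h : Run E p s s' c)
    (hc : c ≤ c') : Run E p s s' c' :=
  fun F K k ε hk => (h F K k ε hk).mono (by omega) le_rfl

/-- Boundedness of the initial state may be assumed. -/
theorem Run.of_bounded {E : Env} {p : Prog} {s s' : State} {c : ℕ}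
    (h : s.BoundedBy E.B → Run E p s s' c) : Run E p s s' c :=
  fun F K k ε hk hs => h hs F K k ε hk hs

theorem Run.skip (E : Env) (s : State) : Run E .skip s s 1 :=
  fun _ _ _ _ hk hs s₁ h₁ hb => Safe.of_step_pure hb rfl (hk hs s₁ h₁ hb)

theorem OK.seq {E : Env} {F : State → ℝ≥0∞} {p q : Prog} {K : List Prog} {s : State} {k : ℕ}
    {ε : ℝ≥0∞} (h : OK E F (p :: q :: K) s k ε) : OK E F (.seq p q :: K) s (k + 1) ε :=
  fun hs s₁ h₁ hb => Safe.of_step_pure hb rfl (h hs s₁ h₁ hb)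

theorem Run.seq {E : Env} {p q : Prog} {s s' s'' : State} {c c' : ℕ} (hp : Run E p s s' c)
    (hq : Run E q s' s'' c') : Run E (.seq p q) s s'' (c + c' + 1) := by
  intro F K k ε hk
  have := (hp F (q :: K) _ ε (hq F K k ε hk)).seq
  exact this.mono (by omega) le_rfl

theorem Run.assign {E : Env} {x : ℕ} {e : Expr} {s : State} (he : e.Tame) (hS : e.size ≤ E.S)
    (hv : s.BoundedBy E.B → e.val E.inp s < E.B) :
    Run E (assign x e) s (s.setReg x (e.val E.inp s)) (e.cost + 2) := by
  intro F K k ε hk hs s₁ h₁ hb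
  have e1 : k + (e.cost + 2) = k + 1 + e.cost + 1 := by ring
  rw [e1]
  refine Safe.of_step_pure hb rfl (e.safe_comp E hs he hS h₁ hb ?_)
  intro s₂ h₂ hb₂ hv₂ _
  refine Safe.of_step_pure hb₂ rfl ?_
  have hv' : BinOp.land.eval (s₂.reg (tmp 0)) (s₂.reg (tmp 0)) = e.val E.inp s := by
    rw [hv₂]
    exact Nat.and_self _
  rw [hv']
  exact hk (hs.setReg (hv hs)) _ (h₂.setReg _ _) (hb₂.setReg ((hv hs).trans_le E.B_le))

theorem Run.put {E : Env} {a : ℕ} {i v : Expr} {s : State} (hi : i.Tame) (hiS : i.size ≤ E.S)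
    (hv : v.Tame) (hvS : v.size ≤ E.S) (hlt : s.BoundedBy E.B → v.val E.inp s < E.B) :
    Run E (put a i v) s (s.setArr a (i.val E.inp s) (v.val E.inp s)) (i.cost + v.cost + 3) := by
  intro F K k ε hk hs s₁ h₁ hb
  have e1 : k + (i.cost + v.cost + 3) = k + 1 + v.cost + 1 + i.cost + 1 := by ring
  rw [e1]
  refine Safe.of_step_pure hb rfl (i.safe_comp E hs hi hiS h₁ hb ?_)
  intro s₂ h₂ hb₂ hv₂ _
  refine Safe.of_step_pure hb₂ rfl (v.safe_comp E hs hv hvS h₂ hb₂ ?_)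
  intro s₃ h₃ hb₃ hv₃ hu₃
  refine Safe.of_step_pure hb₃ rfl ?_
  rw [hu₃ 0 one_pos, hv₂, hv₃]
  exact hk (hs.setArr (hlt hs)) _ (h₃.setArr _ _ _) (hb₃.setArr ((hlt hs).trans_le E.B_le))

theorem Run.ifExpr_pos {E : Env} {e : Expr} {p q : Prog} {s s' : State} {c : ℕ} (he : e.Tame)
    (hS : e.size ≤ E.S) (h : e.val E.inp s ≠ 0) (hp : Run E p s s' c) :
    Run E (ifExpr e p q) s s' (e.cost + c + 2) := by
  intro F K k ε hk hs s₁ h₁ hb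
  have e1 : k + (e.cost + c + 2) = k + c + 1 + e.cost + 1 := by ring
  rw [e1]
  refine Safe.of_step_pure hb rfl (e.safe_comp E hs he hS h₁ hb ?_)
  intro s₂ h₂ hb₂ hv₂ _
  refine Safe.of_step_pure hb₂ rfl ?_
  rw [if_pos (by rwa [hv₂])]
  exact hp F K k ε hk hs s₂ h₂ hb₂

theorem Run.ifExpr_neg {E : Env} {e : Expr} {p q : Prog} {s s' : State} {c : ℕ} (he : e.Tame)
    (hS : e.size ≤ E.S) (h : e.val E.inp s = 0) (hq : Run E q s s' c) :
    Run E (ifExpr e p q) s s' (e.cost + c + 2) := by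
  intro F K k ε hk hs s₁ h₁ hb
  have e1 : k + (e.cost + c + 2) = k + c + 1 + e.cost + 1 := by ring
  rw [e1]
  refine Safe.of_step_pure hb rfl (e.safe_comp E hs he hS h₁ hb ?_)
  intro s₂ h₂ hb₂ hv₂ _
  refine Safe.of_step_pure hb₂ rfl ?_
  rw [if_neg (by rw [hv₂, h]; simp)]
  exact hq F K k ε hk hs s₂ h₂ hb₂

theorem OK.ifExpr_pos {E : Env} {F : State → ℝ≥0∞} {e : Expr} {p q : Prog} {K : List Prog}
    {s : State} {k : ℕ} {ε : ℝ≥0∞} (he : e.Tame) (hS : e.size ≤ E.S) (h : e.val E.inp s ≠ 0)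
    (hp : OK E F (p :: K) s k ε) : OK E F (ifExpr e p q :: K) s (k + (e.cost + 2)) ε := by
  intro hs s₁ h₁ hb
  have e1 : k + (e.cost + 2) = k + 1 + e.cost + 1 := by ring
  rw [e1]
  refine Safe.of_step_pure hb rfl (e.safe_comp E hs he hS h₁ hb ?_)
  intro s₂ h₂ hb₂ hv₂ _
  refine Safe.of_step_pure hb₂ rfl ?_
  rw [if_pos (by rwa [hv₂])]
  exact hp hs s₂ h₂ hb₂

theorem OK.loop_zero {E : Env} {F : State → ℝ≥0∞} {x : ℕ} {p : Prog} {K : List Prog} {s : State}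
    {k : ℕ} {ε : ℝ≥0∞} (hx : x % 3 ≠ 1) (h0 : s.reg x = 0) (h : OK E F K s k ε) :
    OK E F (.loop x p :: K) s (k + 1) ε := by
  intro hs s₁ h₁ hb
  refine Safe.of_step_pure hb rfl ?_
  rw [if_neg (by rw [h₁.1 x hx, h0]; simp)]
  exact h hs s₁ h₁ hb

theorem OK.loop_pos {E : Env} {F : State → ℝ≥0∞} {x : ℕ} {p : Prog} {K : List Prog} {s : State}
    {k : ℕ} {ε : ℝ≥0∞} (hx : x % 3 ≠ 1) (h0 : s.reg x ≠ 0)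
    (h : OK E F (p :: .loop x p :: K) s k ε) : OK E F (.loop x p :: K) s (k + 1) ε := by
  intro hs s₁ h₁ hb
  refine Safe.of_step_pure hb rfl ?_
  rw [if_pos (by rwa [h₁.1 x hx])]
  exact h hs s₁ h₁ hb

/-- One iteration of a countdown loop. -/
theorem OK.countdown_step {E : Env} {F : State → ℝ≥0∞} {x : ℕ} {p : Prog} {K : List Prog}
    {s : State} {i k : ℕ} {ε : ℝ≥0∞} (hx : x % 3 ≠ 1) (hS : 2 ≤ E.S) (hi : s.reg x = i + 1)
    (h : OK E F (p :: .loop x (countdownBody x p) :: K) (s.setReg x i) k ε) :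
    OK E F (.loop x (countdownBody x p) :: K) s (k + 9) ε := by
  have hval : (Expr.bin .sub (.reg x) (.lit 1)).val E.inp s = i := by
    simp [Expr.val, BinOp.eval, hi]
  have hrun : Run E (assign x (.bin .sub (.reg x) (.lit 1))) s (s.setReg x i) 7 := by
    have := Run.assign (E := E) (x := x) (e := .bin .sub (.reg x) (.lit 1)) (s := s)
      (by simp [Expr.Tame, BinOp.Tame, hx]) hS (fun hs => by rw [hval]; have := hs.1 x; omega)
    rwa [hval] at this
  exact OK.loop_pos hx (by omega) ((hrun F _ _ _ h).seq)

theorem Run.countdown {E : Env} {x n c : ℕ} {e : Expr} {p : Prog} {s : State} (hx : x % 3 ≠ 1)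
    (hS2 : 2 ≤ E.S) (he : e.Tame) (hS : e.size ≤ E.S) (hn : e.val E.inp s = n)
    (hv : s.BoundedBy E.B → n < E.B) (I : ℕ → State → Prop) (h0 : I n (s.setReg x n))
    (hstep : ∀ i < n, ∀ s, I (i + 1) s → s.reg x = i + 1 →
      ∃ s', Run E p (s.setReg x i) s' c ∧ I i s' ∧ s'.reg x = i) :
    ∃ s', Run E (countdown x e p) s s' (n * (c + 9) + e.cost + 4) ∧ I 0 s' ∧ s'.reg x = 0 := by
  have key : ∀ i ≤ n, ∀ s, I i s → s.reg x = i →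
      ∃ s', Run E (.loop x (countdownBody x p)) s s' (i * (c + 9) + 1) ∧ I 0 s' ∧ s'.reg x = 0 := by
    intro i
    induction i with
    | zero =>
      intro _ s hI hx0
      exact ⟨s, fun F K k ε hk => (OK.loop_zero hx hx0 hk).mono (by omega) le_rfl, hI, hx0⟩
    | succ i ih =>
      intro hi s hI hxi
      obtain ⟨s₁, hr₁, hI₁, hx₁⟩ := hstep i hi s hI hxi
      obtain ⟨s₂, hr₂, hI₂, hx₂⟩ := ih (by omega) s₁ hI₁ hx₁
      refine ⟨s₂, fun F K k ε hk => ?_, hI₂, hx₂⟩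
      have := OK.countdown_step hx hS2 hxi (hr₁ F _ _ _ (hr₂ F K k ε hk))
      refine this.mono ?_ le_rfl
      rw [add_mul]
      omega
  obtain ⟨s', hr, hI, hx'⟩ := key n le_rfl _ h0 (by simp [State.setReg])
  refine ⟨s', ?_, hI, hx'⟩
  have ha := Run.assign (E := E) (x := x) (e := e) (s := s) he hS (by rwa [hn])
  rw [hn] at ha
  exact (ha.seq hr).mono (by omega)

end WordRAM

namespace WordRAM

/-! ### Simulation of a program as a subroutine -/

/-- The register that holds the number of the current subroutine call. -/
abbrev epochReg : ℕ := 3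

/-- The register that stands for register `x` of the simulated machine. -/
abbrev vreg (x : ℕ) : ℕ := 3 * x + 2

/-- The array that stands for array `a` of the simulated machine. -/
abbrev valArr (a : ℕ) : ℕ := 2 * a + 1

/-- The array that records, for each entry of array `a` of the simulated machine, in which call it
was last written. Entries written in earlier calls count as `0`, so that no memory has to be
cleared between the calls. -/
abbrev stampArr (a : ℕ) : ℕ := 2 * a + 2

/-- The entry with index `i` of array `a` of the simulated machine. Stamps never exceed the current
epoch, so the truncated difference vanishes only for entries of the current call. -/
def virtEntry (a : ℕ) (i : Expr) : Expr :=
  .ite (.bin .sub (.reg epochReg) (.arr (stampArr a) i)) (.lit 0) (.arr (valArr a) i)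

/-- The translation of a program into a subroutine, where the expression `rd a r` stands for the
entry of the input array `a` whose index is in register `r`. -/
def virt (rd : ℕ → ℕ → Expr) : Prog → Prog
  | .skip => .skip
  | .const x c => .const (vreg x) c
  | .op o x y z => .op o (vreg x) (vreg y) (vreg z)
  | .load x a y => assign (vreg x) (virtEntry a (.reg (vreg y)))
  | .store a y z =>
      .seq (.store (valArr a) (vreg y) (vreg z)) (.store (stampArr a) (vreg y) epochReg)
  | .read x a y => assign (vreg x) (rd a (vreg y))
  | .rand x y => .rand (vreg x) (vreg y)
  | .seq p q => .seq (virt rd p) (virt rd q)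
  | .branch x p q => .branch (vreg x) (virt rd p) (virt rd q)
  | .loop x p => .loop (vreg x) (virt rd p)

/-- All registers of the program are below `W`. -/
def UsesBelow (W : ℕ) : Prog → Prop
  | .skip => True
  | .const x _ => x < W
  | .op _ x y z => x < W ∧ y < W ∧ z < W
  | .load x _ y => x < W ∧ y < W
  | .store _ y z => y < W ∧ z < W
  | .read x _ y => x < W ∧ y < W
  | .rand x y => x < W ∧ y < W
  | .seq p q => UsesBelow W p ∧ UsesBelow W q
  | .branch x p q => x < W ∧ UsesBelow W p ∧ UsesBelow W q
  | .loop x p => x < W ∧ UsesBelow W p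

theorem UsesBelow.mono {W W' : ℕ} (h : W ≤ W') {p : Prog} (hp : UsesBelow W p) :
    UsesBelow W' p := by
  induction p with
  | seq p q ihp ihq => exact ⟨ihp hp.1, ihq hp.2⟩
  | branch x p q ihp ihq => exact ⟨hp.1.trans_le h, ihp hp.2.1, ihq hp.2.2⟩
  | loop x p ih => exact ⟨hp.1.trans_le h, ih hp.2⟩
  | _ => simp only [UsesBelow] at hp ⊢ <;> omega

theorem exists_usesBelow (p : Prog) : ∃ W, UsesBelow W p := by
  induction p with
  | skip => exact ⟨0, trivial⟩
  | const x c => exact ⟨x + 1, Nat.lt_succ_self x⟩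
  | op o x y z => exact ⟨x + y + z + 1, by simp only [UsesBelow]; omega⟩
  | load x a y => exact ⟨x + y + 1, by simp only [UsesBelow]; omega⟩
  | store a y z => exact ⟨y + z + 1, by simp only [UsesBelow]; omega⟩
  | read x a y => exact ⟨x + y + 1, by simp only [UsesBelow]; omega⟩
  | rand x y => exact ⟨x + y + 1, by simp only [UsesBelow]; omega⟩
  | seq p q ihp ihq =>
    obtain ⟨W, hW⟩ := ihp
    obtain ⟨W', hW'⟩ := ihq
    exact ⟨W + W', hW.mono (by omega), hW'.mono (by omega)⟩
  | branch x p q ihp ihq =>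
    obtain ⟨W, hW⟩ := ihp
    obtain ⟨W', hW'⟩ := ihq
    exact ⟨x + 1 + W + W', by omega, hW.mono (by omega), hW'.mono (by omega)⟩
  | loop x p ih =>
    obtain ⟨W, hW⟩ := ih
    exact ⟨x + 1 + W, by omega, hW.mono (by omega)⟩

/-- The two states agree on the variables and on array `0`, the data a subroutine may not touch. -/
def SameVars (s s' : State) : Prop := (∀ i, s.reg (3 * i) = s'.reg (3 * i)) ∧ s.arr 0 = s'.arr 0

/-- In state `s`, the simulated machine is in state `σ` (as far as its first `W` registers are
concerned), and the variables are the same as in `s₀`. -/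
structure Represents (s₀ : State) (W : ℕ) (s σ : State) : Prop where
  reg : ∀ x < W, s.reg (vreg x) = σ.reg x
  arr : ∀ a y, σ.arr a y =
    if s.arr (stampArr a) y = s.reg epochReg then s.arr (valArr a) y else 0
  stamp : ∀ a y, s.arr (stampArr a) y ≤ s.reg epochReg
  vars : SameVars s s₀

theorem Represents.setReg {s₀ s σ : State} {W x : ℕ} (h : Represents s₀ W s σ) (v : ℕ) :
    Represents s₀ W (s.setReg (vreg x) v) (σ.setReg x v) := by
  have he : epochReg ≠ vreg x := by unfold epochReg vreg; omega
  refine ⟨fun y hy => ?_, ?_, ?_, ?_⟩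
  · by_cases hyx : y = x
    · subst hyx
      simp [State.setReg]
    · have : vreg y ≠ vreg x := by unfold vreg; omega
      simpa [State.setReg, hyx] using h.reg y hy
  · intro a y
    simpa [State.setReg, he] using h.arr a y
  · intro a y
    simpa [State.setReg, he] using h.stamp a y
  · refine ⟨fun i => ?_, h.vars.2⟩
    have : 3 * i ≠ vreg x := by unfold vreg; omega
    simpa [State.setReg, this] using h.vars.1 i

theorem vreg_mod (x : ℕ) : vreg x % 3 ≠ 1 := by unfold vreg; omega

theorem State.setArr_arr_of_ne {s : State} {a b : ℕ} (h : b ≠ a) (i v : ℕ) :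
    (s.setArr a i v).arr b = s.arr b :=
  Function.update_of_ne h _ _

theorem State.setArr_arr_self (s : State) (a i v : ℕ) :
    (s.setArr a i v).arr a = Function.update (s.arr a) i v :=
  Function.update_self _ _ _

theorem Represents.setArr {s₀ s σ : State} {W : ℕ} (h : Represents s₀ W s σ) (a i v : ℕ) :
    Represents s₀ W ((s.setArr (valArr a) i v).setArr (stampArr a) i (s.reg epochReg))
      (σ.setArr a i v) := by
  refine ⟨h.reg, ?_, ?_, h.vars.1, ?_⟩
  · intro b y
    have h2 : stampArr b ≠ valArr a := by unfold stampArr valArr; omega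
    have h3 : valArr b ≠ stampArr a := by unfold stampArr valArr; omega
    have h0 := h.arr b y
    change _ = if _ = s.reg epochReg then _ else _
    by_cases hb : b = a
    · subst hb
      rw [State.setArr_arr_self, State.setArr_arr_self, State.setArr_arr_of_ne h2,
        State.setArr_arr_of_ne h3, State.setArr_arr_self]
      by_cases hy : y = i
      · subst hy
        simp
      · simpa [hy] using h0
    · have h4 : stampArr b ≠ stampArr a := by unfold stampArr; omega
      have h5 : valArr b ≠ valArr a := by unfold valArr; omega
      rwa [State.setArr_arr_of_ne hb, State.setArr_arr_of_ne h4, State.setArr_arr_of_ne h2,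
        State.setArr_arr_of_ne h3, State.setArr_arr_of_ne h5]
  · intro b y
    have h2 : stampArr b ≠ valArr a := by unfold stampArr valArr; omega
    have h0 := h.stamp b y
    change _ ≤ s.reg epochReg
    by_cases hb : b = a
    · subst hb
      rw [State.setArr_arr_self, State.setArr_arr_of_ne h2]
      by_cases hy : y = i
      · subst hy
        simp
      · simpa [hy] using h0
    · have h4 : stampArr b ≠ stampArr a := by unfold stampArr; omega
      rwa [State.setArr_arr_of_ne h4, State.setArr_arr_of_ne h2]
  · have h2 : 0 ≠ valArr a := by unfold valArr; omega
    have h3 : 0 ≠ stampArr a := by unfold stampArr; omega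
    rw [State.setArr_arr_of_ne h3, State.setArr_arr_of_ne h2]
    exact h.vars.2

theorem Represents.virtEntry {s₀ s σ : State} {W : ℕ} (h : Represents s₀ W s σ)
    (I : ℕ → ℕ → ℕ) (a : ℕ) (i : Expr) :
    (virtEntry a i).val I s = σ.arr a (i.val I s) := by
  have h1 := h.stamp a (i.val I s)
  rw [h.arr]
  change (if s.reg epochReg - s.arr (stampArr a) (i.val I s) ≠ 0 then 0
    else s.arr (valArr a) (i.val I s)) = _
  by_cases he : s.arr (stampArr a) (i.val I s) = s.reg epochReg
  · simp [he]
  · rw [if_pos (by omega), if_neg he]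

theorem Run.const {E : Env} {x c : ℕ} {s : State} (hc : c < E.B) :
    Run E (.const x c) s (s.setReg x c) 1 :=
  fun _ _ _ _ hk hs _ h₁ hb => Safe.of_step_pure hb rfl
    (hk (hs.setReg hc) _ (h₁.setReg _ _) (hb.setReg (hc.trans_le E.B_le)))

theorem Run.op {E : Env} {o : BinOp} {x y z : ℕ} {s : State} (hy : y % 3 ≠ 1) (hz : z % 3 ≠ 1)
    (hv : o.eval (s.reg y) (s.reg z) < E.B) :
    Run E (.op o x y z) s (s.setReg x (o.eval (s.reg y) (s.reg z))) 1 := by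
  intro F K k ε hk hs s₁ h₁ hb
  refine Safe.of_step_pure hb rfl ?_
  rw [h₁.1 y hy, h₁.1 z hz]
  exact hk (hs.setReg hv) _ (h₁.setReg _ _) (hb.setReg (hv.trans_le E.B_le))

theorem Run.store {E : Env} {a y z : ℕ} {s : State} (hy : y % 3 ≠ 1) (hz : z % 3 ≠ 1) :
    Run E (.store a y z) s (s.setArr a (s.reg y) (s.reg z)) 1 := by
  intro F K k ε hk hs s₁ h₁ hb
  refine Safe.of_step_pure hb rfl ?_
  rw [h₁.1 y hy, h₁.1 z hz]
  exact hk (hs.setArr (hs.1 z)) _ (h₁.setArr _ _ _) (hb.setArr ((hs.1 z).trans_le E.B_le))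

theorem OK.rand {E : Env} {F : State → ℝ≥0∞} {x y n k : ℕ} {K : List Prog} {s : State}
    (hy : y % 3 ≠ 1) (hn : s.reg y = n) (e : Fin (n + 1) → ℝ≥0∞)
    (h : ∀ v : Fin (n + 1), OK E F K (s.setReg x v) k (e v)) :
    OK E F (.rand x y :: K) s (k + 1)
      (∑' v, PMF.uniformOfFintype (Fin (n + 1)) v * e v) := by
  intro hs s₁ h₁ hb
  have hn' : s₁.reg y = n := (h₁.1 y hy).trans hn
  have hnB : n < E.B := hn ▸ hs.1 y
  subst hn'
  refine Safe.of_step_map hb _ _ rfl e fun v _ => ?_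
  have hv : v.val < E.B := by omega
  exact h v (hs.setReg hv) _ (h₁.setReg _ _) (hb.setReg (hv.trans_le E.B_le))

theorem run_succ_of_pure {inp : ℕ → ℕ → ℕ} {c c' : Config} (h : step inp c = PMF.pure c') (t : ℕ) :
    run inp (t + 1) c = run inp t c' := by
  change (step inp c).bind (run inp t) = _
  rw [h, PMF.pure_bind]

theorem run_succ_of_map {inp : ℕ → ℕ → ℕ} {α : Type} {c : Config} {p : PMF α} {f : α → Config}
    (h : step inp c = p.map f) (t : ℕ) :
    run inp (t + 1) c = p.bind fun v => run inp t (f v) := by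
  change (step inp c).bind (run inp t) = _
  rw [h, PMF.bind_map]
  rfl

/-- The translated program behaves like the original one on the input `vinp`, with a constant
factor of slowdown `C`: if it is safe to continue with `K₀` at cost `G σ` from every final state `σ`
of the original program, then it is safe to start the translated one at the expected cost. -/
theorem OK.simulate {E : Env} {F : State → ℝ≥0∞} {rd : ℕ → ℕ → Expr} {vinp : ℕ → ℕ → ℕ}
    {W C k Mv : ℕ} {s₀ : State} {K₀ : List Prog} {G : State → ℝ≥0∞} {P : State → Prop}
    (hMv : Mv ≤ E.B)
    (hrd : ∀ a y, (rd a (vreg y)).Tame ∧ (rd a (vreg y)).size ≤ E.S ∧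
      (rd a (vreg y)).cost + 2 ≤ C)
    (hval : ∀ a y s, SameVars s s₀ → (rd a (vreg y)).val E.inp s = vinp a (s.reg (vreg y)))
    (hC : 20 ≤ C) (hS : 4 ≤ E.S)
    (hG : ∀ s σ, Represents s₀ W s σ → P σ → OK E F K₀ s k (G σ)) (T : ℕ) :
    ∀ (K : List Prog) (σ s : State), (∀ p ∈ K, UsesBelow W p) →
      (∀ t, ∀ c ∈ (run vinp t (K, σ)).support, c.2.BoundedBy Mv) →
      (∀ c ∈ (run vinp T (K, σ)).support, c.1 = [] ∧ P c.2) →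
      Represents s₀ W s σ →
      OK E F (K.map (virt rd) ++ K₀) s (k + C * T) (∑' c, run vinp T (K, σ) c * G c.2) := by
  induction T with
  | zero =>
    intro K σ s _ _ hhalt hrep
    change ∀ c ∈ (PMF.pure (K, σ)).support, c.1 = [] ∧ P c.2 at hhalt
    obtain ⟨hK, hP⟩ : K = [] ∧ P σ := hhalt (K, σ) (by simp)
    subst hK
    change OK E F K₀ s k (∑' c, PMF.pure (([], σ) : Config) c * G c.2)
    rw [tsum_pure_mul]
    exact hG s σ hrep hP
  | succ T ih =>
    intro K σ s huse hbd hhalt hrep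
    cases K with
    | nil =>
      have hst : step vinp ([], σ) = PMF.pure ([], σ) := rfl
      rw [run_succ_of_pure hst]
      rw [run_succ_of_pure hst] at hhalt
      exact (ih [] σ s huse hbd hhalt hrep).mono (by rw [mul_add]; omega) le_rfl
    | cons p K =>
      have huseK : ∀ q ∈ K, UsesBelow W q := fun q hq => huse q (List.mem_cons_of_mem _ hq)
      have hp : UsesBelow W p := huse p List.mem_cons_self
      -- deterministic steps
      have adv : ∀ (K' : List Prog) (σ' s' : State), step vinp (p :: K, σ) = PMF.pure (K', σ') →
          (∀ q ∈ K', UsesBelow W q) → (σ'.BoundedBy Mv → Represents s₀ W s' σ') →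
          (σ'.BoundedBy Mv → ∀ k' ε, OK E F (K'.map (virt rd) ++ K₀) s' k' ε →
            OK E F (virt rd p :: (K.map (virt rd) ++ K₀)) s (k' + C) ε) →
          OK E F ((p :: K).map (virt rd) ++ K₀) s (k + C * (T + 1))
            (∑' c, run vinp (T + 1) (p :: K, σ) c * G c.2) := by
        intro K' σ' s' hst hu hr hrun
        have hb' : ∀ t, ∀ c ∈ (run vinp t (K', σ')).support, c.2.BoundedBy Mv := by
          intro t c hc
          exact hbd (t + 1) c (by rwa [run_succ_of_pure hst])
        have hσ' : σ'.BoundedBy Mv :=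
          hb' 0 (K', σ') (by change _ ∈ (PMF.pure (K', σ')).support; simp)
        rw [run_succ_of_pure hst] at hhalt ⊢
        rw [mul_add, mul_one, ← add_assoc]
        exact hrun hσ' _ _ (ih K' σ' s' hu hb' hhalt (hr hσ'))
      cases p with
      | skip =>
        exact adv K σ s rfl huseK (fun _ => hrep) fun _ k' ε h =>
          (Run.skip E s F _ _ _ h).mono (by omega) le_rfl
      | const x c =>
        refine adv K _ (s.setReg (vreg x) c) rfl huseK (fun _ => hrep.setReg c) fun hσ k' ε h => ?_
        have hc : c < Mv := by simpa [State.setReg] using hσ.1 x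
        exact (Run.const (hc.trans_le hMv) F _ _ _ h).mono (by omega) le_rfl
      | op o x y z =>
        obtain ⟨hx, hy, hz⟩ := hp
        refine adv K _ (s.setReg (vreg x) (o.eval (s.reg (vreg y)) (s.reg (vreg z)))) rfl huseK
          (fun _ => ?_) fun hσ k' ε h => ?_
        · rw [hrep.reg y hy, hrep.reg z hz]
          exact hrep.setReg _
        · have hc : o.eval (σ.reg y) (σ.reg z) < Mv := by simpa [State.setReg] using hσ.1 x
          rw [← hrep.reg y hy, ← hrep.reg z hz] at hc
          exact (Run.op (vreg_mod _) (vreg_mod _) (hc.trans_le hMv) F _ _ _ h).mono (by omega) le_rfl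
      | load x a y =>
        obtain ⟨hx, hy⟩ := hp
        have hv : (virtEntry a (.reg (vreg y))).val E.inp s = σ.arr a (σ.reg y) := by
          rw [hrep.virtEntry, ← hrep.reg y hy]
          rfl
        refine adv K _ (s.setReg (vreg x) (σ.arr a (σ.reg y))) rfl huseK
          (fun _ => hrep.setReg _) fun hσ k' ε h => ?_
        have hc : σ.arr a (σ.reg y) < Mv := by simpa [State.setReg] using hσ.1 x
        have hrun := Run.assign (E := E) (x := vreg x) (e := virtEntry a (.reg (vreg y))) (s := s)
          (by simp [virtEntry, Expr.Tame, BinOp.Tame]) hS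
          (fun _ => by rw [hv]; exact hc.trans_le hMv)
        rw [hv] at hrun
        exact (hrun F _ _ _ h).mono (by simp only [virtEntry, Expr.cost]; omega) le_rfl
      | store a y z =>
        obtain ⟨hy, hz⟩ := hp
        refine adv K _ ((s.setArr (valArr a) (σ.reg y) (σ.reg z)).setArr (stampArr a) (σ.reg y)
          (s.reg epochReg)) rfl huseK (fun _ => hrep.setArr a _ _) fun hσ k' ε h => ?_
        have h1 := Run.store (E := E) (a := valArr a) (y := vreg y) (z := vreg z) (s := s)
          (vreg_mod _) (vreg_mod _)
        rw [hrep.reg y hy, hrep.reg z hz] at h1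
        have h2 := Run.store (E := E) (a := stampArr a) (y := vreg y) (z := epochReg)
          (s := s.setArr (valArr a) (σ.reg y) (σ.reg z)) (vreg_mod _) (by decide)
        have h3 : (s.setArr (valArr a) (σ.reg y) (σ.reg z)).reg (vreg y) = σ.reg y := hrep.reg y hy
        rw [h3] at h2
        exact (h1.seq h2 F _ _ _ h).mono (by omega) le_rfl
      | read x a y =>
        obtain ⟨hx, hy⟩ := hp
        have hv := hval a y s hrep.vars
        rw [hrep.reg y hy] at hv
        refine adv K _ (s.setReg (vreg x) (vinp a (σ.reg y))) rfl huseK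
          (fun _ => hrep.setReg _) fun hσ k' ε h => ?_
        have hc : vinp a (σ.reg y) < Mv := by simpa [State.setReg] using hσ.1 x
        have hrun := Run.assign (E := E) (x := vreg x) (e := rd a (vreg y)) (s := s)
          (hrd a y).1 (hrd a y).2.1 (fun _ => by rw [hv]; exact hc.trans_le hMv)
        rw [hv] at hrun
        exact (hrun F _ _ _ h).mono (by have := (hrd a y).2.2; omega) le_rfl
      | rand x y =>
        obtain ⟨hx, hy⟩ := hp
        have hst : step vinp (.rand x y :: K, σ) =
            (PMF.uniformOfFintype (Fin (σ.reg y + 1))).map fun v : Fin (σ.reg y + 1) =>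
              (K, σ.setReg x v.val) := rfl
        rw [run_succ_of_map hst, tsum_bind_mul]
        rw [run_succ_of_map hst] at hhalt
        have hb' : ∀ v : Fin (σ.reg y + 1), ∀ t,
            ∀ c ∈ (run vinp t (K, σ.setReg x v.val)).support, c.2.BoundedBy Mv := by
          intro v t c hc
          refine hbd (t + 1) c ?_
          rw [run_succ_of_map hst, PMF.mem_support_bind_iff]
          exact ⟨v, by simp, hc⟩
        refine (OK.rand (vreg_mod _) (hrep.reg y hy) _ fun v => ih K (σ.setReg x v)
          (s.setReg (vreg x) v) huseK (hb' v) (fun c hc => hhalt c ?_) (hrep.setReg _)).mono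
          (k := k + C * T + 1) (by rw [mul_add]; omega) le_rfl
        rw [PMF.mem_support_bind_iff]
        exact ⟨v, by simp, hc⟩
      | seq p q =>
        refine adv (p :: q :: K) σ s rfl ?_ (fun _ => hrep) fun _ k' ε h =>
          (OK.seq h).mono (by omega) le_rfl
        intro r hr
        rcases List.mem_cons.1 hr with rfl | hr
        · exact hp.1
        rcases List.mem_cons.1 hr with rfl | hr
        · exact hp.2
        · exact huseK r hr
      | branch x p q =>
        obtain ⟨hx, hp, hq⟩ := hp
        have hxx := hrep.reg x hx
        by_cases h0 : σ.reg x = 0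
        · refine adv (q :: K) σ s (by simp [step, h0]) ?_ (fun _ => hrep) fun _ k' ε h => ?_
          · intro r hr
            rcases List.mem_cons.1 hr with rfl | hr
            · exact hq
            · exact huseK r hr
          · intro hs s₁ h₁ hb
            refine (Safe.of_step_pure hb rfl ?_ : Safe _ _ _ (k' + 1) _ _).mono (by omega) le_rfl
            rw [h₁.1 _ (vreg_mod _), hxx, if_neg (by simpa using h0)]
            exact h hs s₁ h₁ hb
        · refine adv (p :: K) σ s (by simp [step, h0]) ?_ (fun _ => hrep) fun _ k' ε h => ?_
          · intro r hr
            rcases List.mem_cons.1 hr with rfl | hr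
            · exact hp
            · exact huseK r hr
          · intro hs s₁ h₁ hb
            refine (Safe.of_step_pure hb rfl ?_ : Safe _ _ _ (k' + 1) _ _).mono (by omega) le_rfl
            rw [h₁.1 _ (vreg_mod _), hxx, if_pos h0]
            exact h hs s₁ h₁ hb
      | loop x p =>
        obtain ⟨hx, hp'⟩ := hp
        have hxx := hrep.reg x hx
        by_cases h0 : σ.reg x = 0
        · refine adv K σ s (by simp [step, h0]) huseK (fun _ => hrep) fun _ k' ε h => ?_
          exact (OK.loop_zero (vreg_mod _) (hxx.trans h0) h).mono (by omega) le_rfl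
        · refine adv (p :: .loop x p :: K) σ s (by simp [step, h0]) ?_ (fun _ => hrep)
            fun _ k' ε h => ?_
          · intro r hr
            rcases List.mem_cons.1 hr with rfl | hr
            · exact hp'
            · exact huse r hr
          · exact (OK.loop_pos (vreg_mod _) (by rwa [hxx]) h).mono (by omega) le_rfl

/-- Set the first `W` registers of the simulated machine to `0`. -/
def clearRegs : ℕ → Prog
  | 0 => .skip
  | W + 1 => .seq (clearRegs W) (.const (vreg W) 0)

theorem run_clearRegs (E : Env) (W : ℕ) (s : State) :
    ∃ s', Run E (clearRegs W) s s' (2 * W + 1) ∧ (∀ x < W, s'.reg (vreg x) = 0) ∧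
      (∀ i, s'.reg (3 * i) = s.reg (3 * i)) ∧ s'.arr = s.arr := by
  induction W with
  | zero => exact ⟨s, Run.skip E s, by simp, fun _ => rfl, rfl⟩
  | succ W ih =>
    obtain ⟨s', hr, hx, hi, ha⟩ := ih
    refine ⟨s'.setReg (vreg W) 0,
      (hr.seq (Run.const (by have := E.le_B; omega))).mono (by omega), ?_, ?_, ha⟩
    · intro x hxW
      by_cases h : x = W
      · subst h
        simp [State.setReg]
      · simpa [State.setReg, h] using hx x (by omega)
    · intro i
      have : 3 * i ≠ vreg W := by unfold vreg; omega
      simpa [State.setReg, this] using hi i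

/-- A call of the subroutine, from a blank memory of the simulated machine. -/
def call (W : ℕ) (rd : ℕ → ℕ → Expr) (p : Prog) : Prog :=
  .seq (clearRegs W) (.seq (assign epochReg (.bin .add (.reg epochReg) (.lit 1))) (virt rd p))

/-- No entry has been written in a call that is still to come. -/
def StampsOld (s : State) : Prop := ∀ a y, s.arr (stampArr a) y ≤ s.reg epochReg

/-- The outcome of a call is distributed like that of the original program, started afresh. Raising
the epoch is what turns all array entries of the simulated machine to `0`. -/
theorem OK.call {E : Env} {F : State → ℝ≥0∞} {rd : ℕ → ℕ → Expr} {vinp : ℕ → ℕ → ℕ}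
    {W C k Mv T : ℕ} {s : State} {K : List Prog} {G : State → ℝ≥0∞} {P : State → Prop}
    {p : Prog} (hMv : Mv ≤ E.B)
    (hrd : ∀ a y, (rd a (vreg y)).Tame ∧ (rd a (vreg y)).size ≤ E.S ∧
      (rd a (vreg y)).cost + 2 ≤ C)
    (hval : ∀ a y s', SameVars s' (s.setReg epochReg (s.reg epochReg + 1)) →
      (rd a (vreg y)).val E.inp s' = vinp a (s'.reg (vreg y)))
    (hC : 20 ≤ C) (hS : 4 ≤ E.S) (hp : UsesBelow W p)
    (hbd : ∀ t, ∀ c ∈ (run vinp t ([p], State.zero)).support, c.2.BoundedBy Mv)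
    (hhalt : ∀ c ∈ (run vinp T ([p], State.zero)).support, c.1 = [] ∧ P c.2)
    (hold : StampsOld s) (hepoch : s.reg epochReg + 1 < E.B)
    (hG : ∀ s' σ, Represents (s.setReg epochReg (s.reg epochReg + 1)) W s' σ →
      P σ → OK E F K s' k (G σ)) :
    OK E F (call W rd p :: K) s (k + C * T + (2 * W + 20))
      (∑' c, run vinp T ([p], State.zero) c * G c.2) := by
  obtain ⟨s₁, hr, hx, hi, ha⟩ := run_clearRegs E W s
  have he : s₁.reg epochReg = s.reg epochReg := hi 1
  have hv : (Expr.bin .add (.reg epochReg) (.lit 1)).val E.inp s₁ = s.reg epochReg + 1 := by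
    simp [Expr.val, BinOp.eval, he]
  have hr₂ := Run.assign (E := E) (x := epochReg) (e := .bin .add (.reg epochReg) (.lit 1))
    (s := s₁) (by decide) (by simp only [Expr.size]; omega) (fun _ => by rwa [hv])
  rw [hv] at hr₂
  have hrep : Represents (s.setReg epochReg (s.reg epochReg + 1)) W
      (s₁.setReg epochReg (s.reg epochReg + 1)) State.zero := by
    refine ⟨fun x hxW => ?_, fun a y => ?_, fun a y => ?_, fun i => ?_, ?_⟩
    · have : vreg x ≠ epochReg := by unfold epochReg vreg; omega
      simpa [State.setReg, this, State.zero] using hx x hxW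
    · have := hold a y
      simp only [State.setReg, ha, State.zero, Function.update_self]
      rw [if_neg (by omega)]
    · have := hold a y
      simp only [State.setReg, ha, Function.update_self]
      omega
    · by_cases h : 3 * i = epochReg
      · simp [State.setReg, h]
      · simpa [State.setReg, h] using hi i
    · simp only [State.setReg, ha]
  have key := OK.simulate hMv hrd hval hC hS hG T [p] State.zero _ (by simpa using hp) hbd hhalt hrep
  have := (hr F _ _ _ (hr₂ F _ _ _ key).seq).seq
  refine this.mono ?_ le_rfl
  simp only [Expr.cost]
  omega

end WordRAM

namespace Gadget

/-! ### Orthogonality as earth mover distance -/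

/-- The inner product of rows `i` and `j` of two matrices with `d` columns, in row-major order. -/
def rowDot (d : ℕ) (ia ib : ℕ → ℕ) (i j : ℕ) : ℕ :=
  ∑ v ∈ Finset.range d, ia (i * d + v) * ib (j * d + v)

/-- Row `i` on the side of `A`: the vector itself if it is alive and `0` otherwise, a block with the
binary digits of `i`, an empty block, and the alive flag. -/
def vecA (d : ℕ) (alive ia : ℕ → ℕ) (i v : ℕ) : ℕ :=
  if v < d then alive i * ia (i * d + v)
  else if v < 2 * d then (i >>> (v - d)) % 2
  else if v < 3 * d then 0
  else alive i

/-- Row `j` on the side of `B`: the vector itself, an empty block, a block with the binary digits of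
`j`, and a flag that distinguishes the dummies `j ≥ n`. -/
def vecB (n d : ℕ) (ib : ℕ → ℕ) (j v : ℕ) : ℕ :=
  if v < d then ib (j * d + v)
  else if v < 2 * d then 0
  else if v < 3 * d then (j >>> (v - 2 * d)) % 2
  else if j < n then 0 else 1

/-- Each entry of `vecA` becomes three bits, `110` for `0` and `000` for `1`; the remaining bits
are `0`. -/
def bitA (d : ℕ) (alive ia : ℕ → ℕ) (i c : ℕ) : ℕ :=
  if c < 3 * (3 * d + 1) then (if c % 3 < 2 then 1 - vecA d alive ia i (c / 3) else 0) else 0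

/-- Each entry of `vecB` becomes three bits, `100` for `0` and `111` for `1`; the remaining bits
are `0`. -/
def bitB (n d : ℕ) (ib : ℕ → ℕ) (j c : ℕ) : ℕ :=
  if c < 3 * (3 * d + 1) then (if c % 3 = 0 then 1 else vecB n d ib j (c / 3)) else 0

/-- The rows `bitA`, as vectors. -/
def setA (n d D : ℕ) (alive ia : ℕ → ℕ) (i : Fin (2 * n)) (c : Fin D) : Bool :=
  bitA d alive ia i c != 0

/-- The rows `bitB`, as vectors. -/
def setB (n d D : ℕ) (ib : ℕ → ℕ) (j : Fin (2 * n)) (c : Fin D) : Bool :=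
  bitB n d ib j c != 0

theorem eq_of_digits {d i i' : ℕ} (hi : i < 2 ^ d) (hi' : i' < 2 ^ d)
    (h : ∀ t < d, (i >>> t) % 2 = (i' >>> t) % 2) : i = i' := by
  refine Nat.eq_of_testBit_eq fun t => ?_
  by_cases ht : t < d
  · have := h t ht
    rw [Nat.shiftRight_eq_div_pow, Nat.shiftRight_eq_div_pow] at this
    rw [Nat.testBit_eq_decide_div_mod_eq, Nat.testBit_eq_decide_div_mod_eq, this]
  · have : 2 ^ d ≤ 2 ^ t := Nat.pow_le_pow_right (by norm_num) (by omega)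
    rw [Nat.testBit_lt_two_pow (hi.trans_le this), Nat.testBit_lt_two_pow (hi'.trans_le this)]

theorem setA_injective {n d D : ℕ} {alive ia : ℕ → ℕ} (hn : 2 * n ≤ 2 ^ d)
    (hD : 3 * (3 * d + 1) ≤ D) : Function.Injective (setA n d D alive ia) := by
  intro i i' h
  refine Fin.ext (eq_of_digits (i.2.trans_le hn) (i'.2.trans_le hn) fun t ht => ?_)
  have h1 := congrFun h ⟨3 * (d + t), by omega⟩
  have e1 : 3 * (d + t) < 3 * (3 * d + 1) := by omega
  have e2 : 3 * (d + t) % 3 < 2 := by omega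
  have e3 : 3 * (d + t) / 3 = d + t := by omega
  have e4 : ¬ d + t < d := by omega
  have e5 : d + t < 2 * d := by omega
  have e6 : d + t - d = t := by omega
  simp only [setA, bitA, e1, e2, e3, if_true, vecA, e4, e5, e6, if_false] at h1
  rcases Nat.mod_two_eq_zero_or_one ((i : ℕ) >>> t) with h2 | h2 <;>
  rcases Nat.mod_two_eq_zero_or_one ((i' : ℕ) >>> t) with h3 | h3 <;>
  simp [h2, h3] at h1 ⊢

theorem setB_injective {n d D : ℕ} {ib : ℕ → ℕ} (hn : 2 * n ≤ 2 ^ d)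
    (hD : 3 * (3 * d + 1) ≤ D) : Function.Injective (setB n d D ib) := by
  intro i i' h
  refine Fin.ext (eq_of_digits (i.2.trans_le hn) (i'.2.trans_le hn) fun t ht => ?_)
  have h1 := congrFun h ⟨3 * (2 * d + t) + 1, by omega⟩
  have e1 : 3 * (2 * d + t) + 1 < 3 * (3 * d + 1) := by omega
  have e2 : ¬ (3 * (2 * d + t) + 1) % 3 = 0 := by omega
  have e3 : (3 * (2 * d + t) + 1) / 3 = 2 * d + t := by omega
  have e4 : ¬ 2 * d + t < d := by omega
  have e5 : ¬ 2 * d + t < 2 * d := by omega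
  have e6 : 2 * d + t < 3 * d := by omega
  have e7 : 2 * d + t - 2 * d = t := by omega
  simp only [setB, bitB, e1, e2, e3, if_true, vecB, e4, e5, e6, e7, if_false] at h1
  rcases Nat.mod_two_eq_zero_or_one ((i : ℕ) >>> t) with h2 | h2 <;>
  rcases Nat.mod_two_eq_zero_or_one ((i' : ℕ) >>> t) with h3 | h3 <;>
  simp [h2, h3] at h1 ⊢

theorem vecA_le_one {d : ℕ} {alive ia : ℕ → ℕ} (ha : ∀ i, alive i ≤ 1) (hia : ∀ y, ia y ≤ 1)
    (i v : ℕ) : vecA d alive ia i v ≤ 1 := by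
  unfold vecA
  split_ifs
  · exact Nat.mul_le_mul (ha i) (hia _)
  · omega
  · omega
  · exact ha i

theorem vecB_le_one {n d : ℕ} {ib : ℕ → ℕ} (hib : ∀ y, ib y ≤ 1) (j v : ℕ) :
    vecB n d ib j v ≤ 1 := by
  unfold vecB
  split_ifs
  · exact hib _
  all_goals omega

/-- The inner product of the extended rows: besides the inner product of the vectors, it only
penalizes the combination of a living vector with a dummy. -/
theorem sum_vecA_mul_vecB {n d : ℕ} {alive ia ib : ℕ → ℕ} (i j : ℕ) :
    ∑ v ∈ Finset.range (3 * d + 1), vecA d alive ia i v * vecB n d ib j v =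
      alive i * rowDot d ia ib i j + alive i * (if j < n then 0 else 1) := by
  have e : 3 * d + 1 = d + d + d + 1 := by ring
  rw [e, Finset.sum_range_succ, Finset.sum_range_add, Finset.sum_range_add]
  have h1 : ∑ v ∈ Finset.range d, vecA d alive ia i v * vecB n d ib j v =
      alive i * rowDot d ia ib i j := by
    rw [rowDot, Finset.mul_sum]
    refine Finset.sum_congr rfl fun v hv => ?_
    rw [Finset.mem_range] at hv
    simp only [vecA, vecB, hv, if_true]
    ring
  have h2 : ∑ v ∈ Finset.range d, vecA d alive ia i (d + v) * vecB n d ib j (d + v) = 0 := by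
    refine Finset.sum_eq_zero fun v hv => ?_
    rw [Finset.mem_range] at hv
    simp [vecB, show d + v < 2 * d by omega]
  have h3 : ∑ v ∈ Finset.range d, vecA d alive ia i (d + d + v) * vecB n d ib j (d + d + v) = 0 := by
    refine Finset.sum_eq_zero fun v hv => ?_
    rw [Finset.mem_range] at hv
    simp [vecA, show ¬ d + d + v < d by omega, show ¬ d + d + v < 2 * d by omega,
      show d + d + v < 3 * d by omega]
  have h4 : vecA d alive ia i (d + d + d) * vecB n d ib j (d + d + d) =
      alive i * (if j < n then 0 else 1) := by
    simp [vecA, vecB, show ¬ d + d + d < d by omega, show ¬ d + d + d < 2 * d by omega,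
      show ¬ d + d + d < 3 * d by omega]
  rw [h1, h2, h3, h4]
  ring

theorem sum_range_three_mul (M : ℕ) (f : ℕ → ℝ) :
    ∑ c ∈ Finset.range (3 * M), f c =
      ∑ v ∈ Finset.range M, (f (3 * v) + f (3 * v + 1) + f (3 * v + 2)) := by
  induction M with
  | zero => simp
  | succ M ih =>
    rw [show 3 * (M + 1) = 3 * M + 1 + 1 + 1 by ring, Finset.sum_range_succ, Finset.sum_range_succ,
      Finset.sum_range_succ, ih, Finset.sum_range_succ]
    ring

/-- The gadget turns inner products into distances. -/
theorem norm_setA_sub_setB {n d D : ℕ} {alive ia ib : ℕ → ℕ} (ha : ∀ i, alive i ≤ 1)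
    (hia : ∀ y, ia y ≤ 1) (hib : ∀ y, ib y ≤ 1) (hD : 3 * (3 * d + 1) ≤ D) (i j : Fin (2 * n)) :
    ‖toPoint (setA n d D alive ia i) - toPoint (setB n d D ib j)‖ =
      √((3 * d + 1 : ℕ) + 2 * ((alive i * rowDot d ia ib i j +
        alive i * (if (j : ℕ) < n then 0 else 1) : ℕ) : ℝ)) := by
  rw [EuclideanSpace.norm_eq]
  congr 1
  let f : ℕ → ℝ := fun c => ((if bitA d alive ia i c != 0 then (1 : ℝ) else 0) -
    (if bitB n d ib j c != 0 then 1 else 0)) ^ 2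
  have h1 : ∑ c : Fin D, ‖(toPoint (setA n d D alive ia i) - toPoint (setB n d D ib j)) c‖ ^ 2 =
      ∑ c ∈ Finset.range D, f c := by
    rw [← Fin.sum_univ_eq_sum_range]
    refine Finset.sum_congr rfl fun c _ => ?_
    simp [toPoint, setA, setB, f]
  have h2 : ∑ c ∈ Finset.range D, f c = ∑ c ∈ Finset.range (3 * (3 * d + 1)), f c := by
    refine (Finset.sum_subset (Finset.range_mono hD) fun c _ hc => ?_).symm
    rw [Finset.mem_range] at hc
    simp [f, bitA, bitB, hc]
  rw [h1, h2, sum_range_three_mul, ← sum_vecA_mul_vecB]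
  have h3 : ∀ v ∈ Finset.range (3 * d + 1), f (3 * v) + f (3 * v + 1) + f (3 * v + 2) =
      1 + 2 * ((vecA d alive ia i v * vecB n d ib j v : ℕ) : ℝ) := by
    intro v hv
    rw [Finset.mem_range] at hv
    have e0 : 3 * v % 3 = 0 := by omega
    have e1 : (3 * v + 1) % 3 = 1 := by omega
    have e2 : (3 * v + 2) % 3 = 2 := by omega
    have d0 : 3 * v / 3 = v := by omega
    have d1 : (3 * v + 1) / 3 = v := by omega
    have d2 : (3 * v + 2) / 3 = v := by omega
    have l0 : 3 * v < 3 * (3 * d + 1) := by omega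
    have l1 : 3 * v + 1 < 3 * (3 * d + 1) := by omega
    have l2 : 3 * v + 2 < 3 * (3 * d + 1) := by omega
    have hA := vecA_le_one (d := d) ha hia i v
    have hB := vecB_le_one (n := n) (d := d) hib j v
    simp only [f, bitA, bitB, e0, e1, e2, d0, d1, d2, l0, l1, l2, if_true]
    interval_cases vecA d alive ia i v <;> interval_cases vecB n d ib j v <;> norm_num
  rw [Finset.sum_congr rfl h3, Finset.sum_add_distrib, ← Finset.mul_sum]
  simp

/-! ### Large matchings -/

/-- There is a matching of size at least `E` between `S` and `{0, …, n - 1}` in the relation `O`. -/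
def HasMatching (n : ℕ) (O : ℕ → ℕ → Prop) (E : ℕ) (S : Finset ℕ) : Prop :=
  ∃ T ⊆ S, ∃ f : ℕ → ℕ, Set.InjOn f T ∧ (∀ i ∈ T, f i < n ∧ O i (f i)) ∧ E ≤ T.card

theorem HasMatching.mono {n E : ℕ} {O : ℕ → ℕ → Prop} {S S' : Finset ℕ} (hS : S' ⊆ S)
    (h : HasMatching n O E S') : HasMatching n O E S := by
  obtain ⟨T, hT, h⟩ := h
  exact ⟨T, hT.trans hS, h⟩

theorem HasMatching.le_card {n E : ℕ} {O : ℕ → ℕ → Prop} {S : Finset ℕ}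
    (h : HasMatching n O E S) : E ≤ S.card := by
  obtain ⟨T, hT, _, _, _, h⟩ := h
  exact h.trans (Finset.card_le_card hT)

section Cost

variable {n M : ℕ} {S : Finset ℕ} {O : ℕ → ℕ → Prop} {dot : Fin (2 * n) → Fin (2 * n) → ℕ}

/-- A matching of living vectors extends to a permutation that sends the remaining living vectors to
dummies, and everything else to places at the smallest possible distance. -/
theorem exists_perm_cost_le (hS : S ⊆ Finset.range n)
    (hdead : ∀ i j : Fin (2 * n), (i : ℕ) ∉ S → dot i j = 0)
    (horth : ∀ i j : Fin (2 * n), (i : ℕ) ∈ S → (j : ℕ) < n → (dot i j = 0 ↔ O i j))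
    (hdummy : ∀ i j : Fin (2 * n), (i : ℕ) ∈ S → n ≤ (j : ℕ) → dot i j = 1)
    {T : Finset ℕ} (hT : T ⊆ S) {f : ℕ → ℕ} (hf : Set.InjOn f T)
    (hfO : ∀ i ∈ T, f i < n ∧ O i (f i)) :
    ∃ π : Equiv.Perm (Fin (2 * n)), ∑ i, √((M : ℝ) + 2 * (dot i (π i) : ℝ)) ≤
      (2 * n : ℕ) * √(M : ℝ) + ((S.card : ℝ) - T.card) * (√((M : ℝ) + 2) - √(M : ℝ)) := by
  classical
  have hSn : ∀ i ∈ S, i < n := fun i hi => Finset.mem_range.1 (hS hi)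
  let g : {i : Fin (2 * n) // (i : ℕ) ∈ S} → Fin (2 * n) := fun i =>
    if h : (i.1 : ℕ) ∈ T then ⟨f i.1, by have := (hfO _ h).1; omega⟩
    else ⟨n + i.1, by have := hSn _ i.2; omega⟩
  have hg : Function.Injective g := by
    rintro ⟨i, hi⟩ ⟨j, hj⟩ hij
    have hi' := hSn _ hi
    have hj' := hSn _ hj
    simp only [g] at hij
    refine Subtype.ext (Fin.ext ?_)
    by_cases h1 : (i : ℕ) ∈ T <;> by_cases h2 : (j : ℕ) ∈ T <;>
      simp only [h1, h2, dif_pos, dif_neg, not_false_eq_true, Fin.mk.injEq] at hij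
    · exact hf h1 h2 hij
    · have := (hfO _ h1).1; omega
    · have := (hfO _ h2).1; omega
    · exact Nat.add_left_cancel hij
  let e := Equiv.ofInjective g hg
  let π : Equiv.Perm (Fin (2 * n)) := Equiv.extendSubtype (q := fun x => x ∈ Set.range g) e
  have hπ : ∀ (i : Fin (2 * n)) (hi : (i : ℕ) ∈ S), π i = g ⟨i, hi⟩ := fun i hi =>
    Equiv.extendSubtype_apply_of_mem (q := fun x => x ∈ Set.range g) e i hi
  refine ⟨π, ?_⟩
  have hterm : ∀ i : Fin (2 * n), √((M : ℝ) + 2 * (dot i (π i) : ℝ)) =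
      √(M : ℝ) + if (i : ℕ) ∈ S \ T then (√((M : ℝ) + 2) - √(M : ℝ)) else 0 := by
    intro i
    by_cases hi : (i : ℕ) ∈ S
    · by_cases hiT : (i : ℕ) ∈ T
      · have h0 : dot i (π i) = 0 := by
          have h1 : ((π i : Fin (2 * n)) : ℕ) = f i := by
            rw [hπ i hi]
            simp only [g, hiT, dif_pos]
          rw [horth i _ hi (by rw [h1]; exact (hfO _ hiT).1), h1]
          exact (hfO _ hiT).2
        simp [h0, hiT]
      · have h0 : dot i (π i) = 1 := by
          have h1 : ((π i : Fin (2 * n)) : ℕ) = n + i := by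
            rw [hπ i hi]
            simp only [g, hiT, dif_neg, not_false_eq_true]
          exact hdummy i _ hi (by omega)
        simp [h0, hi, hiT]
    · simp [hdead i _ hi, hi]
  rw [Finset.sum_congr rfl fun i _ => hterm i, Finset.sum_add_distrib, Finset.sum_const,
    Finset.card_univ, Fintype.card_fin, nsmul_eq_mul,
    Fin.sum_univ_eq_sum_range (fun i => if i ∈ S \ T then (√((M : ℝ) + 2) - √(M : ℝ)) else 0),
    ← Finset.sum_filter, Finset.sum_const, nsmul_eq_mul]
  have h2 : (Finset.range (2 * n)).filter (· ∈ S \ T) = S \ T := by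
    ext i
    simp only [Finset.mem_filter, Finset.mem_range, Finset.mem_sdiff]
    constructor
    · exact fun h => h.2
    · intro h
      have := hSn i h.1
      exact ⟨by omega, h⟩
  rw [h2, Finset.card_sdiff_of_subset hT, Nat.cast_sub (Finset.card_le_card hT)]

/-- Every living vector not matched to an orthogonal one costs at least `√(M + 2)`. -/
theorem le_perm_cost (hS : S ⊆ Finset.range n)
    (horth : ∀ i j : Fin (2 * n), (i : ℕ) ∈ S → (j : ℕ) < n → (dot i j = 0 ↔ O i j))
    (hdummy : ∀ i j : Fin (2 * n), (i : ℕ) ∈ S → n ≤ (j : ℕ) → dot i j = 1)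
    (π : Equiv.Perm (Fin (2 * n))) (S' : Finset ℕ) (hS' : S' ⊆ S)
    (hbad : ∀ i : Fin (2 * n), (i : ℕ) ∈ S' → ¬ ((π i : ℕ) < n ∧ O i (π i))) :
    (2 * n : ℕ) * √(M : ℝ) + (S'.card : ℝ) * (√((M : ℝ) + 2) - √(M : ℝ)) ≤
      ∑ i, √((M : ℝ) + 2 * (dot i (π i) : ℝ)) := by
  classical
  have hterm : ∀ i : Fin (2 * n),
      √(M : ℝ) + (if (i : ℕ) ∈ S' then (√((M : ℝ) + 2) - √(M : ℝ)) else 0) ≤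
      √((M : ℝ) + 2 * (dot i (π i) : ℝ)) := by
    intro i
    by_cases hi : (i : ℕ) ∈ S'
    · have h1 : 1 ≤ dot i (π i) := by
        by_cases hn : (π i : ℕ) < n
        · have h2 : ¬ O i (π i) := fun h => hbad i hi ⟨hn, h⟩
          rw [← horth i _ (hS' hi) hn] at h2
          omega
        · rw [hdummy i _ (hS' hi) (by omega)]
      have h2 : (1 : ℝ) ≤ dot i (π i) := by exact_mod_cast h1
      simp only [hi, if_true, add_sub_cancel]
      exact Real.sqrt_le_sqrt (by linarith)
    · simp only [hi, if_false, add_zero]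
      exact Real.sqrt_le_sqrt (by linarith [Nat.cast_nonneg (α := ℝ) (dot i (π i))])
  refine le_trans (le_of_eq ?_) (Finset.sum_le_sum fun i _ => hterm i)
  rw [Finset.sum_add_distrib, Finset.sum_const, Finset.card_univ, Fintype.card_fin, nsmul_eq_mul,
    Fin.sum_univ_eq_sum_range (fun i => if i ∈ S' then (√((M : ℝ) + 2) - √(M : ℝ)) else 0),
    ← Finset.sum_filter, Finset.sum_const, nsmul_eq_mul]
  have h2 : (Finset.range (2 * n)).filter (· ∈ S') = S' := by
    ext i
    simp only [Finset.mem_filter, Finset.mem_range, and_iff_right_iff_imp]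
    intro h
    have := Finset.mem_range.1 (hS (hS' h))
    omega
  rw [h2]

/-- If a matching of size `2 E` exists, then in an approximately optimal permutation at least `E`
living vectors are matched to orthogonal ones: the approximation loses at most `E` of them. -/
theorem card_add_le (hS : S ⊆ Finset.range n)
    (hdead : ∀ i j : Fin (2 * n), (i : ℕ) ∉ S → dot i j = 0)
    (horth : ∀ i j : Fin (2 * n), (i : ℕ) ∈ S → (j : ℕ) < n → (dot i j = 0 ↔ O i j))
    (hdummy : ∀ i j : Fin (2 * n), (i : ℕ) ∈ S → n ≤ (j : ℕ) → dot i j = 1)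
    {E : ℕ} (hM : HasMatching n O (2 * E) S) {η : ℝ} (hη : 0 ≤ η)
    (hE : η * (2 * n : ℕ) * (M + 2) ≤ E) (π : Equiv.Perm (Fin (2 * n)))
    (hπ : ∀ π' : Equiv.Perm (Fin (2 * n)), ∑ i, √((M : ℝ) + 2 * (dot i (π i) : ℝ)) ≤
      (1 + η) * ∑ i, √((M : ℝ) + 2 * (dot i (π' i) : ℝ)))
    (S' : Finset ℕ) (hS' : S' ⊆ S)
    (hbad : ∀ i : Fin (2 * n), (i : ℕ) ∈ S' → ¬ ((π i : ℕ) < n ∧ O i (π i))) :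
    S'.card + E ≤ S.card := by
  obtain ⟨T, hT, f, hf, hfO, hTE⟩ := hM
  obtain ⟨π', hπ'⟩ := exists_perm_cost_le (M := M) hS hdead horth hdummy hT hf hfO
  have h1 := le_perm_cost (M := M) hS horth hdummy π S' hS' hbad
  have h2 := hπ π'
  have hSn : (S.card : ℝ) ≤ (2 * n : ℕ) := by
    have := Finset.card_le_card hS
    rw [Finset.card_range] at this
    exact_mod_cast (by omega : S.card ≤ 2 * n)
  have hTS : (2 * E : ℝ) ≤ T.card := by exact_mod_cast hTE
  have hT0 : (0 : ℝ) ≤ T.card := Nat.cast_nonneg _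
  set x := √(M : ℝ) with hx
  set y := √((M : ℝ) + 2) with hy
  have hx0 : 0 ≤ x := Real.sqrt_nonneg _
  have hxx : x * x = M := Real.mul_self_sqrt (Nat.cast_nonneg _)
  have hyy : y * y = M + 2 := Real.mul_self_sqrt (by positivity)
  have hy0 : 0 < y := Real.sqrt_pos.2 (by positivity)
  have hxy : x < y := Real.sqrt_lt_sqrt (Nat.cast_nonneg _) (by linarith)
  -- the gap between orthogonal and nonorthogonal pairs is at least `y / (M + 2)`
  have hgap : y ≤ (y - x) * (M + 2) := by
    have h3 : (y - x) * (y + x) = 2 := by ring_nf; nlinarith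
    have h4 : (y - x) * (2 * y) ≥ 2 := by nlinarith
    rw [← hyy]
    nlinarith
  set N : ℝ := ((2 * n : ℕ) : ℝ) with hN
  have hN0 : 0 ≤ N := Nat.cast_nonneg _
  set r : ℝ := (S.card : ℝ) - T.card with hr
  have hopt : N * x + r * (y - x) ≤ N * y := by nlinarith
  have h5 : (S'.card : ℝ) * (y - x) ≤ r * (y - x) + η * (N * y) := by
    have h6 := mul_le_mul_of_nonneg_left hopt hη
    have h7 := mul_le_mul_of_nonneg_left hπ' (by linarith : 0 ≤ 1 + η)
    nlinarith
  have h8 : η * (N * y) ≤ E * (y - x) := by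
    have h9 : η * N * y ≤ η * N * ((y - x) * (M + 2)) :=
      mul_le_mul_of_nonneg_left hgap (mul_nonneg hη hN0)
    have h10 := mul_le_mul_of_nonneg_right hE (by linarith : 0 ≤ y - x)
    nlinarith
  have h11 : (S'.card : ℝ) * (y - x) ≤ (r + E) * (y - x) := by linarith
  have h12 := le_of_mul_le_mul_right h11 (by linarith)
  have h13 : (S'.card : ℝ) + E ≤ S.card := by linarith
  exact_mod_cast h13

end Cost

/-- The effect of one approximately optimal matching of the gadgets. -/
theorem card_add_le_of_matchingCost_le {n d D E : ℕ} {S S' : Finset ℕ} {alive ia ib : ℕ → ℕ}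
    (halive : ∀ i, alive i = if i ∈ S then 1 else 0) (hia : ∀ y, ia y ≤ 1) (hib : ∀ y, ib y ≤ 1)
    (hib0 : ∀ y, n * d ≤ y → ib y = 0) (hD : 3 * (3 * d + 1) ≤ D) (hS : S ⊆ Finset.range n)
    (hM : HasMatching n (fun i j => rowDot d ia ib i j = 0) (2 * E) S) {η : ℝ} (hη : 0 ≤ η)
    (hE : η * (2 * n : ℕ) * ((3 * d + 1 : ℕ) + 2) ≤ E) (π : Equiv.Perm (Fin (2 * n)))
    (hπ : matchingCost (setA n d D alive ia) (setB n d D ib) π ≤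
      (1 + η) * emd (setA n d D alive ia) (setB n d D ib))
    (hS' : S' ⊆ S) (hbad : ∀ i : Fin (2 * n), (i : ℕ) ∈ S' →
      ¬ ((π i : ℕ) < n ∧ rowDot d ia ib i (π i) = 0)) :
    S'.card + E ≤ S.card := by
  have ha1 : ∀ i, alive i ≤ 1 := by
    intro i
    rw [halive]
    split_ifs <;> omega
  have hcost : ∀ π : Equiv.Perm (Fin (2 * n)),
      matchingCost (setA n d D alive ia) (setB n d D ib) π =
      ∑ i : Fin (2 * n), √((3 * d + 1 : ℕ) + 2 * ((alive i * rowDot d ia ib i (π i) +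
        alive i * (if (π i : ℕ) < n then 0 else 1) : ℕ) : ℝ)) :=
    fun π => Finset.sum_congr rfl fun i _ => norm_setA_sub_setB ha1 hia hib hD i (π i)
  refine card_add_le (M := 3 * d + 1) (dot := fun i j => alive i * rowDot d ia ib i j +
    alive i * (if (j : ℕ) < n then 0 else 1)) hS ?_ ?_ ?_ hM hη hE π ?_ S' hS' hbad
  · intro i j hi
    simp [halive, hi]
  · intro i j hi hj
    simp [halive, hi, hj]
  · intro i j hi hj
    have h0 : rowDot d ia ib i j = 0 := by
      refine Finset.sum_eq_zero fun v _ => ?_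
      rw [hib0 _ ((Nat.mul_le_mul_right d hj).trans (Nat.le_add_right _ _)), mul_zero]
    simp [halive, hi, h0, show ¬ (j : ℕ) < n by omega]
  · intro π'
    rw [← hcost, ← hcost]
    refine hπ.trans (mul_le_mul_of_nonneg_left ?_ (by linarith))
    exact Finset.inf'_le _ (Finset.mem_univ π')

end Gadget

namespace WordRAM

/-! ### The algorithm for the Hitting Set problem -/

/-- The setting in which the algorithm is analyzed: `n` rows of `d` bits in each of the input
arrays `1` and `2`. -/
structure HSEnv extends Env where
  n : ℕ
  d : ℕ
  inp_n : inp 0 0 = n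
  inp_d : inp 0 1 = d
  inp_one_le : ∀ y, inp 1 y ≤ 1
  inp_two_le : ∀ y, inp 2 y ≤ 1
  inp_two_eq_zero : ∀ y, n * d ≤ y → inp 2 y = 0
  le_S : 100 ≤ S

namespace HS

/-- The number of vectors. -/
abbrev rN : ℕ := 6
/-- The dimension of the Hitting Set instance. -/
abbrev rDim : ℕ := 9
/-- The dimension of the matching instances. -/
abbrev rBig : ℕ := 12
/-- The integer root of `n` that controls the number of rounds. -/
abbrev rG : ℕ := 15
/-- An index into `A`. -/
abbrev rI : ℕ := 18
/-- An index into `B`. -/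
abbrev rJ : ℕ := 21
/-- A coordinate. -/
abbrev rV : ℕ := 24
/-- An inner product. -/
abbrev rAcc : ℕ := 27
/-- Result of the search for an orthogonal vector. -/
abbrev rF : ℕ := 30
/-- Result of the search for a living vector. -/
abbrev rX : ℕ := 33
/-- A counter of rounds. -/
abbrev rC : ℕ := 36

/-- The two states agree except for the registers in `X` and array `0`. -/
def Keeps (X : List ℕ) (s₀ s : State) : Prop :=
  (∀ r, r ∉ X → s.reg r = s₀.reg r) ∧ ∀ a, a ≠ 0 → s.arr a = s₀.arr a

theorem Keeps.refl (X : List ℕ) (s : State) : Keeps X s s := ⟨fun _ _ => rfl, fun _ _ => rfl⟩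

theorem Keeps.trans {X : List ℕ} {s₀ s₁ s₂ : State} (h : Keeps X s₀ s₁) (h' : Keeps X s₁ s₂) :
    Keeps X s₀ s₂ :=
  ⟨fun r hr => (h'.1 r hr).trans (h.1 r hr), fun a ha => (h'.2 a ha).trans (h.2 a ha)⟩

theorem Keeps.mono {X Y : List ℕ} {s₀ s : State} (h : Keeps X s₀ s) (hXY : X ⊆ Y) :
    Keeps Y s₀ s :=
  ⟨fun r hr => h.1 r fun hX => hr (hXY hX), h.2⟩

theorem Keeps.setReg {X : List ℕ} {s₀ s : State} (h : Keeps X s₀ s) {x : ℕ} (hx : x ∈ X) (v : ℕ) :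
    Keeps X s₀ (s.setReg x v) := by
  refine ⟨fun r hr => ?_, h.2⟩
  have : r ≠ x := fun e => hr (e ▸ hx)
  simpa [State.setReg, this] using h.1 r hr

theorem Keeps.setArr {X : List ℕ} {s₀ s : State} (h : Keeps X s₀ s) (i v : ℕ) :
    Keeps X s₀ (s.setArr 0 i v) :=
  ⟨h.1, fun a ha => (State.setArr_arr_of_ne ha i v).trans (h.2 a ha)⟩

theorem setReg_self (s : State) (x v : ℕ) : (s.setReg x v).reg x = v := Function.update_self _ _ _

theorem setReg_of_ne {s : State} {x y : ℕ} (h : y ≠ x) (v : ℕ) : (s.setReg x v).reg y = s.reg y :=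
  Function.update_of_ne h _ _

/-- Array `0` is the indicator of the set `S` of living vectors. -/
def AliveIs (s : State) (S : Finset ℕ) : Prop := ∀ i, s.arr 0 i = if i ∈ S then 1 else 0

theorem AliveIs.erase {s : State} {S : Finset ℕ} (h : AliveIs s S) (i : ℕ) :
    AliveIs (s.setArr 0 i 0) (S.erase i) := by
  intro j
  rw [State.setArr_arr_self]
  by_cases hj : j = i
  · simp [hj]
  · simpa [hj] using h j

/-- Computes the inner product of row `rI` of `A` and row `rJ` of `B` into `rAcc`. -/
def dotProg : Prog :=
  .seq (assign rAcc (.lit 0)) (countdown rV (.reg rDim) (assign rAcc (.bin .add (.reg rAcc)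
    (.bin .mul (.inp 1 (.bin .add (.bin .mul (.reg rI) (.reg rDim)) (.reg rV)))
      (.inp 2 (.bin .add (.bin .mul (.reg rJ) (.reg rDim)) (.reg rV)))))))

theorem run_dotProg (E : HSEnv) {s : State} (hd : s.reg rDim = E.d) :
    ∃ s', Run E.toEnv dotProg s s' (50 * (E.d + 1)) ∧
      s'.reg rAcc = Gadget.rowDot E.d (E.inp 1) (E.inp 2) (s.reg rI) (s.reg rJ) ∧
      (∀ r, r ∉ [rV, rAcc] → s'.reg r = s.reg r) ∧ s'.arr = s.arr := by
  have hS := E.le_S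
  have hB := E.le_B
  have h0 := Run.assign (E := E.toEnv) (x := rAcc) (e := .lit 0) (s := s) rfl
    (by simp only [Expr.size]; omega) (fun _ => by simp only [Expr.val]; omega)
  set t : ℕ → ℕ := fun v => E.inp 1 (s.reg rI * E.d + v) * E.inp 2 (s.reg rJ * E.d + v) with ht
  have ht1 : ∀ v, t v ≤ 1 := fun v => Nat.mul_le_mul (E.inp_one_le _) (E.inp_two_le _)
  let I : ℕ → State → Prop := fun x s' =>
    s'.reg rAcc + ∑ v ∈ Finset.range x, t v = ∑ v ∈ Finset.range E.d, t v ∧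
      (∀ r, r ∉ [rV, rAcc] → s'.reg r = s.reg r) ∧ s'.arr = s.arr
  have hloop := Run.countdown (E := E.toEnv) (x := rV) (n := E.d) (c := 40) (e := .reg rDim)
    (p := assign rAcc (.bin .add (.reg rAcc)
    (.bin .mul (.inp 1 (.bin .add (.bin .mul (.reg rI) (.reg rDim)) (.reg rV)))
      (.inp 2 (.bin .add (.bin .mul (.reg rJ) (.reg rDim)) (.reg rV))))))
    (s := s.setReg rAcc 0) (by decide) (by omega) rfl (by simp only [Expr.size]; omega)
    (by simpa [Expr.val, State.setReg] using hd)
    (fun _ => by have := E.inp_lt 0 1; rwa [E.inp_d] at this) I ?_ ?_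
  · obtain ⟨s', hr, hI, -⟩ := hloop
    refine ⟨s', (h0.seq hr).mono ?_, by
      have h1 := hI.1
      rwa [Finset.sum_range_zero, add_zero] at h1, hI.2⟩
    simp only [Expr.cost]
    omega
  · refine ⟨by simp [State.setReg], fun r hr => ?_, rfl⟩
    simp only [List.mem_cons, List.not_mem_nil, or_false, not_or] at hr
    rw [setReg_of_ne hr.1, setReg_of_ne hr.2]
  · intro i hi s₁ hI hx
    obtain ⟨h1, h2, h3⟩ := hI
    have hval : (Expr.bin .add (.reg rAcc)
        (.bin .mul (.inp 1 (.bin .add (.bin .mul (.reg rI) (.reg rDim)) (.reg rV)))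
        (.inp 2 (.bin .add (.bin .mul (.reg rJ) (.reg rDim)) (.reg rV))))).val E.inp
        (s₁.setReg rV i) = s₁.reg rAcc + t i := by
      have e1 := h2 rI (by decide)
      have e2 := h2 rJ (by decide)
      have e3 := h2 rDim (by decide)
      rw [hd] at e3
      simp [Expr.val, BinOp.eval, State.setReg, e1, e2, e3, ht]
    have hle : s₁.reg rAcc + t i ≤ E.d := by
      rw [Finset.sum_range_succ] at h1
      have : ∑ v ∈ Finset.range E.d, t v ≤ E.d := by
        have := Finset.sum_le_sum fun v (_ : v ∈ Finset.range E.d) => ht1 v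
        simpa using this
      omega
    have hdB : E.d < E.B := by have := E.inp_lt 0 1; rwa [E.inp_d] at this
    have hr := Run.assign (E := E.toEnv) (x := rAcc) (e := .bin .add (.reg rAcc)
        (.bin .mul (.inp 1 (.bin .add (.bin .mul (.reg rI) (.reg rDim)) (.reg rV)))
        (.inp 2 (.bin .add (.bin .mul (.reg rJ) (.reg rDim)) (.reg rV)))))
      (s := s₁.setReg rV i) (by decide) (by simp only [Expr.size]; omega)
      (fun _ => by rw [hval]; omega)
    rw [hval] at hr
    refine ⟨_, hr.mono (by simp only [Expr.cost]; omega), ⟨?_, fun r hr => ?_, h3⟩, ?_⟩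
    · rw [setReg_self, ← h1, Finset.sum_range_succ]
      ring
    · have hr' := hr
      simp only [List.mem_cons, List.not_mem_nil, or_false, not_or] at hr
      rw [setReg_of_ne hr.2, setReg_of_ne hr.1]
      exact h2 r hr'
    · rw [setReg_of_ne (by decide), setReg_self]

/-- Execute `pre` and then, if `e ≠ 0`, also `q`, for `x = n - 1, …, 0`. -/
def scan (x : ℕ) (pre : Prog) (e : Expr) (q : Prog) : Prog :=
  countdown x (.reg rN) (.seq pre (ifExpr e q .skip))

/-- A scan that removes all living vectors with the property `P`. -/
theorem run_scan_kill (E : HSEnv) {X : List ℕ} {pre : Prog} {e : Expr} {c : ℕ} {P : ℕ → Prop}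
    [DecidablePred P] {s₀ : State} {S : Finset ℕ} (hX : rI ∈ X)
    (he : e.Tame) (heS : e.size ≤ 100) (hec : e.cost ≤ 50)
    (hn : s₀.reg rN = E.n) (hS : S ⊆ Finset.range E.n) (halive : AliveIs s₀ S)
    (hpre : ∀ s, Keeps X s₀ s → ∃ s', Run E.toEnv pre s s' c ∧ Keeps X s₀ s' ∧ s'.arr = s.arr ∧
      s'.reg rI = s.reg rI ∧ (e.val E.inp s' ≠ 0 ↔ P (s.reg rI))) :
    ∃ s', Run E.toEnv (scan rI pre e (put 0 (.reg rI) (.lit 0))) s₀ s' (E.n * (c + 100) + 100) ∧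
      Keeps X s₀ s' ∧ AliveIs s' (S.filter fun i => ¬ P i) := by
  have hSS := E.le_S
  have hB := E.le_B
  -- the indices from `x` on have been treated
  let I : ℕ → State → Prop := fun x s' =>
    Keeps X s₀ s' ∧ AliveIs s' (S.filter fun i => ¬ (x ≤ i ∧ P i))
  have hloop := Run.countdown (E := E.toEnv) (x := rI) (n := E.n) (c := c + 70) (e := .reg rN)
    (p := .seq pre (ifExpr e (put 0 (.reg rI) (.lit 0)) .skip))
    (s := s₀) (by decide) (by omega) rfl (by simp only [Expr.size]; omega) hn
    (fun hb => by have := hb.1 rN; rwa [hn] at this) I ?_ ?_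
  · obtain ⟨s', hr, hI, -⟩ := hloop
    refine ⟨s', hr.mono ?_, hI.1, by simpa using hI.2⟩
    have : E.n * (c + 70 + 9) ≤ E.n * (c + 100) := Nat.mul_le_mul_left _ (by omega)
    simp only [Expr.cost]
    omega
  · refine ⟨(Keeps.refl X s₀).setReg hX _, ?_⟩
    have : S.filter (fun i => ¬ (E.n ≤ i ∧ P i)) = S := by
      refine Finset.filter_true_of_mem fun i hi => ?_
      have := Finset.mem_range.1 (hS hi)
      omega
    rw [this]
    exact halive
  · intro i hi s₁ hI hx
    obtain ⟨s₂, hr₂, hk₂, ha₂, hi₂, hP⟩ := hpre (s₁.setReg rI i) (hI.1.setReg hX i)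
    rw [setReg_self] at hi₂ hP
    have halive₂ : AliveIs s₂ (S.filter fun j => ¬ (i + 1 ≤ j ∧ P j)) := by
      intro j
      rw [ha₂]
      exact hI.2 j
    by_cases hPi : P i
    · have hv := Run.put (E := E.toEnv) (a := 0) (i := .reg rI) (v := .lit 0) (s := s₂) rfl
        (by simp only [Expr.size]; omega) rfl (by simp only [Expr.size]; omega)
        (fun _ => by simp only [Expr.val]; omega)
      have hif := Run.ifExpr_pos (q := .skip) he (heS.trans hSS) (hP.2 hPi) hv
      refine ⟨_, (hr₂.seq hif).mono (by simp only [Expr.cost]; omega), ⟨hk₂.setArr _ _, ?_⟩, hi₂⟩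
      have h1 := halive₂.erase i
      have h2 : (S.filter fun j => ¬ (i + 1 ≤ j ∧ P j)).erase i =
          S.filter fun j => ¬ (i ≤ j ∧ P j) := by
        ext j
        simp only [Finset.mem_erase, Finset.mem_filter]
        by_cases hj : j = i
        · subst hj
          simp [hPi]
        · have : i + 1 ≤ j ↔ i ≤ j := by omega
          simp [hj, this]
      rw [h2] at h1
      simpa [Expr.val, hi₂] using h1
    · have hif := Run.ifExpr_neg (p := put 0 (.reg rI) (.lit 0)) he (heS.trans hSS)
        (by by_contra h; exact hPi (hP.1 h)) (Run.skip E.toEnv s₂)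
      refine ⟨_, (hr₂.seq hif).mono (by omega), ⟨hk₂, ?_⟩, hi₂⟩
      have h2 : (S.filter fun j => ¬ (i + 1 ≤ j ∧ P j)) =
          S.filter fun j => ¬ (i ≤ j ∧ P j) := by
        refine Finset.filter_congr fun j _ => ?_
        by_cases hj : j = i
        · subst hj
          simp [hPi]
        · have : i + 1 ≤ j ↔ i ≤ j := by omega
          simp [this]
      rwa [h2] at halive₂

/-- A scan that searches for an index with the property `P`; the result is stored with an offset
of one, and `0` means that there is none. -/
theorem run_scan_search (E : HSEnv) {X : List ℕ} {pre : Prog} {e : Expr} {x out c : ℕ}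
    {P : ℕ → Prop} {s₀ : State} (hx3 : x % 3 ≠ 1) (hX : x ∈ X) (hout : out ∈ X) (hxo : x ≠ out)
    (he : e.Tame) (heS : e.size ≤ 100) (hec : e.cost ≤ 50)
    (hn : s₀.reg rN = E.n) (h0 : s₀.reg out = 0)
    (hpre : ∀ s, Keeps X s₀ s → s.arr = s₀.arr → ∃ s', Run E.toEnv pre s s' c ∧ Keeps X s₀ s' ∧
      s'.arr = s.arr ∧ s'.reg x = s.reg x ∧ s'.reg out = s.reg out ∧
      (e.val E.inp s' ≠ 0 ↔ P (s.reg x))) :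
    ∃ s', Run E.toEnv (scan x pre e (assign out (.bin .add (.reg x) (.lit 1)))) s₀ s'
        (E.n * (c + 100) + 100) ∧
      Keeps X s₀ s' ∧ s'.arr = s₀.arr ∧
      ((s'.reg out = 0 ∧ ∀ i < E.n, ¬ P i) ∨ ∃ i < E.n, P i ∧ s'.reg out = i + 1) := by
  have hSS := E.le_S
  have hB := E.le_B
  let I : ℕ → State → Prop := fun y s' =>
    Keeps X s₀ s' ∧ s'.arr = s₀.arr ∧
      ((s'.reg out = 0 ∧ ∀ i < E.n, y ≤ i → ¬ P i) ∨ ∃ i < E.n, P i ∧ s'.reg out = i + 1)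
  have hloop := Run.countdown (E := E.toEnv) (x := x) (n := E.n) (c := c + 70) (e := .reg rN)
    (p := .seq pre (ifExpr e (assign out (.bin .add (.reg x) (.lit 1))) .skip))
    (s := s₀) hx3 (by omega) rfl (by simp only [Expr.size]; omega) hn
    (fun hb => by have := hb.1 rN; rwa [hn] at this) I ?_ ?_
  · obtain ⟨s', hr, hI, -⟩ := hloop
    refine ⟨s', hr.mono ?_, hI.1, hI.2.1, by simpa using hI.2.2⟩
    have : E.n * (c + 70 + 9) ≤ E.n * (c + 100) := Nat.mul_le_mul_left _ (by omega)
    simp only [Expr.cost]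
    omega
  · refine ⟨(Keeps.refl X s₀).setReg hX _, rfl, Or.inl ⟨?_, fun i hi h => by omega⟩⟩
    rw [setReg_of_ne hxo.symm, h0]
  · intro i hi s₁ hI hxi
    obtain ⟨s₂, hr₂, hk₂, ha₂, hi₂, ho₂, hP⟩ := hpre (s₁.setReg x i) (hI.1.setReg hX i) hI.2.1
    rw [setReg_self] at hi₂ hP
    rw [setReg_of_ne hxo.symm] at ho₂
    by_cases hPi : P i
    · have hval : (Expr.bin .add (.reg x) (.lit 1)).val E.inp s₂ = i + 1 := by
        simp [Expr.val, BinOp.eval, hi₂]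
      have hnB : E.n < E.B := by have := E.inp_lt 0 0; rwa [E.inp_n] at this
      have hv := Run.assign (E := E.toEnv) (x := out) (e := .bin .add (.reg x) (.lit 1)) (s := s₂)
        (by simp [Expr.Tame, BinOp.Tame, hx3]) (by simp only [Expr.size]; omega)
        (fun _ => by rw [hval]; omega)
      rw [hval] at hv
      have hif := Run.ifExpr_pos (q := .skip) he (heS.trans hSS) (hP.2 hPi) hv
      refine ⟨_, (hr₂.seq hif).mono (by simp only [Expr.cost]; omega),
        ⟨hk₂.setReg hout _, ha₂.trans hI.2.1, Or.inr ⟨i, hi, hPi, setReg_self _ _ _⟩⟩, ?_⟩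
      rw [setReg_of_ne hxo, hi₂]
    · have hif := Run.ifExpr_neg (p := assign out (.bin .add (.reg x) (.lit 1))) he (heS.trans hSS)
        (by by_contra h; exact hPi (hP.1 h)) (Run.skip E.toEnv s₂)
      refine ⟨_, (hr₂.seq hif).mono (by omega), ⟨hk₂, ha₂.trans hI.2.1, ?_⟩, hi₂⟩
      rw [ho₂]
      rcases hI.2.2 with ⟨h1, h2⟩ | h
      · refine Or.inl ⟨h1, fun j hj hij => ?_⟩
        by_cases hji : j = i
        · rwa [hji]
        · exact h2 j hj (by omega)
      · exact Or.inr h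

/-- The relation between indices of `A` and `B` whose vectors are orthogonal. -/
def Orth (E : HSEnv) (i j : ℕ) : Prop := Gadget.rowDot E.d (E.inp 1) (E.inp 2) i j = 0

instance (E : HSEnv) (i j : ℕ) : Decidable (Orth E i j) := by unfold Orth; infer_instance

/-- Removes all living vectors that are orthogonal to the partner assigned to them by the
simulated matching algorithm. -/
def killMatched : Prog :=
  scan rI (.seq (assign rJ (virtEntry 0 (.reg rI))) dotProg)
    (.bin .mul (.bin .sub (.reg rN) (.reg rJ)) (.bin .sub (.lit 1) (.reg rAcc)))
    (put 0 (.reg rI) (.lit 0))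

theorem run_killMatched (E : HSEnv) {s₀ s σ : State} {W : ℕ} {S : Finset ℕ}
    (hrep : Represents s₀ W s σ) (hn : s.reg rN = E.n) (hd : s.reg rDim = E.d)
    (hS : S ⊆ Finset.range E.n) (halive : AliveIs s S) :
    ∃ s', Run E.toEnv killMatched s s' (E.n * (50 * (E.d + 1) + 200) + 100) ∧
      Keeps [rI, rJ, rV, rAcc] s s' ∧
      AliveIs s' (S.filter fun i => ¬ (σ.arr 0 i < E.n ∧ Orth E i (σ.arr 0 i))) := by
  have hSS := E.le_S
  have key := run_scan_kill E (X := [rI, rJ, rV, rAcc])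
    (pre := .seq (assign rJ (virtEntry 0 (.reg rI))) dotProg)
    (e := .bin .mul (.bin .sub (.reg rN) (.reg rJ)) (.bin .sub (.lit 1) (.reg rAcc)))
    (c := 50 * (E.d + 1) + 100) (P := fun i => σ.arr 0 i < E.n ∧ Orth E i (σ.arr 0 i))
    (by decide) (by decide) (by decide) (by decide) hn hS halive ?_
  · obtain ⟨s', hr, h⟩ := key
    exact ⟨s', hr.mono (by simp only [add_assoc]; exact le_rfl), h⟩
  · intro s₁ hk
    have hval : (virtEntry 0 (.reg rI)).val E.inp s₁ = σ.arr 0 (s₁.reg rI) := by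
      rw [hrep.arr]
      have e1 := hk.1 epochReg (by decide)
      have e2 := hk.2 (stampArr 0) (by decide)
      have e3 := hk.2 (valArr 0) (by decide)
      have h1 := hrep.stamp 0 (s₁.reg rI)
      change (if s₁.reg epochReg - s₁.arr (stampArr 0) (s₁.reg rI) ≠ 0 then 0
        else s₁.arr (valArr 0) (s₁.reg rI)) = _
      rw [e1, e2, e3]
      by_cases he : s.arr (stampArr 0) (s₁.reg rI) = s.reg epochReg
      · simp [he]
      · rw [if_pos (by omega), if_neg he]
    have h1 := Run.of_bounded fun hb => Run.assign (E := E.toEnv) (x := rJ)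
      (e := virtEntry 0 (.reg rI)) (s := s₁) (by decide) (by simp only [virtEntry, Expr.size]; omega)
      (fun _ => by
        have hB := E.le_B
        change (if _ then 0 else s₁.arr (valArr 0) (s₁.reg rI)) < _
        split_ifs
        · omega
        · exact hb.2 _ _)
    rw [hval] at h1
    obtain ⟨s₂, hr₂, hacc, hreg, harr⟩ := run_dotProg E (s := s₁.setReg rJ (σ.arr 0 (s₁.reg rI)))
      (by rw [setReg_of_ne (by decide), hk.1 rDim (by decide), hd])
    rw [setReg_of_ne (by decide), setReg_self] at hacc
    refine ⟨s₂, (h1.seq hr₂).mono (by simp only [virtEntry, Expr.cost]; omega), ?_, harr, ?_, ?_⟩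
    · refine hk.trans ⟨fun r hr => ?_, fun a _ => by rw [harr]; rfl⟩
      simp only [List.mem_cons, List.not_mem_nil, or_false, not_or] at hr
      rw [hreg r (by simp [hr.2.2.1, hr.2.2.2]), setReg_of_ne hr.2.1]
    · rw [hreg _ (by decide), setReg_of_ne (by decide)]
    · have e1 : s₂.reg rN = E.n := by
        rw [hreg _ (by decide), setReg_of_ne (by decide), hk.1 rN (by decide), hn]
      have e2 : s₂.reg rJ = σ.arr 0 (s₁.reg rI) := by rw [hreg _ (by decide), setReg_self]
      change (s₂.reg rN - s₂.reg rJ) * (1 - s₂.reg rAcc) ≠ 0 ↔ _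
      rw [e1, e2, hacc, mul_ne_zero_iff, Orth]
      omega

/-- One step of the exhaustive search: take a living vector, find a vector orthogonal to it, and
remove all living vectors orthogonal to the latter. -/
def starStep : Prog :=
  .seq (assign rX (.lit 0)) <|
  .seq (scan rI .skip (.arr 0 (.reg rI)) (assign rX (.bin .add (.reg rI) (.lit 1)))) <|
  ifExpr (.reg rX)
    (.seq (assign rI (.bin .sub (.reg rX) (.lit 1))) <|
    .seq (assign rF (.lit 0)) <|
    .seq (scan rJ dotProg (.bin .sub (.lit 1) (.reg rAcc))
      (assign rF (.bin .add (.reg rJ) (.lit 1)))) <|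
    ifExpr (.reg rF)
      (.seq (assign rJ (.bin .sub (.reg rF) (.lit 1))) <|
      scan rI dotProg (.bin .sub (.lit 1) (.reg rAcc)) (put 0 (.reg rI) (.lit 0)))
      (assign 0 (.lit 1)))
    .skip

/-- The registers that `starStep` may change. -/
abbrev starRegs : List ℕ := [rI, rJ, rV, rAcc, rF, rX]

/-- The outcomes of `starStep`: no vector is alive, a hitting vector `i` is found, or a living `i`
and a `j` orthogonal to it are found. -/
theorem run_starStep (E : HSEnv) {s : State} {S : Finset ℕ} (hn : s.reg rN = E.n)
    (hd : s.reg rDim = E.d) (hS : S ⊆ Finset.range E.n) (halive : AliveIs s S) :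
    ∃ s' S', Run E.toEnv starStep s s' (3 * (E.n * (50 * (E.d + 1) + 100)) + 500) ∧
      Keeps (0 :: starRegs) s s' ∧ AliveIs s' S' ∧
      ((S = ∅ ∧ S' = S ∧ s'.reg 0 = s.reg 0) ∨
        (∃ i ∈ S, (∀ j < E.n, ¬ Orth E i j) ∧ S' = S ∧ s'.reg 0 = 1) ∨
        ∃ i ∈ S, ∃ j < E.n, Orth E i j ∧ S' = S.filter (fun i => ¬ Orth E i j) ∧
          s'.reg 0 = s.reg 0) := by
  have hSS := E.le_S
  have hB := E.le_B
  have hdot : ∀ s₁ : State, s₁.reg rDim = E.d → ∃ s', Run E.toEnv dotProg s₁ s' (50 * (E.d + 1)) ∧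
      s'.reg rAcc = Gadget.rowDot E.d (E.inp 1) (E.inp 2) (s₁.reg rI) (s₁.reg rJ) ∧
      (∀ r, r ∉ [rV, rAcc] → s'.reg r = s₁.reg r) ∧ s'.arr = s₁.arr :=
    fun s₁ h => run_dotProg E h
  have hmono : E.n * (1 + 100) ≤ E.n * (50 * (E.d + 1) + 100) :=
    Nat.mul_le_mul_left _ (by omega)
  -- search for a living vector
  have h0 := Run.assign (E := E.toEnv) (x := rX) (e := .lit 0) (s := s) rfl
    (by simp only [Expr.size]; omega) (fun _ => by simp only [Expr.val]; omega)
  obtain ⟨s₁, hr₁, hk₁, ha₁, hres₁⟩ := run_scan_search E (X := [rI, rX]) (pre := .skip)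
    (e := .arr 0 (.reg rI)) (x := rI) (out := rX) (c := 1) (P := fun i => i ∈ S)
    (s₀ := s.setReg rX 0) (by decide) (by decide) (by decide) (by decide) (by decide) (by decide)
    (by decide) (by rw [setReg_of_ne (by decide), hn]) (setReg_self _ _ _) (by
      intro s' hk ha
      refine ⟨s', Run.skip _ _, hk, rfl, rfl, rfl, ?_⟩
      change s'.arr 0 (s'.reg rI) ≠ 0 ↔ _
      have : s'.arr 0 (s'.reg rI) = if s'.reg rI ∈ S then 1 else 0 := by
        rw [ha]
        exact halive _
      rw [this]
      simp)
  have hk₁' : Keeps [rI, rX] s s₁ := ((Keeps.refl _ s).setReg (by decide) 0).trans hk₁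
  have halive₁ : AliveIs s₁ S := by
    intro i
    rw [ha₁]
    exact halive i
  have hn₁ : s₁.reg rN = E.n := (hk₁'.1 rN (by decide)).trans hn
  have hd₁ : s₁.reg rDim = E.d := (hk₁'.1 rDim (by decide)).trans hd
  have h00₁ : s₁.reg 0 = s.reg 0 := hk₁'.1 0 (by decide)
  have hsub₁ : ([rI, rX] : List ℕ) ⊆ 0 :: starRegs := by decide
  rcases hres₁ with ⟨hx0, hnone⟩ | ⟨i, hin, hiS, hxi⟩
  · have hif := Run.ifExpr_neg (E := E.toEnv) (e := .reg rX) (p :=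
      (.seq (assign rI (.bin .sub (.reg rX) (.lit 1))) <|
        .seq (assign rF (.lit 0)) <|
        .seq (scan rJ dotProg (.bin .sub (.lit 1) (.reg rAcc))
          (assign rF (.bin .add (.reg rJ) (.lit 1)))) <|
        ifExpr (.reg rF)
          (.seq (assign rJ (.bin .sub (.reg rF) (.lit 1))) <|
          scan rI dotProg (.bin .sub (.lit 1) (.reg rAcc)) (put 0 (.reg rI) (.lit 0)))
          (assign 0 (.lit 1)))) rfl (by simp only [Expr.size]; omega) hx0 (Run.skip _ s₁)
    refine ⟨s₁, S, (h0.seq (hr₁.seq hif)).mono ?_, hk₁'.mono hsub₁, halive₁, Or.inl ⟨?_, rfl, h00₁⟩⟩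
    · simp only [Expr.cost]
      omega
    · refine Finset.eq_empty_of_forall_notMem fun i hi => hnone i (Finset.mem_range.1 (hS hi)) hi
  -- search for an orthogonal partner
  have hnB : E.n < E.B := by have := E.inp_lt 0 0; rwa [E.inp_n] at this
  have hv₂ : (Expr.bin .sub (.reg rX) (.lit 1)).val E.inp s₁ = i := by
    change s₁.reg rX - 1 = i
    omega
  have h2 := Run.assign (E := E.toEnv) (x := rI) (e := .bin .sub (.reg rX) (.lit 1)) (s := s₁)
    (by decide) (by simp only [Expr.size]; omega) (fun _ => by rw [hv₂]; omega)
  rw [hv₂] at h2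
  have h3 := Run.assign (E := E.toEnv) (x := rF) (e := .lit 0) (s := s₁.setReg rI i) rfl
    (by simp only [Expr.size]; omega) (fun _ => by simp only [Expr.val]; omega)
  set s₂ := (s₁.setReg rI i).setReg rF 0 with hs₂
  have hk₂ : Keeps starRegs s s₂ :=
    ((hk₁'.mono (by decide)).setReg (by decide) _).setReg (by decide) _
  obtain ⟨s₃, hr₃, hk₃, ha₃, hres₃⟩ := run_scan_search E (X := [rJ, rV, rAcc, rF]) (pre := dotProg)
    (e := .bin .sub (.lit 1) (.reg rAcc)) (x := rJ) (out := rF) (c := 50 * (E.d + 1))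
    (P := fun j => Orth E i j)
    (s₀ := s₂) (by decide) (by decide) (by decide) (by decide) (by decide) (by decide)
    (by decide) ((hk₂.1 rN (by decide)).trans hn) (setReg_self _ _ _) (by
      intro s' hk ha
      obtain ⟨s'', hr, hacc, hreg, harr⟩ := hdot s'
        ((hk.1 rDim (by decide)).trans ((hk₂.1 rDim (by decide)).trans hd))
      have hi : s'.reg rI = i := by
        rw [hk.1 rI (by decide), hs₂, setReg_of_ne (by decide), setReg_self]
      refine ⟨s'', hr, hk.trans ⟨fun r hr => hreg r ?_, fun a _ => by rw [harr]⟩, harr,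
        hreg _ (by decide), hreg _ (by decide), ?_⟩
      · simp only [List.mem_cons, List.not_mem_nil, or_false, not_or] at hr ⊢
        exact ⟨hr.2.1, hr.2.2.1⟩
      · change 1 - s''.reg rAcc ≠ 0 ↔ _
        rw [hacc, hi, Orth]
        omega)
  have hk₃' : Keeps starRegs s s₃ := hk₂.trans (hk₃.mono (by decide))
  have halive₃ : AliveIs s₃ S := by
    intro i
    rw [ha₃]
    exact halive₁ i
  have hX1 : (Expr.reg rX).val E.inp s₁ ≠ 0 := by
    change s₁.reg rX ≠ 0
    omega
  rcases hres₃ with ⟨hf0, hnone⟩ | ⟨j, hjn, hij, hfj⟩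
  · have h4 := Run.assign (E := E.toEnv) (x := 0) (e := .lit 1) (s := s₃) rfl
      (by simp only [Expr.size]; omega) (fun _ => by simp only [Expr.val]; omega)
    have hif := Run.ifExpr_neg (E := E.toEnv) (e := .reg rF) (p :=
          (.seq (assign rJ (.bin .sub (.reg rF) (.lit 1))) <|
          scan rI dotProg (.bin .sub (.lit 1) (.reg rAcc)) (put 0 (.reg rI) (.lit 0))))
          rfl (by simp only [Expr.size]; omega) hf0 h4
    have hall := Run.ifExpr_pos (q := .skip) rfl (by simp only [Expr.size]; omega) hX1
      (h2.seq (h3.seq (hr₃.seq hif)))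
    refine ⟨_, S, (h0.seq (hr₁.seq hall)).mono ?_,
      (hk₃'.mono (List.subset_cons_self _ _)).setReg List.mem_cons_self _, halive₃,
      Or.inr (Or.inl ⟨i, hiS, hnone, rfl, setReg_self _ _ _⟩)⟩
    simp only [Expr.cost]
    omega
  -- removal of the star
  have hv₄ : (Expr.bin .sub (.reg rF) (.lit 1)).val E.inp s₃ = j := by
    change s₃.reg rF - 1 = j
    omega
  have h4 := Run.assign (E := E.toEnv) (x := rJ) (e := .bin .sub (.reg rF) (.lit 1)) (s := s₃)
    (by decide) (by simp only [Expr.size]; omega) (fun _ => by rw [hv₄]; omega)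
  rw [hv₄] at h4
  have hk₄ : Keeps starRegs s (s₃.setReg rJ j) := hk₃'.setReg (by decide) _
  obtain ⟨s₅, hr₅, hk₅, halive₅⟩ := run_scan_kill E (X := [rI, rV, rAcc]) (pre := dotProg)
    (e := .bin .sub (.lit 1) (.reg rAcc)) (c := 50 * (E.d + 1)) (P := fun i => Orth E i j)
    (s₀ := s₃.setReg rJ j) (S := S) (by decide) (by decide) (by decide) (by decide)
    ((hk₄.1 rN (by decide)).trans hn) hS halive₃ (by
      intro s' hk
      obtain ⟨s'', hr, hacc, hreg, harr⟩ := hdot s'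
        ((hk.1 rDim (by decide)).trans ((hk₄.1 rDim (by decide)).trans hd))
      have hj : s'.reg rJ = j := by
        rw [hk.1 rJ (by decide), setReg_self]
      refine ⟨s'', hr, hk.trans ⟨fun r hr => hreg r ?_, fun a _ => by rw [harr]⟩, harr,
        hreg _ (by decide), ?_⟩
      · simp only [List.mem_cons, List.not_mem_nil, or_false, not_or] at hr ⊢
        exact hr.2
      · change 1 - s''.reg rAcc ≠ 0 ↔ _
        rw [hacc, hj, Orth]
        omega)
  have hk₅' : Keeps starRegs s s₅ := hk₄.trans (hk₅.mono (by decide))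
  have hF : (Expr.reg rF).val E.inp s₃ ≠ 0 := by
    change s₃.reg rF ≠ 0
    omega
  have hif := Run.ifExpr_pos (q := assign 0 (.lit 1)) rfl (by simp only [Expr.size]; omega) hF
    (h4.seq hr₅)
  have hall := Run.ifExpr_pos (q := .skip) rfl (by simp only [Expr.size]; omega) hX1
      (h2.seq (h3.seq (hr₃.seq hif)))
  refine ⟨s₅, S.filter (fun i => ¬ Orth E i j), (h0.seq (hr₁.seq hall)).mono ?_,
    hk₅'.mono (List.subset_cons_self _ _), halive₅,
    Or.inr (Or.inr ⟨i, hiS, j, hjn, hij, rfl, hk₅'.1 0 (by decide)⟩)⟩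
  simp only [Expr.cost]
  omega

end HS

end WordRAM

namespace WordRAM

namespace HS

/-! ### The matching instance as seen by the subroutine -/

/-- The size `2 n`, wherever it is read. -/
def rdSize (_ _ : ℕ) : Expr := .bin .mul (.lit 2) (.reg rN)

/-- The row of the bit with index `r`. -/
def eRow (r : ℕ) : Expr := .bin .div (.reg r) (.reg rBig)

/-- The column of the bit with index `r`. -/
def eCol (r : ℕ) : Expr := .bin .mod (.reg r) (.reg rBig)

/-- The coordinate to which this column belongs. -/
def eCoord (r : ℕ) : Expr := .bin .div (eCol r) (.lit 3)

/-- The test `a < b`. -/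
def eLt (a b : Expr) : Expr := .bin .sub b a

/-- The value of `Gadget.vecA`. -/
def eVecA (r : ℕ) : Expr :=
  .ite (eLt (eCoord r) (.reg rDim))
    (.bin .mul (.arr 0 (eRow r)) (.inp 1 (.bin .add (.bin .mul (eRow r) (.reg rDim)) (eCoord r)))) <|
  .ite (eLt (eCoord r) (.bin .mul (.lit 2) (.reg rDim)))
    (.bin .mod (.bin .shr (eRow r) (.bin .sub (eCoord r) (.reg rDim))) (.lit 2)) <|
  .ite (eLt (eCoord r) (.bin .mul (.lit 3) (.reg rDim))) (.lit 0) (.arr 0 (eRow r))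

/-- The value of `Gadget.vecB`. -/
def eVecB (r : ℕ) : Expr :=
  .ite (eLt (eCoord r) (.reg rDim))
    (.inp 2 (.bin .add (.bin .mul (eRow r) (.reg rDim)) (eCoord r))) <|
  .ite (eLt (eCoord r) (.bin .mul (.lit 2) (.reg rDim))) (.lit 0) <|
  .ite (eLt (eCoord r) (.bin .mul (.lit 3) (.reg rDim)))
    (.bin .mod (.bin .shr (eRow r) (.bin .sub (eCoord r) (.bin .mul (.lit 2) (.reg rDim))))
      (.lit 2)) <|
  .ite (eLt (eRow r) (.reg rN)) (.lit 0) (.lit 1)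

/-- The test whether the column is one of those in use. -/
def eInRange (r : ℕ) : Expr :=
  eLt (eCol r) (.bin .mul (.lit 3) (.bin .add (.bin .mul (.lit 3) (.reg rDim)) (.lit 1)))

/-- The input of the matching instance, computed on the fly. In particular, nothing has to be
written down for the columns which are not in use, whose number may be large. -/
def rdMatch : ℕ → ℕ → Expr
  | 0, r => .ite (.reg r) (.ite (eLt (.lit 1) (.reg r)) (.lit 0) (.reg rBig))
      (.bin .mul (.lit 2) (.reg rN))
  | 1, r => .ite (eLt (.reg r) (.bin .mul (.bin .mul (.lit 2) (.reg rN)) (.reg rBig)))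
      (.ite (eInRange r) (.ite (eLt (.bin .mod (eCol r) (.lit 3)) (.lit 2))
        (.bin .sub (.lit 1) (eVecA r)) (.lit 0)) (.lit 0)) (.lit 0)
  | 2, r => .ite (eLt (.reg r) (.bin .mul (.bin .mul (.lit 2) (.reg rN)) (.reg rBig)))
      (.ite (eInRange r) (.ite (.bin .mod (eCol r) (.lit 3)) (eVecB r) (.lit 1)) (.lit 0)) (.lit 0)
  | _, _ => .lit 0

theorem rdSize_tame (a y : ℕ) : (rdSize a (vreg y)).Tame ∧ (rdSize a (vreg y)).size ≤ 100 ∧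
    (rdSize a (vreg y)).cost + 2 ≤ 500 :=
  ⟨rfl, by simp [rdSize, Expr.size], by simp [rdSize, Expr.cost]⟩

theorem rdMatch_tame (a y : ℕ) : (rdMatch a (vreg y)).Tame ∧ (rdMatch a (vreg y)).size ≤ 100 ∧
    (rdMatch a (vreg y)).cost + 2 ≤ 500 := by
  match a with
  | 0 | 1 | 2 =>
    simp [rdMatch, eLt, eInRange, eVecA, eVecB, eCol, eRow, eCoord, Expr.Tame, BinOp.Tame,
      Expr.size, Expr.cost]
  | _ + 3 => simp [rdMatch, Expr.Tame, Expr.size, Expr.cost]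

theorem val_ite_lt (I : ℕ → ℕ → ℕ) (s : State) (a b c c' : Expr) :
    (Expr.ite (eLt a b) c c').val I s =
      if a.val I s < b.val I s then c.val I s else c'.val I s := by
  change (if b.val I s - a.val I s ≠ 0 then _ else _) = _
  by_cases h : a.val I s < b.val I s
  · rw [if_pos (by omega), if_pos h]
  · rw [if_neg (by omega), if_neg h]

/-- The instance of the matching problem for the set `S` of living vectors. -/
def matchInst (E : HSEnv) (dd : ℕ → ℕ) (S : Finset ℕ) (hn : 2 * E.n ≤ 2 ^ E.d)
    (hD : 3 * (3 * E.d + 1) ≤ dd (2 * E.n)) : VectorPair dd where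
  n := 2 * E.n
  A := Gadget.setA E.n E.d (dd (2 * E.n)) (fun i => if i ∈ S then 1 else 0) (E.inp 1)
  B := Gadget.setB E.n E.d (dd (2 * E.n)) (E.inp 2)
  injA := Gadget.setA_injective hn hD
  injB := Gadget.setB_injective hn hD

theorem bitArray_eq {n D : ℕ} {A : Fin n → Fin D → Bool} {f : ℕ → ℕ → ℕ} (hf : ∀ i c, f i c ≤ 1)
    (hA : ∀ i c, A i c = (f i c != 0)) (y : ℕ) :
    bitArray A y = if y < n * D then f (y / D) (y % D) else 0 := by
  unfold bitArray
  split_ifs with h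
  · rw [hA]
    change (f (y / D) (y % D) != 0).toNat = _
    have := hf (y / D) (y % D)
    interval_cases f (y / D) (y % D) <;> rfl
  · rfl

theorem bitA_le_one (d : ℕ) (alive ia : ℕ → ℕ) (i c : ℕ) : Gadget.bitA d alive ia i c ≤ 1 := by
  unfold Gadget.bitA
  split_ifs <;> omega

theorem bitB_le_one (n d : ℕ) {ib : ℕ → ℕ} (hib : ∀ y, ib y ≤ 1) (j c : ℕ) :
    Gadget.bitB n d ib j c ≤ 1 := by
  unfold Gadget.bitB
  split_ifs
  · omega
  · exact Gadget.vecB_le_one hib _ _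
  · omega

theorem val_eVecA (I : ℕ → ℕ → ℕ) (s : State) (r : ℕ) :
    (eVecA r).val I s = Gadget.vecA (s.reg rDim) (s.arr 0) (I 1) (s.reg r / s.reg rBig)
      (s.reg r % s.reg rBig / 3) := by
  rw [eVecA, val_ite_lt, val_ite_lt, val_ite_lt]
  rfl

theorem val_eVecB (I : ℕ → ℕ → ℕ) (s : State) (r : ℕ) :
    (eVecB r).val I s = Gadget.vecB (s.reg rN) (s.reg rDim) (I 2) (s.reg r / s.reg rBig)
      (s.reg r % s.reg rBig / 3) := by
  rw [eVecB, val_ite_lt, val_ite_lt, val_ite_lt, val_ite_lt]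
  rfl

theorem val_rdMatch (E : HSEnv) (dd : ℕ → ℕ) {S : Finset ℕ} (hn : 2 * E.n ≤ 2 ^ E.d)
    (hD : 3 * (3 * E.d + 1) ≤ dd (2 * E.n)) {s : State} (h1 : s.reg rN = E.n)
    (h2 : s.reg rDim = E.d) (h3 : s.reg rBig = dd (2 * E.n)) (h4 : AliveIs s S) (a r : ℕ) :
    (rdMatch a r).val E.inp s = (matchInst E dd S hn hD).input a (s.reg r) := by
  have halive : s.arr 0 = fun i => if i ∈ S then 1 else 0 := funext h4
  match a with
  | 0 =>
    have e1 : (rdMatch 0 r).val E.inp s = if s.reg r ≠ 0 then (if 1 < s.reg r then 0 else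
        dd (2 * E.n)) else 2 * E.n := by
      rw [rdMatch]
      change (if s.reg r ≠ 0 then Expr.val E.inp s (.ite (eLt (.lit 1) (.reg r)) _ _)
        else 2 * s.reg rN) = _
      rw [val_ite_lt, h1]
      change (if s.reg r ≠ 0 then if 1 < s.reg r then 0 else s.reg rBig else 2 * E.n) = _
      rw [h3]
    rw [e1]
    generalize s.reg r = y
    match y with
    | 0 => rfl
    | 1 => rfl
    | y + 2 => simp [VectorPair.input]
  | 1 =>
    have hin : (matchInst E dd S hn hD).input 1 (s.reg r) =
        bitArray (matchInst E dd S hn hD).A (s.reg r) := by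
      simp only [VectorPair.input]
    rw [hin, bitArray_eq (A := (matchInst E dd S hn hD).A)
      (f := Gadget.bitA E.d (fun i => if i ∈ S then 1 else 0) (E.inp 1))
      (bitA_le_one _ _ _) (fun _ _ => rfl)]
    rw [rdMatch, val_ite_lt, eInRange, val_ite_lt, val_ite_lt]
    change (if s.reg r < 2 * s.reg rN * s.reg rBig then
      (if s.reg r % s.reg rBig < 3 * (3 * s.reg rDim + 1) then
        (if s.reg r % s.reg rBig % 3 < 2 then 1 - (eVecA r).val E.inp s else 0) else 0) else 0) = _
    rw [val_eVecA, h1, h2, h3, halive]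
    rfl
  | 2 =>
    have hin : (matchInst E dd S hn hD).input 2 (s.reg r) =
        bitArray (matchInst E dd S hn hD).B (s.reg r) := by
      simp only [VectorPair.input]
    rw [hin, bitArray_eq (A := (matchInst E dd S hn hD).B) (f := Gadget.bitB E.n E.d (E.inp 2))
      (bitB_le_one _ _ E.inp_two_le) (fun _ _ => rfl)]
    rw [rdMatch, val_ite_lt, eInRange, val_ite_lt]
    change (if s.reg r < 2 * s.reg rN * s.reg rBig then
      (if s.reg r % s.reg rBig < 3 * (3 * s.reg rDim + 1) then
        (if s.reg r % s.reg rBig % 3 ≠ 0 then (eVecB r).val E.inp s else 1) else 0) else 0) = _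
    rw [val_eVecB, h1, h2, h3, ite_not]
    rfl
  | _ + 3 => simp [rdMatch, Expr.val, VectorPair.input]

/-! ### Deterministic parts of the algorithm -/

/-- The integer part of the `h`-th root. -/
def root (h n : ℕ) : ℕ := Nat.findGreatest (fun g => g ^ h ≤ n) n

theorem root_pow_le {h : ℕ} (hh : 0 < h) (n : ℕ) : root h n ^ h ≤ n :=
  Nat.findGreatest_spec (P := fun g => g ^ h ≤ n) (Nat.zero_le n) (by simp [hh.ne'])

theorem root_le (h n : ℕ) : root h n ≤ n := Nat.findGreatest_le n

theorem lt_root_add_one_pow {h : ℕ} (hh : 0 < h) (n : ℕ) : n < (root h n + 1) ^ h := by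
  by_contra hcon
  have h1 : root h n + 1 ≤ n :=
    (Nat.le_self_pow hh.ne' _).trans (not_lt.1 hcon)
  exact Nat.findGreatest_is_greatest (P := fun g => g ^ h ≤ n) (Nat.lt_succ_self _) h1
    (not_lt.1 hcon)

theorem root_pos {h n : ℕ} (hh : 0 < h) (hn : 0 < n) : 0 < root h n := by
  rw [Nat.pos_iff_ne_zero]
  intro h0
  have := lt_root_add_one_pow hh n
  rw [h0] at this
  simp at this
  omega

theorem eq_root {h n g : ℕ} (hh : 0 < h) (h1 : n < (g + 1) ^ h)
    (h2 : ∀ i < g, (i + 1) ^ h ≤ n) : g = root h n := by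
  refine le_antisymm ?_ ?_
  · rcases g with _ | g
    · omega
    · have := (h2 g (by omega)).trans_lt (lt_root_add_one_pow hh n)
      have := lt_of_pow_lt_pow_left₀ h (Nat.zero_le _) this
      omega
  · have := (root_pow_le hh n).trans_lt h1
    have := lt_of_pow_lt_pow_left₀ h (Nat.zero_le _) this
    omega

/-- The quotient of `n` by a power of `rI + 1`, which vanishes exactly if the power exceeds `n`;
unlike the power itself, it never exceeds the bounds of a word. -/
def eQuot : ℕ → Expr
  | 0 => .reg rN
  | h + 1 => .bin .div (eQuot h) (.bin .add (.reg rI) (.lit 1))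

theorem eQuot_size (h : ℕ) : (eQuot h).size = 2 * h + 1 := by
  induction h with
  | zero => rfl
  | succ h ih => simp only [eQuot, Expr.size, ih]; ring

theorem eQuot_cost (h : ℕ) : (eQuot h).cost = 8 * h + 1 := by
  induction h with
  | zero => rfl
  | succ h ih => simp only [eQuot, Expr.cost, ih]; ring

theorem eQuot_tame (h : ℕ) : (eQuot h).Tame := by
  induction h with
  | zero => rfl
  | succ h ih => simp only [eQuot, Expr.Tame, BinOp.Tame, ih]; rfl

theorem eQuot_val (I : ℕ → ℕ → ℕ) (s : State) (h : ℕ) :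
    (eQuot h).val I s = s.reg rN / (s.reg rI + 1) ^ h := by
  induction h with
  | zero => simp [eQuot, Expr.val]
  | succ h ih =>
    change (eQuot h).val I s / (s.reg rI + 1) = _
    rw [ih, Nat.div_div_eq_div_mul, pow_succ]

/-- Computes `root h n` into `rG`. -/
def rootProg (h : ℕ) : Prog :=
  .seq (assign rG (.reg rN)) (countdown rI (.reg rN) (ifExpr (eQuot h) .skip (assign rG (.reg rI))))

theorem run_rootProg (E : HSEnv) {h : ℕ} (hh : 0 < h) (hhS : 2 * h + 1 ≤ E.S) {s : State}
    (hn : s.reg rN = E.n) :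
    ∃ s', Run E.toEnv (rootProg h) s s' (E.n * (8 * h + 50) + 50) ∧ Keeps [rG, rI] s s' ∧
      s'.arr = s.arr ∧ s'.reg rG = root h E.n := by
  have hS := E.le_S
  have h0 := Run.assign (E := E.toEnv) (x := rG) (e := .reg rN) (s := s) rfl
    (by simp only [Expr.size]; omega) (fun hb => hb.1 rN)
  have hv0 : (Expr.reg rN).val E.inp s = E.n := hn
  rw [hv0] at h0
  -- `rG` has come down to the least `i ≥ x` with `n < (i + 1) ^ h`, or is still `n`
  let I : ℕ → State → Prop := fun x s' => Keeps [rG, rI] s s' ∧ s'.arr = s.arr ∧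
    E.n < (s'.reg rG + 1) ^ h ∧ ∀ i, x ≤ i → i < s'.reg rG → (i + 1) ^ h ≤ E.n
  have hloop := Run.countdown (E := E.toEnv) (x := rI) (n := E.n) (c := 8 * h + 20) (e := .reg rN)
    (p := ifExpr (eQuot h) .skip (assign rG (.reg rI)))
    (s := s.setReg rG E.n) (by decide) (by omega) rfl (by simp only [Expr.size]; omega)
    (by rw [Expr.val, setReg_of_ne (by decide), hn])
    (fun hb => by have := hb.1 rN; rwa [setReg_of_ne (by decide), hn] at this) I ?_ ?_
  · obtain ⟨s', hr, ⟨hk, ha, h1, h2⟩, -⟩ := hloop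
    refine ⟨s', (h0.seq hr).mono ?_, hk, ha, eq_root hh h1 fun i => h2 i (Nat.zero_le i)⟩
    have : E.n * (8 * h + 20 + 9) ≤ E.n * (8 * h + 50) := Nat.mul_le_mul_left _ (by omega)
    simp only [Expr.cost]
    omega
  · refine ⟨((Keeps.refl _ s).setReg (by decide) _).setReg (by decide) _, rfl, ?_, ?_⟩
    · rw [setReg_of_ne (by decide), setReg_self]
      exact (Nat.lt_succ_self _).trans_le (Nat.le_self_pow hh.ne' _)
    · intro i hi hi'
      rw [setReg_of_ne (by decide), setReg_self] at hi'
      omega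
  · intro i hi s₁ hI hx
    obtain ⟨hk, ha, h1, h2⟩ := hI
    have hn₁ : s₁.reg rN = E.n := (hk.1 rN (by decide)).trans hn
    have hval : (eQuot h).val E.inp (s₁.setReg rI i) = E.n / (i + 1) ^ h := by
      rw [eQuot_val, setReg_self, setReg_of_ne (by decide), hn₁]
    have hnB : E.n < E.B := by have := E.inp_lt 0 0; rwa [E.inp_n] at this
    have hpos : 0 < (i + 1) ^ h := by positivity
    by_cases hq : E.n / (i + 1) ^ h = 0
    · have h3 := Run.assign (E := E.toEnv) (x := rG) (e := .reg rI) (s := s₁.setReg rI i) rfl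
        (by simp only [Expr.size]; omega) (fun hb => hb.1 rI)
      have hv3 : (Expr.reg rI).val E.inp (s₁.setReg rI i) = i := setReg_self _ _ _
      rw [hv3] at h3
      have hif := Run.ifExpr_neg (p := .skip) (eQuot_tame h) (by rw [eQuot_size]; exact hhS)
        (hval.trans hq) h3
      refine ⟨_, hif.mono (by rw [eQuot_cost]; simp only [Expr.cost]; omega),
        ⟨(hk.setReg (by decide) _).setReg (by decide) _, ha, ?_, ?_⟩, ?_⟩
      · rw [setReg_self]
        exact (Nat.div_eq_zero_iff_lt hpos).1 hq
      · intro j hj hj'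
        rw [setReg_self] at hj'
        omega
      · rw [setReg_of_ne (by decide), setReg_self]
    · have hif := Run.ifExpr_pos (q := assign rG (.reg rI)) (eQuot_tame h)
        (by rw [eQuot_size]; exact hhS) (by rwa [hval]) (Run.skip E.toEnv (s₁.setReg rI i))
      refine ⟨_, hif.mono (by rw [eQuot_cost]; omega),
        ⟨hk.setReg (by decide) _, ha, ?_, ?_⟩, setReg_self _ _ _⟩
      · rw [setReg_of_ne (by decide)]
        exact h1
      · intro j hj hj'
        rw [setReg_of_ne (by decide)] at hj'
        by_cases hji : j = i
        · subst hji
          by_contra hcon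
          exact hq ((Nat.div_eq_zero_iff_lt hpos).2 (not_le.1 hcon))
        · exact h2 j (by omega) hj'

/-- Declares all vectors living. -/
def initAlive : Prog := countdown rI (.reg rN) (put 0 (.reg rI) (.lit 1))

theorem run_initAlive (E : HSEnv) {s : State} (hn : s.reg rN = E.n) (h0 : AliveIs s ∅) :
    ∃ s', Run E.toEnv initAlive s s' (E.n * 20 + 20) ∧ Keeps [rI] s s' ∧
      AliveIs s' (Finset.range E.n) := by
  have hS := E.le_S
  have hB := E.le_B
  let I : ℕ → State → Prop := fun x s' => Keeps [rI] s s' ∧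
    AliveIs s' (Finset.Ico x E.n)
  have hloop := Run.countdown (E := E.toEnv) (x := rI) (n := E.n) (c := 10) (e := .reg rN)
    (p := put 0 (.reg rI) (.lit 1))
    (s := s) (by decide) (by omega) rfl (by simp only [Expr.size]; omega) hn
    (fun hb => by have := hb.1 rN; rwa [hn] at this) I ?_ ?_
  · obtain ⟨s', hr, ⟨hk, ha⟩, -⟩ := hloop
    refine ⟨s', hr.mono ?_, hk, by simpa using ha⟩
    have : E.n * (10 + 9) ≤ E.n * 20 := Nat.mul_le_mul_left _ (by omega)
    simp only [Expr.cost]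
    omega
  · refine ⟨(Keeps.refl _ s).setReg (by decide) _, ?_⟩
    rw [Finset.Ico_self]
    exact h0
  · intro i hi s₁ hI hx
    have hv := Run.put (E := E.toEnv) (a := 0) (i := .reg rI) (v := .lit 1) (s := s₁.setReg rI i)
      rfl (by simp only [Expr.size]; omega) rfl (by simp only [Expr.size]; omega)
      (fun _ => by simp only [Expr.val]; omega)
    have hvi : (Expr.reg rI).val E.inp (s₁.setReg rI i) = i := setReg_self _ _ _
    have hv1 : (Expr.lit 1).val E.inp (s₁.setReg rI i) = 1 := rfl
    rw [hvi, hv1] at hv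
    refine ⟨_, hv.mono (by simp only [Expr.cost]; omega),
      ⟨(hI.1.setReg (by decide) _).setArr _ _, fun j => ?_⟩, setReg_self s₁ rI i⟩
    rw [State.setArr_arr_self]
    by_cases hj : j = i
    · subst hj
      simp [hi]
    · have h1 := hI.2 j
      have h2 : j ∈ Finset.Ico i E.n ↔ j ∈ Finset.Ico (i + 1) E.n := by
        simp only [Finset.mem_Ico]
        omega
      simpa [hj, h2, State.setReg] using h1

/-- What holds between the phases of the algorithm: vectors of `A` outside the set `S` of living
vectors are known to be orthogonal to some vector of `B`. -/
structure Inv (E : HSEnv) (D g : ℕ) (s : State) (S : Finset ℕ) : Prop where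
  n : s.reg rN = E.n
  d : s.reg rDim = E.d
  big : s.reg rBig = D
  root : s.reg rG = g
  ans : s.reg 0 = 0
  stamps : StampsOld s
  alive : AliveIs s S
  sub : S ⊆ Finset.range E.n
  dead : ∀ i < E.n, i ∉ S → ∃ j < E.n, Orth E i j

theorem Inv.of_keeps {E : HSEnv} {D g : ℕ} {s s' : State} {S S' : Finset ℕ} {X : List ℕ}
    (h : Inv E D g s S) (hk : Keeps X s s')
    (hX : ∀ r ∈ [rN, rDim, rBig, rG, 0, epochReg], r ∉ X) (ha : AliveIs s' S') (hS : S' ⊆ S)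
    (hd : ∀ i ∈ S, i ∉ S' → ∃ j < E.n, Orth E i j) : Inv E D g s' S' where
  n := (hk.1 _ (hX _ (by decide))).trans h.n
  d := (hk.1 _ (hX _ (by decide))).trans h.d
  big := (hk.1 _ (hX _ (by decide))).trans h.big
  root := (hk.1 _ (hX _ (by decide))).trans h.root
  ans := (hk.1 _ (hX _ (by decide))).trans h.ans
  stamps := by
    intro a y
    rw [hk.2 _ (by unfold stampArr; omega), hk.1 _ (hX _ (by decide))]
    exact h.stamps a y
  alive := ha
  sub := hS.trans h.sub
  dead := by
    intro i hi hiS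
    by_cases h' : i ∈ S
    · exact hd i h' hiS
    · exact h.dead i hi h'

/-- Some vector of `A` is orthogonal to no vector of `B`. -/
def IsYes (E : HSEnv) : Prop := ∃ i < E.n, ∀ j < E.n, ¬ Orth E i j

/-- The exhaustive search. Its successful steps yield a matching, so if there are no large
matchings, it ends early. -/
def searchPhase : Prog := countdown rC (.bin .mul (.lit 2) (.bin .div (.reg rN) (.reg rG))) starStep

/-- If no matching has size `2 * (n / g)`, then the search runs out of living vectors or finds a
hitting vector before it runs out of steps. -/
theorem run_searchPhase (E : HSEnv) {D g : ℕ} (h2n : 2 * E.n < E.B) {s : State} {S : Finset ℕ}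
    (hInv : Inv E D g s S) :
    ∃ s', Run E.toEnv searchPhase s s'
        (2 * (E.n / g) * (3 * (E.n * (50 * (E.d + 1) + 100)) + 550) + 50) ∧
      (¬ Gadget.HasMatching E.n (Orth E) (2 * (E.n / g)) S → (s'.reg 0 ≠ 0 ↔ IsYes E)) := by
  have hSS := E.le_S
  set b := 2 * (E.n / g) with hb
  -- With `x` steps to go and no answer yet, either all vectors are dead or the steps so far have
  -- produced a matching of size `b - x` whose partners in `B` are orthogonal to no living vector.
  let J : ℕ → State → Prop := fun x s' => ∃ S', s'.reg rN = E.n ∧ s'.reg rDim = E.d ∧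
    AliveIs s' S' ∧ S' ⊆ S ∧ (∀ i < E.n, i ∉ S' → ∃ j < E.n, Orth E i j) ∧
    (s'.reg 0 ≠ 0 → IsYes E) ∧
    (s'.reg 0 = 0 → S' = ∅ ∨ ∃ T ⊆ S, ∃ f : ℕ → ℕ, Set.InjOn f T ∧
      (∀ i ∈ T, f i < E.n ∧ Orth E i (f i)) ∧ T.card + x = b ∧
      ∀ i ∈ S', ∀ t ∈ T, ¬ Orth E i (f t))
  have hdivle : E.n / g ≤ E.n := Nat.div_le_self _ _
  have hloop := Run.countdown (E := E.toEnv) (x := rC) (n := b)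
    (c := 3 * (E.n * (50 * (E.d + 1) + 100)) + 500)
    (e := .bin .mul (.lit 2) (.bin .div (.reg rN) (.reg rG)))
    (p := starStep) (s := s) (by decide) (by omega) rfl (by simp only [Expr.size]; omega)
    (by simp only [Expr.val, BinOp.eval, hInv.n, hInv.root, hb])
    (fun _ => by omega) J ?_ ?_
  · obtain ⟨s', hr, ⟨S', -, -, hal, hsub, hdead, hyes, hno⟩, -⟩ := hloop
    refine ⟨s', hr.mono ?_, fun hM => ⟨hyes, fun hY h0 => ?_⟩⟩
    · have : b * (3 * (E.n * (50 * (E.d + 1) + 100)) + 500 + 9) ≤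
          b * (3 * (E.n * (50 * (E.d + 1) + 100)) + 550) := Nat.mul_le_mul_left _ (by omega)
      simp only [Expr.cost]
      linarith
    · rcases hno h0 with rfl | ⟨T, hT, f, hf, hfO, hc, -⟩
      · obtain ⟨i, hi, hij⟩ := hY
        obtain ⟨j, hj, hO⟩ := hdead i hi (by simp)
        exact hij j hj hO
      · exact hM ⟨T, hT, f, hf, hfO, by omega⟩
  · refine ⟨S, ?_, ?_, ?_, subset_rfl, hInv.dead, ?_, ?_⟩
    · rw [setReg_of_ne (by decide), hInv.n]
    · rw [setReg_of_ne (by decide), hInv.d]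
    · exact hInv.alive
    · rw [setReg_of_ne (by decide), hInv.ans]
      simp
    · intro _
      exact Or.inr ⟨∅, by simp, id, by simp, by simp, by simp, by simp⟩
  · intro i hi s₁ hJ hx
    obtain ⟨S', hn, hd, hal, hsub, hdead, hyes, hno⟩ := hJ
    obtain ⟨s₂, S₂, hr, hk, hal₂, hcase⟩ := run_starStep E (s := s₁.setReg rC i) (S := S')
      (by rw [setReg_of_ne (by decide), hn]) (by rw [setReg_of_ne (by decide), hd])
      (hsub.trans hInv.sub) hal
    have h0 : (s₁.setReg rC i).reg 0 = s₁.reg 0 := setReg_of_ne (by decide) _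
    rw [h0] at hcase
    refine ⟨s₂, hr, ⟨S₂, ?_, ?_, hal₂, ?_⟩, ?_⟩
    · rw [hk.1 rN (by decide), setReg_of_ne (by decide), hn]
    · rw [hk.1 rDim (by decide), setReg_of_ne (by decide), hd]
    · rcases hcase with ⟨rfl, rfl, h3⟩ | ⟨i₀, hi₀, hiso, rfl, h3⟩ | ⟨i₀, hi₀, j, hj, hO, rfl, h3⟩
      · rw [h3]
        exact ⟨hsub, hdead, hyes, fun _ => Or.inl rfl⟩
      · rw [h3]
        exact ⟨hsub, hdead, fun _ => ⟨i₀, Finset.mem_range.1 (hInv.sub (hsub hi₀)), hiso⟩,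
          fun h => absurd h one_ne_zero⟩
      · rw [h3]
        refine ⟨(Finset.filter_subset _ _).trans hsub, ?_, hyes, fun h => Or.inr ?_⟩
        · intro k hk' hkS
          by_cases hkS' : k ∈ S'
          · refine ⟨j, hj, ?_⟩
            by_contra hcon
            exact hkS (Finset.mem_filter.2 ⟨hkS', hcon⟩)
          · exact hdead k hk' hkS'
        · rcases hno h with rfl | ⟨T, hT, f, hf, hfO, hc, hnew⟩
          · simp at hi₀
          have hiT : i₀ ∉ T := fun hiT => hnew i₀ hi₀ i₀ hiT (hfO i₀ hiT).2
          have hfne : ∀ t ∈ T, f t ≠ j := by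
            rintro t ht rfl
            exact hnew i₀ hi₀ t ht hO
          have hfT : ∀ t ∈ T, Function.update f i₀ j t = f t := by
            intro t ht
            refine Function.update_of_ne ?_ _ _
            rintro rfl
            exact hiT ht
          refine ⟨insert i₀ T, Finset.insert_subset (hsub hi₀) hT, Function.update f i₀ j,
            ?_, ?_, ?_, ?_⟩
          · rw [Finset.coe_insert, Set.injOn_insert (by simpa using hiT)]
            refine ⟨fun a ha c hc' hac => ?_, ?_⟩
            · rw [hfT a ha, hfT c hc'] at hac
              exact hf ha hc' hac
            · rintro ⟨t, ht, hte⟩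
              rw [hfT t ht, Function.update_self] at hte
              exact hfne t ht hte
          · intro t ht
            rcases Finset.mem_insert.1 ht with rfl | ht
            · rw [Function.update_self]
              exact ⟨hj, hO⟩
            · rw [hfT t ht]
              exact hfO t ht
          · rw [Finset.card_insert_of_notMem hiT]
            omega
          · intro k hkS t ht
            rw [Finset.mem_filter] at hkS
            rcases Finset.mem_insert.1 ht with rfl | ht
            · rw [Function.update_self]
              exact hkS.2
            · rw [hfT t ht]
              exact hnew k hkS.1 t ht
    · rw [hk.1 rC (by decide), setReg_self]

end HS

end WordRAM

namespace WordRAM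

namespace HS

/-! ### Randomized rounds -/

/-- The expectation of a quantity that is always at most `b`, and at most `a` with probability at
least `2 / 3`. -/
theorem tsum_mul_le_of_prob {α : Type*} (p : PMF α) (C : Set α) (hC : 2 / 3 ≤ p.toOuterMeasure C)
    (G : α → ℝ≥0∞) {a b : ℝ≥0∞} (hab : a ≤ b) (hb : ∀ x, G x ≤ b) (ha : ∀ x ∈ C, G x ≤ a) :
    ∑' x, p x * G x ≤ 2 / 3 * a + 1 / 3 * b := by
  classical
  set P := p.toOuterMeasure C
  set Q := p.toOuterMeasure Cᶜ
  have hPQ : P + Q = 1 := by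
    simp only [P, Q, PMF.toOuterMeasure_apply]
    rw [← ENNReal.tsum_add, ← p.tsum_coe]
    refine tsum_congr fun c => ?_
    by_cases hc : c ∈ C <;> simp [Set.indicator, hc]
  have h1 : ∑' x, p x * G x ≤ P * a + Q * b := by
    simp only [P, Q, PMF.toOuterMeasure_apply]
    rw [← ENNReal.tsum_mul_right, ← ENNReal.tsum_mul_right, ← ENNReal.tsum_add]
    refine ENNReal.tsum_le_tsum fun x => ?_
    by_cases hx : x ∈ C
    · simpa [Set.indicator, hx] using mul_le_mul_right (ha x hx) (p x)
    · simpa [Set.indicator, hx] using mul_le_mul_right (hb x) (p x)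
  obtain ⟨x, hx⟩ := exists_add_of_le hC
  have h13 : (2 / 3 : ℝ≥0∞) + 1 / 3 = 1 := by
    rw [ENNReal.div_add_div_same]
    norm_num
    exact ENNReal.div_self (by norm_num) (by norm_num)
  have h23 : (2 / 3 : ℝ≥0∞) ≠ ⊤ := (ENNReal.div_lt_top (by norm_num) (by norm_num)).ne
  have hxQ : x + Q = 1 / 3 := by
    have : (2 / 3 : ℝ≥0∞) + (x + Q) = 2 / 3 + 1 / 3 := by
      rw [← add_assoc, ← hx, hPQ, h13]
    exact (ENNReal.add_right_inj h23).1 this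
  calc ∑' x, p x * G x ≤ P * a + Q * b := h1
    _ = 2 / 3 * a + (x * a + Q * b) := by rw [hx]; ring
    _ ≤ 2 / 3 * a + (x * b + Q * b) := by gcongr
    _ = 2 / 3 * a + 1 / 3 * b := by rw [← add_mul, hxQ]

/-- An upper bound for the probability that large matchings remain after `t` more rounds, when `r`
vectors are alive and every successful round removes `b` of them. -/
noncomputable def drift (b t r : ℕ) : ℝ :=
  if 2 * b * t ≤ 3 * r then 1 else 3 * r / (2 * b * t)

theorem drift_nonneg (b t r : ℕ) : 0 ≤ drift b t r := by
  unfold drift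
  split_ifs <;> positivity

theorem drift_le_one (b t r : ℕ) : drift b t r ≤ 1 := by
  unfold drift
  split_ifs with h
  · exact le_rfl
  · have h' : (3 * r : ℝ) < 2 * b * t := by exact_mod_cast not_le.1 h
    exact (div_le_one (lt_of_le_of_lt (by positivity) h')).2 h'.le

theorem drift_mono (b t : ℕ) {r r' : ℕ} (h : r' ≤ r) : drift b t r' ≤ drift b t r := by
  by_cases h1 : 2 * b * t ≤ 3 * r
  · exact (drift_le_one _ _ _).trans (by simp [drift, h1])
  · have h2 : ¬ 2 * b * t ≤ 3 * r' := by omega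
    rw [drift, drift, if_neg h1, if_neg h2]
    have : (r' : ℝ) ≤ r := by exact_mod_cast h
    gcongr

theorem drift_le_div {b t : ℕ} (r : ℕ) (hbt : 0 < b * t) :
    drift b t r ≤ 3 * r / (2 * b * t) := by
  unfold drift
  split_ifs with h
  · have h' : (2 * b * t : ℝ) ≤ 3 * r := by exact_mod_cast h
    have : (0 : ℝ) < b * t := by exact_mod_cast hbt
    rw [le_div_iff₀ (by nlinarith)]
    linarith
  · exact le_rfl

/-- One round: the average decrease of `r` is at least `2 b / 3`. -/
theorem drift_step {b t r : ℕ} (hb : 0 < b) (hr : 2 * b ≤ r) :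
    2 / 3 * drift b t (r - b) + 1 / 3 * drift b t r ≤ drift b (t + 1) r := by
  by_cases h : 2 * b * (t + 1) ≤ 3 * r
  · have h1 : drift b (t + 1) r = 1 := by simp [drift, h]
    rw [h1]
    have := drift_le_one b t (r - b)
    have := drift_le_one b t r
    linarith
  · rcases Nat.eq_zero_or_pos t with rfl | ht
    · omega
    have hbt : 0 < b * t := Nat.mul_pos hb ht
    have h1 := drift_le_div (r - b) hbt
    have h2 := drift_le_div r hbt
    have hbt' : (0 : ℝ) < b * t := by exact_mod_cast hbt
    have hb' : (0 : ℝ) < b := by exact_mod_cast hb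
    have ht' : (0 : ℝ) < t := by exact_mod_cast ht
    have h' : (3 * r : ℝ) < 2 * b * (t + 1) := by exact_mod_cast not_le.1 h
    have h3 : drift b (t + 1) r = 3 * r / (2 * b * (t + 1)) := by
      rw [drift, if_neg h]
      push_cast
      rfl
    rw [h3]
    have h4 : (((r - b : ℕ) : ℕ) : ℝ) = r - b := by
      rw [Nat.cast_sub (by omega)]
    rw [h4] at h1
    have h5 : (2 / 3 * (3 * (r - b) / (2 * b * t)) + 1 / 3 * (3 * r / (2 * b * t)) : ℝ) ≤
        3 * r / (2 * b * (t + 1)) := by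
      have e : (2 / 3 * (3 * (r - b) / (2 * b * t)) + 1 / 3 * (3 * r / (2 * b * t)) : ℝ) =
          (3 * r - 2 * b) / (2 * b * t) := by
        field_simp
        ring
      rw [e, div_le_div_iff₀ (by positivity) (by positivity)]
      nlinarith
    linarith

/-- The bound for the failure probability when `t` rounds remain and `S` is the set of living
vectors. Without a matching of size `2 b` in `S` the final search is certain to succeed. -/
noncomputable def failBound (E : HSEnv) (b t : ℕ) (S : Finset ℕ) : ℝ≥0∞ :=
  open scoped Classical in
  if Gadget.HasMatching E.n (Orth E) (2 * b) S then ENNReal.ofReal (drift b t S.card) else 0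

theorem failBound_le (E : HSEnv) (b t : ℕ) {S : Finset ℕ} {r : ℕ} (h : S.card ≤ r) :
    failBound E b t S ≤ ENNReal.ofReal (drift b t r) := by
  unfold failBound
  split_ifs
  · exact ENNReal.ofReal_le_ofReal (drift_mono b t h)
  · exact zero_le

theorem failBound_mono (E : HSEnv) (b t : ℕ) {S S' : Finset ℕ} (hS : S' ⊆ S) {r : ℕ}
    [Decidable (Gadget.HasMatching E.n (Orth E) (2 * b) S)]
    (h : Gadget.HasMatching E.n (Orth E) (2 * b) S → S'.card ≤ r) :
    failBound E b t S' ≤ if Gadget.HasMatching E.n (Orth E) (2 * b) S then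
      ENNReal.ofReal (drift b t r) else 0 := by
  by_cases hM : Gadget.HasMatching E.n (Orth E) (2 * b) S
  · rw [if_pos hM]
    exact failBound_le E b t (h hM)
  · have : ¬ Gadget.HasMatching E.n (Orth E) (2 * b) S' := fun h' => hM (h'.mono hS)
    simp [failBound, this]

/-- One round: a matching, followed by the removal of the vectors matched orthogonally. -/
def round (W : ℕ) (p : Prog) : Prog := .seq (call W rdMatch p) killMatched

/-- The running time of a round in which the matching takes time `t`. -/
def roundCost (n d W t : ℕ) : ℕ := 500 * t + (2 * W + n * (50 * (d + 1) + 200) + 200)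

/-- A matching algorithm whose instances are large enough for the gadgets (`digits`, `dim`) and
whose approximation is good enough to lose at most `b` pairs of a matching (`approx`). -/
structure Matcher (E : HSEnv) (dd : ℕ → ℕ) (η : ℕ → ℝ) (b : ℕ) where
  p : Prog
  k : ℕ
  T : ℕ → ℕ
  W : ℕ
  solves : Solves (approxEMDMatching η dd) (2 / 3) p k T
  uses : UsesBelow W p
  pow_le : (2 * E.n + 2) ^ k ≤ E.B
  digits : 2 * E.n ≤ 2 ^ E.d
  dim : 3 * (3 * E.d + 1) ≤ dd (2 * E.n)
  nonneg : 0 ≤ η (2 * E.n)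
  approx : η (2 * E.n) * (2 * E.n : ℕ) * ((3 * E.d + 1 : ℕ) + 2) ≤ b
  pos : 0 < b

/-- One round succeeds with probability at least `2 / 3`, and then it removes `b` living vectors if
a matching of size `2 b` exists. No test whether the round succeeds is needed: a round that fails
removes only vectors that have an orthogonal partner, too. -/
theorem ok_round {E : HSEnv} {dd : ℕ → ℕ} {η : ℕ → ℝ} {b : ℕ} (M : Matcher E dd η b)
    {F : State → ℝ≥0∞} {K : List Prog} {k t g : ℕ} {s : State} {S : Finset ℕ}
    (hInv : Inv E (dd (2 * E.n)) g s S) (hepoch : s.reg epochReg + 1 < E.B)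
    (hK : ∀ s' S', Inv E (dd (2 * E.n)) g s' S' → s'.reg rC = s.reg rC →
      s'.reg epochReg = s.reg epochReg + 1 → OK E.toEnv F K s' k (failBound E b t S')) :
    OK E.toEnv F (round M.W M.p :: K) s (k + roundCost E.n E.d M.W (M.T (2 * E.n)))
      (failBound E b (t + 1) S) := by
  classical
  have hS := E.le_S
  let x := matchInst E dd S M.digits M.dim
  obtain ⟨hbd, hhalt, hprob⟩ := M.solves x
  -- the living vectors that remain if the subroutine ends in state `σ`
  let rest : State → Finset ℕ := fun σ =>
    S.filter fun i => ¬ (σ.arr 0 i < E.n ∧ Orth E i (σ.arr 0 i))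
  have hcall := OK.call (E := E.toEnv) (F := F) (rd := rdMatch) (vinp := x.input) (W := M.W)
    (C := 500) (k := k + (E.n * (50 * (E.d + 1) + 200) + 100)) (Mv := (2 * E.n + 2) ^ M.k)
    (T := M.T (2 * E.n)) (s := s) (K := killMatched :: K)
    (G := fun σ => failBound E b t (rest σ)) (P := fun _ => True) (p := M.p) M.pow_le
    (fun a y => ⟨(rdMatch_tame a y).1, (rdMatch_tame a y).2.1.trans hS, (rdMatch_tame a y).2.2⟩)
    ?_ (by norm_num) (by omega) M.uses hbd (fun c hc => ⟨hhalt c hc, trivial⟩) hInv.stamps hepoch ?_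
  · refine (hcall.seq).mono ?_ ?_
    · simp only [roundCost]
      omega
    · refine (tsum_mul_le_of_prob _ _ hprob (fun c => failBound E b t (rest c.2))
        (a := if Gadget.HasMatching E.n (Orth E) (2 * b) S then
          ENNReal.ofReal (drift b t (S.card - b)) else 0)
        (b := if Gadget.HasMatching E.n (Orth E) (2 * b) S then
          ENNReal.ofReal (drift b t S.card) else 0) ?_ ?_ ?_).trans ?_
      · split_ifs
        · exact ENNReal.ofReal_le_ofReal (drift_mono _ _ (Nat.sub_le _ _))
        · exact le_rfl
      · intro c
        have hsub : rest c.2 ⊆ S := Finset.filter_subset _ _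
        exact failBound_mono E b t hsub fun _ => Finset.card_le_card hsub
      · rintro c ⟨π, hπ, hcost⟩
        have hsub : rest c.2 ⊆ S := Finset.filter_subset _ _
        refine failBound_mono E b t hsub fun hM => ?_
        have := Gadget.card_add_le_of_matchingCost_le (n := E.n) (d := E.d) (D := dd (2 * E.n))
          (E := b) (S := S) (S' := rest c.2) (alive := fun i => if i ∈ S then 1 else 0)
          (ia := E.inp 1) (ib := E.inp 2) (fun _ => rfl) E.inp_one_le E.inp_two_le
          E.inp_two_eq_zero M.dim hInv.sub hM M.nonneg M.approx π hcost (Finset.filter_subset _ _)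
          (by
            intro i hi
            have h1 := (Finset.mem_filter.1 hi).2
            rwa [hπ i] at h1)
        omega
      · unfold failBound
        split_ifs with hM
        · have h2 := hM.le_card
          have e23 : (2 / 3 : ℝ≥0∞) = ENNReal.ofReal (2 / 3) := by
            rw [ENNReal.ofReal_div_of_pos (by norm_num)]
            norm_num
          have e13 : (1 / 3 : ℝ≥0∞) = ENNReal.ofReal (1 / 3) := by
            rw [ENNReal.ofReal_div_of_pos (by norm_num)]
            norm_num
          rw [e23, e13, ← ENNReal.ofReal_mul (by norm_num), ← ENNReal.ofReal_mul (by norm_num),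
            ← ENNReal.ofReal_add (mul_nonneg (by norm_num) (drift_nonneg _ _ _))
              (mul_nonneg (by norm_num) (drift_nonneg _ _ _))]
          exact ENNReal.ofReal_le_ofReal (drift_step M.pos h2)
        · simp
  · intro a y s' hs'
    refine val_rdMatch E dd M.digits M.dim ?_ ?_ ?_ ?_ a (vreg y)
    · rw [show rN = 3 * 2 from rfl, hs'.1 2]
      exact hInv.n
    · rw [show rDim = 3 * 3 from rfl, hs'.1 3]
      exact hInv.d
    · rw [show rBig = 3 * 4 from rfl, hs'.1 4]
      exact hInv.big
    · intro i
      rw [hs'.2]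
      exact hInv.alive i
  · intro s' σ hrep _
    have hreg : ∀ i, 3 * i ≠ epochReg → s'.reg (3 * i) = s.reg (3 * i) := by
      intro i hi
      rw [hrep.vars.1 i, setReg_of_ne hi]
    have hInv' : Inv E (dd (2 * E.n)) g s' S :=
      ⟨(hreg 2 (by decide)).trans hInv.n, (hreg 3 (by decide)).trans hInv.d,
        (hreg 4 (by decide)).trans hInv.big, (hreg 5 (by decide)).trans hInv.root,
        (hreg 0 (by decide)).trans hInv.ans, hrep.stamp, fun i => by
          rw [hrep.vars.2]
          exact hInv.alive i, hInv.sub, hInv.dead⟩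
    obtain ⟨s'', hr, hk, hal⟩ := run_killMatched E hrep hInv'.n hInv'.d hInv'.sub hInv'.alive
    refine hr F K k _ (hK s'' (rest σ) (hInv'.of_keeps hk (by decide) hal
      (Finset.filter_subset _ _) ?_) ?_ ?_)
    · intro i hi hi'
      have : σ.arr 0 i < E.n ∧ Orth E i (σ.arr 0 i) := by
        by_contra hcon
        exact hi' (Finset.mem_filter.2 ⟨hi, hcon⟩)
      exact ⟨_, this⟩
    · rw [hk.1 _ (by decide)]
      exact hreg 12 (by decide)
    · rw [hk.1 _ (by decide), show epochReg = 3 * 1 from rfl, hrep.vars.1 1]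
      exact setReg_self _ _ _

theorem ok_rounds {E : HSEnv} {dd : ℕ → ℕ} {η : ℕ → ℝ} {b : ℕ} (M : Matcher E dd η b)
    {F : State → ℝ≥0∞} {K : List Prog} {k g : ℕ}
    (hK : ∀ s S, Inv E (dd (2 * E.n)) g s S → OK E.toEnv F K s k (failBound E b 0 S)) (t : ℕ) :
    ∀ s S, Inv E (dd (2 * E.n)) g s S → s.reg rC = t → s.reg epochReg + t < E.B →
      OK E.toEnv F (.loop rC (countdownBody rC (round M.W M.p)) :: K) s
        (k + t * (roundCost E.n E.d M.W (M.T (2 * E.n)) + 10) + 1) (failBound E b t S) := by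
  have hS := E.le_S
  induction t with
  | zero =>
    intro s S hInv hc _
    exact (OK.loop_zero (by decide) hc (hK s S hInv)).mono (by omega) le_rfl
  | succ t ih =>
    intro s S hInv hc he
    have hInv' : Inv E (dd (2 * E.n)) g (s.setReg rC t) S :=
      hInv.of_keeps ((Keeps.refl [rC] s).setReg (by decide) t) (by decide) hInv.alive subset_rfl
        fun i hi hi' => absurd hi hi'
    have e1 : (s.setReg rC t).reg epochReg = s.reg epochReg := setReg_of_ne (by decide) _
    have h1 := ok_round M (F := F) (t := t) hInv' (by rw [e1]; omega) fun s' S' hI hc' he' =>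
      ih s' S' hI (hc'.trans (setReg_self _ _ _)) (by rw [he', e1]; omega)
    refine (OK.countdown_step (by decide) (by omega) hc h1).mono ?_ le_rfl
    rw [add_mul]
    omega

theorem ok_nil (E : Env) {F : State → ℝ≥0∞} (hF : ∀ s s' : State, s.reg 0 = s'.reg 0 → F s = F s')
    (s : State) : OK E F [] s 0 (F s) := by
  intro _ s₁ h₁ hb
  rw [← hF s₁ s (h₁.1 0 (by decide))]
  exact Safe.nil hb

/-- The loss: `1` for a wrong answer. -/
noncomputable def loss (E : HSEnv) (s : State) : ℝ≥0∞ :=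
  open scoped Classical in if (s.reg 0 ≠ 0 ↔ IsYes E) then 0 else 1

theorem loss_congr (E : HSEnv) (s s' : State) (h : s.reg 0 = s'.reg 0) : loss E s = loss E s' := by
  classical
  unfold loss
  exact if_congr (by rw [h]) rfl rfl

/-- The running time of the exhaustive search. -/
def searchCost (n d g : ℕ) : ℕ := 2 * (n / g) * (3 * (n * (50 * (d + 1) + 100)) + 550) + 50

theorem ok_searchPhase (E : HSEnv) {D g : ℕ} (h2n : 2 * E.n < E.B) {s : State} {S : Finset ℕ}
    (hInv : Inv E D g s S) :
    OK E.toEnv (loss E) [searchPhase] s (searchCost E.n E.d g) (failBound E (E.n / g) 0 S) := by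
  classical
  obtain ⟨s', hr, hs'⟩ := run_searchPhase E h2n hInv
  refine (hr _ _ _ _ (ok_nil E.toEnv (loss_congr E) s')).mono (by simp [searchCost]) ?_
  by_cases hM : Gadget.HasMatching E.n (Orth E) (2 * (E.n / g)) S
  · rw [failBound, if_pos hM]
    simp only [drift, mul_zero, zero_le, if_true, ENNReal.ofReal_one, loss]
    split_ifs <;> simp
  · simp [loss, hs' hM]

/-- All rounds followed by the search. There are `9 g` rounds, since `n ≤ 2 * (n / g) * g` makes
`drift (n / g) (9 * g) n` at most `1 / 3`. -/
theorem ok_rounds_search {E : HSEnv} {dd : ℕ → ℕ} {η : ℕ → ℝ} {g : ℕ} (hg : 0 < g) (hgn : g ≤ E.n)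
    (M : Matcher E dd η (E.n / g)) (hB : 9 * E.n + 2 < E.B) {s : State}
    (hInv : Inv E (dd (2 * E.n)) g s (Finset.range E.n)) (he : s.reg epochReg ≤ 1) :
    OK E.toEnv (loss E)
      [.seq (countdown rC (.bin .mul (.lit 9) (.reg rG)) (round M.W M.p)) searchPhase] s
      (searchCost E.n E.d g + 9 * g * (roundCost E.n E.d M.W (M.T (2 * E.n)) + 10) + 20)
      (1 / 3) := by
  have hS := E.le_S
  have hv : (Expr.bin .mul (.lit 9) (.reg rG)).val E.inp s = 9 * g := by
    simp only [Expr.val, BinOp.eval, hInv.root]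
  have h0 := Run.assign (E := E.toEnv) (x := rC) (e := .bin .mul (.lit 9) (.reg rG)) (s := s)
    (by decide) (by simp only [Expr.size]; omega) (fun _ => by rw [hv]; omega)
  rw [hv] at h0
  have hInv' : Inv E (dd (2 * E.n)) g (s.setReg rC (9 * g)) (Finset.range E.n) :=
    hInv.of_keeps ((Keeps.refl [rC] s).setReg (by decide) _) (by decide) hInv.alive subset_rfl
      fun i hi hi' => absurd hi hi'
  have h1 := ok_rounds M (F := loss E) (K := [searchPhase]) (k := searchCost E.n E.d g) (g := g)
    (fun s S hI => ok_searchPhase E (by omega) hI) (9 * g) _ _ hInv' (setReg_self _ _ _)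
    (by rw [setReg_of_ne (by decide)]; omega)
  refine ((h0 _ _ _ _ h1).seq.seq).mono ?_ ?_
  · simp only [Expr.cost]
    omega
  · refine (failBound_le E (E.n / g) (9 * g) (Finset.card_range E.n).le).trans ?_
    have hb : 0 < E.n / g := Nat.div_pos hgn hg
    have h2 : E.n < E.n / g * g + g := by
      have := Nat.div_add_mod E.n g
      have h3 := Nat.mod_lt E.n hg
      rw [mul_comm] at this
      omega
    have h3 : g ≤ E.n / g * g := Nat.le_mul_of_pos_left g hb
    have h4 : E.n ≤ 2 * (E.n / g * g) := by omega
    have h5 : drift (E.n / g) (9 * g) E.n ≤ 1 / 3 := by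
      refine (drift_le_div E.n (by positivity)).trans ?_
      have h6 : (E.n : ℝ) ≤ 2 * ((E.n / g : ℕ) * g) := by exact_mod_cast h4
      have h7 : (0 : ℝ) < (E.n / g : ℕ) * g := by
        exact_mod_cast Nat.mul_pos hb hg
      rw [div_le_div_iff₀ (by push_cast; nlinarith) (by norm_num)]
      push_cast
      nlinarith
    refine (ENNReal.ofReal_le_ofReal h5).trans ?_
    rw [ENNReal.ofReal_div_of_pos (by norm_num)]
    norm_num

/-- The algorithm for the Hitting Set problem. -/
def mainProg (h : ℕ) (Wq : ℕ) (q : Prog) (Wp : ℕ) (p : Prog) : Prog :=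
  .seq (assign rN (.inp 0 (.lit 0))) <|
  .seq (assign rDim (.inp 0 (.lit 1))) <|
  ifExpr (.reg rDim)
    (.seq (call Wq rdSize q) <|
    .seq (assign rBig (.reg (vreg 0))) <|
    .seq (rootProg h) <|
    .seq initAlive <|
    .seq (countdown rC (.bin .mul (.lit 9) (.reg rG)) (round Wp p)) searchPhase)
    .skip

/-- The running time of the algorithm, when the matching takes time `tp` and the computation of its
dimension takes time `tq`. -/
def mainCost (h Wq Wp n d tq tp : ℕ) : ℕ :=
  searchCost n d (root h n) + 9 * root h n * (roundCost n d Wp tp + 10) +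
    (n * (8 * h + 70) + 500 * tq + 2 * Wq + 300)

/-- In dimension `0`, all vectors are orthogonal and register `0` keeps its initial value `0`. -/
theorem ok_mainProg_of_dim_eq_zero (E : HSEnv) (hd : E.d = 0) (h Wq : ℕ) (q : Prog) (Wp : ℕ)
    (p : Prog) : OK E.toEnv (loss E) [mainProg h Wq q Wp p] State.zero 100 (1 / 3) := by
  have hS := E.le_S
  have h1 := Run.assign (E := E.toEnv) (x := rN) (e := .inp 0 (.lit 0)) (s := State.zero) rfl
    (by simp only [Expr.size]; omega) (fun _ => E.inp_lt _ _)
  have h2 := Run.assign (E := E.toEnv) (x := rDim) (e := .inp 0 (.lit 1))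
    (s := State.zero.setReg rN ((Expr.inp 0 (.lit 0)).val E.inp State.zero)) rfl
    (by simp only [Expr.size]; omega) (fun _ => E.inp_lt _ _)
  set s := (State.zero.setReg rN ((Expr.inp 0 (.lit 0)).val E.inp State.zero)).setReg rDim
    ((Expr.inp 0 (.lit 1)).val E.inp
      (State.zero.setReg rN ((Expr.inp 0 (.lit 0)).val E.inp State.zero))) with hs
  have hdim : s.reg rDim = 0 := by
    rw [hs, setReg_self]
    exact E.inp_d.trans hd
  have h3 := Run.ifExpr_neg (E := E.toEnv) (e := .reg rDim)
    (p := .seq (call Wq rdSize q) <|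
      .seq (assign rBig (.reg (vreg 0))) <|
      .seq (rootProg h) <|
      .seq initAlive <|
      .seq (countdown rC (.bin .mul (.lit 9) (.reg rG)) (round Wp p)) searchPhase)
    rfl (by simp only [Expr.size]; omega) hdim (Run.skip E.toEnv s)
  refine (h1.seq (h2.seq h3) _ _ _ _ (ok_nil E.toEnv (loss_congr E) s)).mono ?_ ?_
  · simp only [Expr.cost]
    omega
  · have hans : s.reg 0 = 0 := by
      rw [hs, setReg_of_ne (by decide), setReg_of_ne (by decide)]
      rfl
    have hno : ¬ IsYes E := by
      rintro ⟨i, hi, hij⟩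
      exact hij i hi (by simp [Orth, Gadget.rowDot, hd])
    simp [loss, hans, hno]

/-- Correctness of the algorithm in the dimensions to which the gadgets apply. -/
theorem ok_mainProg {E : HSEnv} (hd : E.d ≠ 0) {h : ℕ} (hh : 0 < h) (hhS : 2 * h + 1 ≤ E.S)
    (hn : 0 < E.n) {dd : ℕ → ℕ} {η : ℕ → ℝ} (M : Matcher E dd η (E.n / root h E.n))
    (hB : 9 * E.n + 2 < E.B) {q : Prog} {kq Wq : ℕ} {Tq : ℕ → ℕ}
    (hq : Solves (evalProblem dd) 1 q kq Tq) (hWq : UsesBelow Wq q) (hWq0 : 0 < Wq)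
    (hkq : (2 * E.n + 2) ^ kq ≤ E.B) :
    OK E.toEnv (loss E) [mainProg h Wq q M.W M.p] State.zero
      (mainCost h Wq M.W E.n E.d (Tq (2 * E.n)) (M.T (2 * E.n))) (1 / 3) := by
  have hS := E.le_S
  have h1 := Run.assign (E := E.toEnv) (x := rN) (e := .inp 0 (.lit 0)) (s := State.zero) rfl
    (by simp only [Expr.size]; omega) (fun _ => E.inp_lt _ _)
  have hv1 : (Expr.inp 0 (.lit 0)).val E.inp State.zero = E.n := E.inp_n
  rw [hv1] at h1
  have h2 := Run.assign (E := E.toEnv) (x := rDim) (e := .inp 0 (.lit 1))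
    (s := State.zero.setReg rN E.n) rfl
    (by simp only [Expr.size]; omega) (fun _ => E.inp_lt _ _)
  have hv2 : (Expr.inp 0 (.lit 1)).val E.inp (State.zero.setReg rN E.n) = E.d := E.inp_d
  rw [hv2] at h2
  set s := (State.zero.setReg rN E.n).setReg rDim E.d with hs
  have hreg : ∀ r, r ≠ rN → r ≠ rDim → s.reg r = 0 := by
    intro r hr hr'
    rw [hs, setReg_of_ne hr', setReg_of_ne hr]
    rfl
  have hsN : s.reg rN = E.n := by rw [hs, setReg_of_ne (by decide), setReg_self]
  have hsD : s.reg rDim = E.d := setReg_self _ _ _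
  obtain ⟨hbd, hhalt, hprob⟩ := hq (2 * E.n)
  set R := run ((evalProblem dd).input (2 * E.n)) (Tq (2 * E.n)) ([q], State.zero) with hR
  have hcorrect : ∀ c ∈ R.support, c.1 = [] ∧ c.2.reg 0 = dd (2 * E.n) := by
    have hone : R.toOuterMeasure {c | (evalProblem dd).Correct (2 * E.n) c.2} = 1 :=
      le_antisymm (by
        rw [PMF.toOuterMeasure_apply, ← R.tsum_coe]
        exact ENNReal.tsum_le_tsum fun c => Set.indicator_le_self _ _ _) hprob
    rw [PMF.toOuterMeasure_apply_eq_one_iff] at hone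
    exact fun c hc => ⟨hhalt c hc, hone hc⟩
  set kr := searchCost E.n E.d (root h E.n) +
    9 * root h E.n * (roundCost E.n E.d M.W (M.T (2 * E.n)) + 10) + 20 with hkr
  have hcall := OK.call (E := E.toEnv) (F := loss E) (rd := rdSize)
    (vinp := fun _ _ => 2 * E.n) (W := Wq)
    (C := 500) (k := kr + (E.n * (8 * h + 70) + 100)) (Mv := (2 * E.n + 2) ^ kq)
    (T := Tq (2 * E.n)) (s := s) (K := [
    .seq (assign rBig (.reg (vreg 0))) <|
    .seq (rootProg h) <|
    .seq initAlive <|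
    .seq (countdown rC (.bin .mul (.lit 9) (.reg rG)) (round M.W M.p)) searchPhase])
    (G := fun _ => 1 / 3) (P := fun σ => σ.reg 0 = dd (2 * E.n)) (p := q) hkq
    (fun a y => ⟨(rdSize_tame a y).1, (rdSize_tame a y).2.1.trans hS, (rdSize_tame a y).2.2⟩)
    ?_ (by norm_num) (by omega) hWq hbd hcorrect ?_ ?_ ?_
  · have hsum : ∑' c, R c * (1 / 3 : ℝ≥0∞) = 1 / 3 := by
      rw [ENNReal.tsum_mul_right, R.tsum_coe, one_mul]
    change OK _ _ _ _ _ (∑' c, R c * (1 / 3 : ℝ≥0∞)) at hcall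
    rw [hsum] at hcall
    have h3 := OK.ifExpr_pos (q := .skip) (e := .reg rDim) rfl (by simp only [Expr.size]; omega)
      (by change s.reg rDim ≠ 0; rwa [hsD]) hcall.seq
    refine ((h1 _ _ _ _ (h2 _ _ _ _ h3).seq).seq).mono ?_ le_rfl
    simp only [Expr.cost, mainCost]
    omega
  · intro a y s' hs'
    change 2 * s'.reg rN = _
    rw [show rN = 3 * 2 from rfl, hs'.1 2, setReg_of_ne (by decide)]
    exact congrArg _ hsN
  · intro a y
    rw [hreg _ (by decide) (by decide)]
    exact le_rfl
  · rw [hreg _ (by decide) (by decide)]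
    have := E.le_B
    omega
  · intro s' σ hrep hσ
    have hreg' : ∀ i, 3 * i ≠ epochReg → s'.reg (3 * i) = s.reg (3 * i) := by
      intro i hi
      rw [hrep.vars.1 i, setReg_of_ne hi]
    have hepoch : s'.reg epochReg = 1 := by
      rw [show epochReg = 3 * 1 from rfl, hrep.vars.1 1]
      change (s.setReg epochReg (s.reg epochReg + 1)).reg epochReg = 1
      rw [setReg_self, hreg _ (by decide) (by decide)]
    have h4 := Run.assign (E := E.toEnv) (x := rBig) (e := .reg (vreg 0)) (s := s')
      rfl (by simp only [Expr.size]; omega) (fun hb => hb.1 _)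
    have hv4 : (Expr.reg (vreg 0)).val E.inp s' = dd (2 * E.n) := (hrep.reg 0 hWq0).trans hσ
    rw [hv4] at h4
    set s₁ := s'.setReg rBig (dd (2 * E.n)) with hs₁
    have hn₁ : s₁.reg rN = E.n := by
      rw [hs₁, setReg_of_ne (by decide)]
      exact (hreg' 2 (by decide)).trans hsN
    obtain ⟨s₂, hr₂, hk₂, ha₂, hg₂⟩ := run_rootProg E hh hhS hn₁
    obtain ⟨s₃, hr₃, hk₃, hal₃⟩ := run_initAlive E (s := s₂)
      ((hk₂.1 rN (by decide)).trans hn₁) (by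
        intro i
        rw [ha₂]
        change s'.arr 0 i = _
        rw [hrep.vars.2]
        simp [hs, State.setReg, State.zero])
    have hreg₁ : ∀ r, r ∉ [rBig, rG, rI] → s₃.reg r = s'.reg r := by
      intro r hr
      simp only [List.mem_cons, List.not_mem_nil, or_false, not_or] at hr
      rw [hk₃.1 r (by simp [hr.2.2]), hk₂.1 r (by simp [hr.2]), hs₁, setReg_of_ne hr.1]
    have hInv : Inv E (dd (2 * E.n)) (root h E.n) s₃ (Finset.range E.n) := by
      refine ⟨?_, ?_, ?_, ?_, ?_, ?_, hal₃, subset_rfl, ?_⟩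
      · exact (hreg₁ _ (by decide)).trans ((hreg' 2 (by decide)).trans hsN)
      · exact (hreg₁ _ (by decide)).trans ((hreg' 3 (by decide)).trans hsD)
      · rw [hk₃.1 _ (by decide), hk₂.1 _ (by decide), hs₁, setReg_self]
      · rw [hk₃.1 _ (by decide), hg₂]
      · exact (hreg₁ _ (by decide)).trans ((hreg' 0 (by decide)).trans
          (hreg _ (by decide) (by decide)))
      · intro a y
        rw [hk₃.2 _ (by unfold stampArr; omega), ha₂, hreg₁ _ (by decide)]
        exact hrep.stamp a y
      · intro i hi hi'
        exact absurd (Finset.mem_range.2 hi) hi'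
    have h5 := ok_rounds_search (root_pos hh hn) (root_le h E.n) M hB hInv
      (by rw [hreg₁ _ (by decide), hepoch])
    refine ((h4 _ _ _ _ (hr₂ _ _ _ _ (hr₃ _ _ _ _ h5).seq).seq).seq).mono ?_ le_rfl
    have e : E.n * (8 * h + 70) = E.n * (8 * h + 50) + E.n * 20 := by ring
    rw [e]
    simp only [Expr.cost]
    omega

end HS

end WordRAM

namespace WordRAM

namespace HS

/-! ### The dimension of the Hitting Set instances and the running time -/

/-- A dimension bound that grows slightly faster than `log n`, but slower than any power of `n`,
and that leaves room for the gadgets in dimension `dd (2 n)`. -/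
def slowDim (dd : ℕ → ℕ) (n : ℕ) : ℕ := min (dd (2 * n) / 12) (Nat.log 2 n ^ 2)

/-- The size `n` is large enough for the analysis of the algorithm. -/
structure Large (dd : ℕ → ℕ) (δ : ℝ) (h n : ℕ) : Prop where
  pos : 0 < n
  digits : 2 * n ≤ 2 ^ slowDim dd n
  dim : 3 * (3 * slowDim dd n + 1) ≤ dd (2 * n)
  approx : 1 / ((2 * n : ℕ) : ℝ) ^ δ * (2 * n : ℕ) * ((3 * slowDim dd n + 1 : ℕ) + 2) ≤
    (n / root h n : ℕ)

/-- The dimension of the Hitting Set instances. It is `0` for small `n`: then there are no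
instances with more than one vector, and in any case the answer is no. -/
noncomputable def hsDim (dd : ℕ → ℕ) (δ : ℝ) (h n : ℕ) : ℕ :=
  open scoped Classical in if Large dd δ h n then slowDim dd n else 0

theorem hsDim_le (dd : ℕ → ℕ) (δ : ℝ) (h n : ℕ) : hsDim dd δ h n ≤ Nat.log 2 n ^ 2 := by
  unfold hsDim
  split_ifs
  · exact min_le_right _ _
  · exact Nat.zero_le _

theorem log_sub_one_le (n : ℕ) : Real.log n - 1 ≤ Nat.log 2 n := by
  rcases Nat.eq_zero_or_pos n with rfl | hn
  · simp
  have h1 : (n : ℝ) < 2 ^ (Nat.log 2 n + 1) := by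
    exact_mod_cast Nat.lt_pow_succ_log_self (by norm_num) n
  have h2 : Real.log n ≤ (Nat.log 2 n + 1 : ℕ) * Real.log 2 := by
    rw [← Real.log_pow]
    exact Real.log_le_log (by exact_mod_cast hn) h1.le
  have h3 : Real.log 2 ≤ 1 := by
    have := Real.log_two_lt_d9
    linarith
  have h4 : (0 : ℝ) ≤ (Nat.log 2 n + 1 : ℕ) := by positivity
  have h5 := mul_le_mul_of_nonneg_left h3 h4
  push_cast at h5 h2
  linarith

theorem tendsto_log_natCast : Tendsto (fun n : ℕ => Real.log n) atTop atTop :=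
  Real.tendsto_log_atTop.comp tendsto_natCast_atTop_atTop

theorem tendsto_two_mul : Tendsto (fun n : ℕ => 2 * n) atTop atTop :=
  tendsto_id.const_mul_atTop' (by norm_num)

theorem eventually_mul_log_le {dd : ℕ → ℕ} (hd : IsOmegaLog dd) {C : ℝ} (hC : 0 < C) :
    ∀ᶠ n : ℕ in atTop, C * Real.log n ≤ slowDim dd n := by
  have h1 := tendsto_two_mul.eventually
    ((isLittleO_iff.1 hd) (c := 1 / (12 * (C + 1))) (by positivity))
  filter_upwards [h1, tendsto_log_natCast.eventually_ge_atTop (C + 4), eventually_ge_atTop 1]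
    with n hn hlog hn1
  have hn1' : (1 : ℝ) ≤ n := by exact_mod_cast hn1
  have hlog2 : Real.log n ≤ Real.log ((2 * n : ℕ) : ℝ) := by
    apply Real.log_le_log (by linarith)
    push_cast
    linarith
  rw [slowDim, Nat.cast_min, le_min_iff]
  constructor
  · rw [Real.norm_of_nonneg (by linarith), Real.norm_of_nonneg (by positivity)] at hn
    have h2 : Real.log n * (12 * (C + 1)) ≤ dd (2 * n) := by
      have h3 := hlog2.trans hn
      rw [div_mul_eq_mul_div, one_mul, le_div_iff₀ (by positivity)] at h3
      exact h3
    have h4 : (dd (2 * n) : ℝ) ≤ 12 * (dd (2 * n) / 12 : ℕ) + 11 := by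
      exact_mod_cast (by omega : dd (2 * n) ≤ 12 * (dd (2 * n) / 12) + 11)
    nlinarith
  · have h5 := log_sub_one_le n
    push_cast
    have h6 : (Real.log n - 1) ^ 2 ≤ (Nat.log 2 n : ℝ) ^ 2 :=
      pow_le_pow_left₀ (by linarith) h5 2
    nlinarith

/-- Powers of logarithms are smaller than powers of `n`. -/
theorem eventually_log_sq_le {θ : ℝ} (hθ : 0 < θ) (C : ℝ) :
    ∀ᶠ n : ℕ in atTop, C * ((Nat.log 2 n : ℝ) ^ 2 + 1) ≤ (n : ℝ) ^ θ := by
  have h1 : (fun x : ℝ => Real.log x ^ (2 : ℝ)) =o[atTop] fun x => x ^ θ :=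
    isLittleO_log_rpow_rpow_atTop 2 hθ
  have h2 := tendsto_natCast_atTop_atTop.eventually
    ((isLittleO_iff.1 h1) (c := 1 / (8 * (|C| + 1))) (by positivity))
  filter_upwards [h2, tendsto_log_natCast.eventually_ge_atTop 1, eventually_ge_atTop 1]
    with n hn hlog hn1
  rw [Real.norm_of_nonneg (by positivity), Real.norm_of_nonneg (by positivity),
    div_mul_eq_mul_div, one_mul, le_div_iff₀ (by positivity), Real.rpow_two] at hn
  have h3 : (Nat.log 2 n : ℝ) ≤ 2 * Real.log n := by
    have h4 : (2 : ℝ) ^ Nat.log 2 n ≤ n := by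
      exact_mod_cast Nat.pow_log_le_self 2 (by omega)
    have h5 := Real.log_le_log (by positivity) h4
    rw [Real.log_pow] at h5
    have := Real.log_two_gt_d9
    nlinarith [Nat.cast_nonneg (α := ℝ) (Nat.log 2 n)]
  have h6 : (Nat.log 2 n : ℝ) ^ 2 + 1 ≤ 8 * Real.log n ^ 2 := by
    nlinarith [Nat.cast_nonneg (α := ℝ) (Nat.log 2 n)]
  calc C * ((Nat.log 2 n : ℝ) ^ 2 + 1) ≤ (|C| + 1) * ((Nat.log 2 n : ℝ) ^ 2 + 1) := by
        have := le_abs_self C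
        gcongr
        linarith
    _ ≤ (|C| + 1) * (8 * Real.log n ^ 2) := by gcongr
    _ ≤ (n : ℝ) ^ θ := by linarith

theorem root_le_rpow {h : ℕ} (hh : 0 < h) (n : ℕ) : (root h n : ℝ) ≤ (n : ℝ) ^ (1 / (h : ℝ)) := by
  have h1 : ((root h n : ℝ)) ^ h ≤ n := by exact_mod_cast root_pow_le hh n
  have h2 := Real.rpow_le_rpow (by positivity) h1 (by positivity : 0 ≤ 1 / (h : ℝ))
  rwa [← Real.rpow_natCast, ← Real.rpow_mul (by positivity),
    mul_one_div_cancel (by exact_mod_cast hh.ne'), Real.rpow_one] at h2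

theorem rpow_le_two_mul_root {h : ℕ} (hh : 0 < h) {n : ℕ} (hn : 0 < n) :
    (n : ℝ) ^ (1 / (h : ℝ)) ≤ 2 * root h n := by
  have h1 : (n : ℝ) ≤ ((root h n : ℝ) + 1) ^ h := by
    exact_mod_cast (lt_root_add_one_pow hh n).le
  have h2 := Real.rpow_le_rpow (by positivity) h1 (by positivity : 0 ≤ 1 / (h : ℝ))
  rw [← Real.rpow_natCast, ← Real.rpow_mul (by positivity),
    mul_one_div_cancel (by exact_mod_cast hh.ne'), Real.rpow_one] at h2
  have h3 : (1 : ℝ) ≤ root h n := by exact_mod_cast root_pos hh hn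
  linarith

theorem eventually_large {dd : ℕ → ℕ} (hd : IsOmegaLog dd) {δ : ℝ} {h : ℕ} (hh : 4 ≤ h)
    (hδ : 4 / (h : ℝ) ≤ δ) : ∀ᶠ n : ℕ in atTop, Large dd δ h n := by
  have hh' : (4 : ℝ) ≤ h := by exact_mod_cast hh
  set θ : ℝ := 1 / (h : ℝ) with hθ
  have hθ0 : 0 < θ := by positivity
  have hθ4 : 4 * θ ≤ 1 := by
    rw [hθ, mul_one_div, div_le_one (by linarith)]
    exact hh'
  have hδ' : 4 * θ ≤ δ := by rwa [hθ, mul_one_div]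
  have htend : Tendsto (fun n : ℕ => (n : ℝ) ^ (2 * θ)) atTop atTop :=
    (tendsto_rpow_atTop (by positivity)).comp tendsto_natCast_atTop_atTop
  filter_upwards [eventually_mul_log_le hd (C := 4) (by norm_num), eventually_ge_atTop 3,
    eventually_log_sq_le hθ0 3, htend.eventually_ge_atTop 3] with n hlog hn hsq hn3
  have hn0 : (0 : ℝ) < n := by exact_mod_cast (by omega : 0 < n)
  have hn1 : (1 : ℝ) ≤ n := by exact_mod_cast (by omega : 1 ≤ n)
  have hlogn : 1 ≤ Real.log n := by
    rw [Real.le_log_iff_exp_le hn0]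
    have h3 : (3 : ℝ) ≤ n := by exact_mod_cast hn
    have := Real.exp_one_lt_d9
    linarith
  refine ⟨by omega, ?_, ?_, ?_⟩
  · have h1 : (n : ℝ) ^ 2 ≤ (2 : ℝ) ^ slowDim dd n := by
      rw [← Real.log_le_log_iff (by positivity) (by positivity), Real.log_pow, Real.log_pow]
      have := Real.log_two_gt_d9
      push_cast
      nlinarith
    have h2 : n ^ 2 ≤ 2 ^ slowDim dd n := by exact_mod_cast h1
    nlinarith
  · have h1 : 1 ≤ slowDim dd n := by
      have : (1 : ℝ) ≤ slowDim dd n := by linarith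
      exact_mod_cast this
    have h2 : slowDim dd n ≤ dd (2 * n) / 12 := min_le_left _ _
    omega
  · have hdim : ((3 * slowDim dd n + 1 : ℕ) + 2 : ℝ) ≤ (n : ℝ) ^ θ := by
      have h1 : (slowDim dd n : ℝ) ≤ (Nat.log 2 n : ℝ) ^ 2 := by
        exact_mod_cast min_le_right (dd (2 * n) / 12) (Nat.log 2 n ^ 2)
      push_cast
      linarith
    have h2n : 1 / ((2 * n : ℕ) : ℝ) ^ δ * (2 * n : ℕ) ≤ 2 * (n : ℝ) ^ (1 - 4 * θ) := by
      have h1 : (n : ℝ) ^ (4 * θ) ≤ ((2 * n : ℕ) : ℝ) ^ δ := by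
        refine (Real.rpow_le_rpow_of_exponent_le hn1 hδ').trans ?_
        refine Real.rpow_le_rpow hn0.le ?_ (by linarith)
        push_cast
        linarith
      have hpos : 0 < (n : ℝ) ^ (4 * θ) := by positivity
      calc 1 / ((2 * n : ℕ) : ℝ) ^ δ * (2 * n : ℕ)
          ≤ 1 / (n : ℝ) ^ (4 * θ) * (2 * n : ℕ) := by gcongr
        _ = 2 * (n : ℝ) ^ (1 - 4 * θ) := by
          rw [Real.rpow_sub hn0, Real.rpow_one]
          push_cast
          ring
    have hquot : (n : ℝ) ^ (1 - θ) ≤ (n / root h n : ℕ) + 1 := by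
      have hg : 0 < root h n := root_pos (by omega) (by omega)
      have hg' : (0 : ℝ) < root h n := by exact_mod_cast hg
      have h1 : (n : ℝ) ≤ root h n * ((n / root h n : ℕ) + 1) := by
        exact_mod_cast (Nat.lt_mul_div_succ n hg).le
      have h2 := root_le_rpow (by omega : 0 < h) n
      rw [Real.rpow_sub hn0, Real.rpow_one, div_le_iff₀ (by positivity)]
      refine h1.trans ?_
      rw [mul_comm]
      gcongr
    have e1 : (n : ℝ) ^ (1 - θ) = (n : ℝ) ^ (1 - 3 * θ) * (n : ℝ) ^ (2 * θ) := by
      rw [← Real.rpow_add hn0]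
      congr 1
      ring
    have e2 : (n : ℝ) ^ (1 - 4 * θ) * (n : ℝ) ^ θ = (n : ℝ) ^ (1 - 3 * θ) := by
      rw [← Real.rpow_add hn0]
      congr 1
      ring
    have h1 : 1 ≤ (n : ℝ) ^ (1 - 3 * θ) := Real.one_le_rpow hn1 (by linarith)
    calc 1 / ((2 * n : ℕ) : ℝ) ^ δ * (2 * n : ℕ) * ((3 * slowDim dd n + 1 : ℕ) + 2)
        ≤ 2 * (n : ℝ) ^ (1 - 4 * θ) * (n : ℝ) ^ θ := by gcongr
      _ = 2 * (n : ℝ) ^ (1 - 3 * θ) := by rw [mul_assoc, e2]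
      _ ≤ (n / root h n : ℕ) := by nlinarith

theorem isOmegaLog_hsDim {dd : ℕ → ℕ} (hd : IsOmegaLog dd) {δ : ℝ} {h : ℕ} (hh : 4 ≤ h)
    (hδ : 4 / (h : ℝ) ≤ δ) : IsOmegaLog (hsDim dd δ h) := by
  refine isLittleO_iff.2 fun c hc => ?_
  filter_upwards [eventually_large hd hh hδ, eventually_mul_log_le hd (C := 1 / c) (by positivity),
    eventually_ge_atTop 1] with n hL hn hn1
  have hn1' : (1 : ℝ) ≤ n := by exact_mod_cast hn1
  rw [hsDim, if_pos hL, Real.norm_of_nonneg (Real.log_nonneg hn1'),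
    Real.norm_of_nonneg (by positivity)]
  rw [div_mul_eq_mul_div, one_mul, div_le_iff₀ hc] at hn
  linarith

/-- A polynomial bound for the running time carries over to size `2 n`. -/
theorem eventually_time_le {T : ℕ → ℕ} {ε : ℝ}
    (hT : (fun n => (T n : ℝ)) =O[atTop] fun n : ℕ => (n : ℝ) ^ (2 - ε)) :
    ∃ C : ℝ, 0 ≤ C ∧ ∀ᶠ n : ℕ in atTop, (T (2 * n) : ℝ) ≤ C * (n : ℝ) ^ (2 - ε) := by
  obtain ⟨C, hC⟩ := hT.bound
  refine ⟨|C| * (2 : ℝ) ^ (2 - ε), by positivity, ?_⟩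
  filter_upwards [tendsto_two_mul.eventually hC] with n hn
  rw [Real.norm_of_nonneg (by positivity), Real.norm_of_nonneg (by positivity)] at hn
  refine hn.trans ?_
  push_cast
  rw [Real.mul_rpow (by norm_num) (by positivity), mul_assoc]
  gcongr
  exact le_abs_self C

/-- The arithmetic behind `isBigO_mainCost`: `y` is the target bound, `q` the number of greedy
searches, `g ≤ x` the number of rounds of matching, `tp` and `tq` the times of the subroutines. -/
theorem cost_le_mul {n D q x y g tp tq Wp Wq h Cp Cq : ℝ} (hg : 0 ≤ g) (htp : 0 ≤ tp)
    (hWp : 0 ≤ Wp) (hWq : 0 ≤ Wq) (hh : 0 ≤ h) (hq : 0 ≤ q) (hn : 1 ≤ n)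
    (hnD : 1 ≤ n * D) (hnD' : n ≤ n * D) (hny : n ≤ y) (hy : 1 ≤ y) (hgx : g ≤ x)
    (hqnD : q * (n * D) ≤ 2 * y) (hxnD : x * (n * D) ≤ y) (hpy : x * tp ≤ Cp * y)
    (hqy : tq ≤ Cq * y) :
    (2 * q * (3 * (n * (50 * D + 100)) + 550) + 50) +
        9 * g * ((500 * tp + (2 * Wp + n * (50 * D + 200) + 200)) + 10) +
        (n * (8 * h + 70) + 500 * tq + 2 * Wq + 300) + 100 ≤
      (4050 + 4500 * Cp + 9 * (2 * Wp + 460) + (8 * h + 70 + 2 * Wq + 400) + 500 * Cq) * y := by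
  have hsearch : 2 * q * (3 * (n * (50 * D + 100)) + 550) ≤ 4000 * y := by
    have h1 : 3 * (n * (50 * D + 100)) + 550 ≤ 1000 * (n * D) := by linarith
    calc 2 * q * (3 * (n * (50 * D + 100)) + 550) ≤ 2 * q * (1000 * (n * D)) :=
          mul_le_mul_of_nonneg_left h1 (by positivity)
      _ = 2000 * (q * (n * D)) := by ring
      _ ≤ 4000 * y := by linarith
  have hrounds : 9 * g * ((500 * tp + (2 * Wp + n * (50 * D + 200) + 200)) + 10) ≤
      4500 * (Cp * y) + 9 * (2 * Wp + 460) * y := by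
    have h0 : 2 * Wp ≤ 2 * Wp * (n * D) := le_mul_of_one_le_right (by positivity) hnD
    have h1 : (500 * tp + (2 * Wp + n * (50 * D + 200) + 200)) + 10 ≤
        500 * tp + (2 * Wp + 460) * (n * D) := by linarith
    have h2 : 0 ≤ 500 * tp + (2 * Wp + 460) * (n * D) := by
      have : 0 ≤ n * D := by linarith
      positivity
    calc 9 * g * ((500 * tp + (2 * Wp + n * (50 * D + 200) + 200)) + 10)
        ≤ 9 * g * (500 * tp + (2 * Wp + 460) * (n * D)) :=
          mul_le_mul_of_nonneg_left h1 (by positivity)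
      _ ≤ 9 * x * (500 * tp + (2 * Wp + 460) * (n * D)) :=
          mul_le_mul_of_nonneg_right (by linarith) h2
      _ = 4500 * (x * tp) + 9 * (2 * Wp + 460) * (x * (n * D)) := by ring
      _ ≤ 4500 * (Cp * y) + 9 * (2 * Wp + 460) * y :=
          add_le_add (mul_le_mul_of_nonneg_left hpy (by norm_num))
            (mul_le_mul_of_nonneg_left hxnD (by positivity))
  have hrest : n * (8 * h + 70) + 500 * tq + 2 * Wq + 300 + 150 ≤
      (8 * h + 70 + 2 * Wq + 400) * y + 500 * (Cq * y) + 50 * y := by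
    have h1 : n * (8 * h + 70) ≤ y * (8 * h + 70) :=
      mul_le_mul_of_nonneg_right hny (by positivity)
    have h2 : 2 * Wq ≤ 2 * Wq * y := le_mul_of_one_le_right (by positivity) hy
    linarith
  linarith

/-- The algorithm takes truly subquadratic time. -/
theorem isBigO_mainCost {dd : ℕ → ℕ} {δ : ℝ} {h Wq Wp : ℕ} {Tq Tp : ℕ → ℕ} {εq εp : ℝ}
    (hh : 4 ≤ h) (hεq : 4 / (h : ℝ) ≤ εq) (hεp : 4 / (h : ℝ) ≤ εp)
    (hTq : (fun n => (Tq n : ℝ)) =O[atTop] fun n : ℕ => (n : ℝ) ^ (2 - εq))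
    (hTp : (fun n => (Tp n : ℝ)) =O[atTop] fun n : ℕ => (n : ℝ) ^ (2 - εp)) :
    (fun n => ((mainCost h Wq Wp n (hsDim dd δ h n) (Tq (2 * n)) (Tp (2 * n)) + 100 : ℕ) : ℝ))
      =O[atTop] fun n : ℕ => (n : ℝ) ^ (2 - 1 / (2 * (h : ℝ))) := by
  have hh' : (4 : ℝ) ≤ h := by exact_mod_cast hh
  obtain ⟨θ, hθ⟩ : ∃ θ : ℝ, θ = 1 / (h : ℝ) := ⟨_, rfl⟩
  have hθ0 : 0 < θ := by rw [hθ]; positivity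
  have hθ4 : 4 * θ ≤ 1 := by
    rw [hθ, mul_one_div, div_le_one (by linarith)]
    exact hh'
  have hεq' : 4 * θ ≤ εq := by rwa [hθ, mul_one_div]
  have hεp' : 4 * θ ≤ εp := by rwa [hθ, mul_one_div]
  have hexp : 1 / (2 * (h : ℝ)) = θ / 2 := by rw [hθ]; field_simp
  obtain ⟨Cq, hCq0, hCq⟩ := eventually_time_le hTq
  obtain ⟨Cp, hCp0, hCp⟩ := eventually_time_le hTp
  rw [hexp]
  refine IsBigO.of_bound (4050 + 4500 * Cp + 9 * (2 * Wp + 460) + (8 * h + 70 + 2 * Wq + 400) +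
    500 * Cq) ?_
  filter_upwards [hCq, hCp, eventually_ge_atTop 1, eventually_log_sq_le (half_pos hθ0) 1]
    with n hq hp hn hsq
  have hn0 : (0 : ℝ) < n := by exact_mod_cast hn
  have hn1 : (1 : ℝ) ≤ n := by exact_mod_cast hn
  rw [Real.norm_of_nonneg (by positivity), Real.norm_of_nonneg (by positivity)]
  set y : ℝ := (n : ℝ) ^ (2 - θ / 2) with hy
  set x : ℝ := (n : ℝ) ^ θ with hx
  set w : ℝ := (n : ℝ) ^ (θ / 2) with hw
  have hx0 : 0 < x := by positivity
  have hxg : x ≤ 2 * root h n := by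
    have := rpow_le_two_mul_root (by omega : 0 < h) hn
    rwa [← hθ] at this
  have hgx : (root h n : ℝ) ≤ x := by
    have := root_le_rpow (by omega : 0 < h) n
    rwa [← hθ] at this
  have hD : ((hsDim dd δ h n : ℕ) : ℝ) + 1 ≤ w := by
    have : ((hsDim dd δ h n : ℕ) : ℝ) ≤ (Nat.log 2 n : ℝ) ^ 2 := by
      exact_mod_cast hsDim_le dd δ h n
    linarith
  have hle : ∀ a : ℝ, a ≤ 2 - θ / 2 → (n : ℝ) ^ a ≤ y := fun a ha =>
    Real.rpow_le_rpow_of_exponent_le hn1 ha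
  have hny : (n : ℝ) ≤ y := by
    have := hle 1 (by linarith)
    rwa [Real.rpow_one] at this
  have h1y : 1 ≤ y := hn1.trans hny
  have hqy : (Tq (2 * n) : ℝ) ≤ Cq * y := hq.trans (by gcongr; exact hle _ (by linarith))
  have hpy : x * Tp (2 * n) ≤ Cp * y := by
    calc x * Tp (2 * n) ≤ x * (Cp * (n : ℝ) ^ (2 - εp)) := by gcongr
      _ = Cp * (n : ℝ) ^ (θ + (2 - εp)) := by rw [Real.rpow_add hn0]; ring
      _ ≤ Cp * y := by gcongr; exact hle _ (by linarith)
  have hxnw : x * (n * w) ≤ y := by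
    have : x * (n * w) = (n : ℝ) ^ (θ + (1 + θ / 2)) := by
      rw [Real.rpow_add hn0, Real.rpow_add hn0, Real.rpow_one]
    rw [this]
    exact hle _ (by linarith)
  have hxy : n * (n * w) = x * y := by
    have e1 : x * y = (n : ℝ) ^ (1 + (1 + θ / 2)) := by
      rw [hx, hy, ← Real.rpow_add hn0]
      congr 1
      ring
    rw [e1, Real.rpow_add hn0, Real.rpow_add hn0, Real.rpow_one]
  obtain ⟨D, hDdef⟩ : ∃ D : ℝ, D = ((hsDim dd δ h n : ℕ) : ℝ) + 1 := ⟨_, rfl⟩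
  rw [← hDdef] at hD
  have hD1 : 1 ≤ D := by
    rw [hDdef]
    linarith [Nat.cast_nonneg (α := ℝ) (hsDim dd δ h n)]
  have hnD : 1 ≤ n * D := by nlinarith
  have hnD' : (n : ℝ) ≤ n * D := by nlinarith
  obtain ⟨q, hqdef⟩ : ∃ q : ℝ, q = ((n / root h n : ℕ) : ℝ) := ⟨_, rfl⟩
  have hq0 : 0 ≤ q := by rw [hqdef]; positivity
  have hqx : q * x ≤ 2 * n := by
    have h1 : q * root h n ≤ n := by
      rw [hqdef]
      exact_mod_cast Nat.div_mul_le_self n (root h n)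
    nlinarith
  have hqnD : q * (n * D) ≤ 2 * y := by
    have h1 : q * (n * w) * x ≤ 2 * y * x := by
      calc q * (n * w) * x = (q * x) * (n * w) := by ring
        _ ≤ (2 * n) * (n * w) := by gcongr
        _ = 2 * y * x := by rw [mul_assoc, hxy]; ring
    have h2 := le_of_mul_le_mul_right h1 hx0
    refine le_trans ?_ h2
    gcongr
  have hxnD : x * (n * D) ≤ y := by
    refine le_trans ?_ hxnw
    gcongr
  have hcost : ((mainCost h Wq Wp n (hsDim dd δ h n) (Tq (2 * n)) (Tp (2 * n)) + 100 : ℕ) : ℝ) =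
      (2 * q * (3 * (n * (50 * D + 100)) + 550) + 50) +
      9 * root h n * ((500 * Tp (2 * n) + (2 * Wp + n * (50 * D + 200) + 200)) + 10) +
      (n * (8 * h + 70) + 500 * Tq (2 * n) + 2 * Wq + 300) + 100 := by
    rw [mainCost, searchCost, roundCost, hDdef, hqdef]
    push_cast
    ring
  rw [hcost]
  exact cost_le_mul (Nat.cast_nonneg _) (Nat.cast_nonneg _) (Nat.cast_nonneg _)
    (Nat.cast_nonneg _) (Nat.cast_nonneg _) hq0 hn1 hnD hnD' hny h1y hgx hqnD hxnD hpy hqy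

/-! ### From instances of Hitting Set to the setting of the algorithm -/

theorem bitArray_le_one {n d : ℕ} (A : Fin n → Fin d → Bool) (y : ℕ) : bitArray A y ≤ 1 := by
  unfold bitArray
  split_ifs
  · exact Bool.toNat_le _
  · exact Nat.zero_le _

theorem bitArray_apply {n d : ℕ} (A : Fin n → Fin d → Bool) (i : Fin n) (v : Fin d) :
    bitArray A (i * d + v) = (A i v).toNat := by
  have h : (i : ℕ) * d + v = (finProdFinEquiv (i, v) : ℕ) := by
    change _ = (v : ℕ) + d * i
    ring
  have hlt : (i : ℕ) * d + v < n * d := by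
    rw [h]
    exact (finProdFinEquiv (i, v)).2
  have he : (⟨(i : ℕ) * d + v, hlt⟩ : Fin (n * d)) = finProdFinEquiv (i, v) := Fin.ext h
  rw [bitArray, dif_pos hlt, he, Equiv.symm_apply_apply]

theorem rowDot_bitArray {n d : ℕ} (A B : Fin n → Fin d → Bool) (i j : Fin n) :
    Gadget.rowDot d (bitArray A) (bitArray B) i j = bdot (A i) (B j) := by
  rw [Gadget.rowDot, bdot, ← Fin.sum_univ_eq_sum_range
    (fun v => bitArray A (i * d + v) * bitArray B (j * d + v))]
  exact Finset.sum_congr rfl fun v _ => by rw [bitArray_apply, bitArray_apply]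

/-- The setting of the algorithm for a given instance. -/
def instEnv {d : ℕ → ℕ} (x : VectorPair d) (k₀ h : ℕ) (hk : 5 ≤ k₀) (hd : d x.n ≤ x.n ^ 2) :
    HSEnv where
  inp := x.input
  B := (x.n + 2) ^ k₀
  S := 101 + 2 * h
  m := (x.n + 2) ^ (k₀ * (101 + 2 * h))
  le_B := (Nat.pow_le_pow_left (by omega : 2 ≤ x.n + 2) 5 |>.trans
    (Nat.pow_le_pow_right (by omega) hk)).trans' (by norm_num)
  inp_lt := by
    have h2 : (x.n + 2) ^ 2 ≤ (x.n + 2) ^ k₀ := Nat.pow_le_pow_right (by omega) (by omega)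
    intro a y
    have h3 : x.input a y ≤ x.n ^ 2 + x.n + 1 := by
      unfold VectorPair.input
      split
      · omega
      · omega
      · exact (bitArray_le_one _ _).trans (by omega)
      · exact (bitArray_le_one _ _).trans (by omega)
      · omega
    nlinarith
  pow_le := by rw [pow_mul]
  one_le := by omega
  n := x.n
  d := d x.n
  inp_n := rfl
  inp_d := rfl
  inp_one_le := fun y => bitArray_le_one x.A y
  inp_two_le := fun y => bitArray_le_one x.B y
  inp_two_eq_zero := fun y hy => by
    change bitArray x.B y = 0
    rw [bitArray, dif_neg (by omega)]
  le_S := by omega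

theorem isYes_instEnv {d : ℕ → ℕ} (x : VectorPair d) (k₀ h : ℕ) (hk : 5 ≤ k₀)
    (hd : d x.n ≤ x.n ^ 2) :
    IsYes (instEnv x k₀ h hk hd) ↔ ∃ i, ∀ j, bdot (x.A i) (x.B j) ≠ 0 := by
  have hO : ∀ i j : Fin x.n, Orth (instEnv x k₀ h hk hd) i j ↔ bdot (x.A i) (x.B j) = 0 := by
    intro i j
    rw [← rowDot_bitArray]
    rfl
  constructor
  · rintro ⟨i, hi, hij⟩
    exact ⟨⟨i, hi⟩, fun j => fun h0 => hij j j.2 ((hO ⟨i, hi⟩ j).2 h0)⟩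
  · rintro ⟨i, hij⟩
    exact ⟨i, i.2, fun j hj h0 => hij ⟨j, hj⟩ ((hO i ⟨j, hj⟩).1 h0)⟩

theorem two_mul_add_two_pow_le (n k k₀ : ℕ) (hk : 2 * k ≤ k₀) :
    (2 * n + 2) ^ k ≤ (n + 2) ^ k₀ := by
  have h1 : 2 * n + 2 ≤ (n + 2) ^ 2 := by nlinarith
  calc (2 * n + 2) ^ k ≤ ((n + 2) ^ 2) ^ k := Nat.pow_le_pow_left h1 k
    _ = (n + 2) ^ (2 * k) := by rw [pow_mul]
    _ ≤ (n + 2) ^ k₀ := Nat.pow_le_pow_right (by omega) hk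

end HS

end WordRAM

open WordRAM.HS in
theorem theorem3 (δ : ℝ) (hδ : 0 < δ) (d : ℕ → ℕ) (hd : IsOmegaLog d)
    (hdc : SubquadraticallyComputable d)
    (h : ∃ ε : ℝ, 0 < ε ∧
      RandomizedSolvable (approxEMDMatching (fun n => 1 / (n : ℝ) ^ δ) d) ε) :
    ¬ HittingSetConjecture := by
  obtain ⟨εq, hεq, q, kq, Tq, hq, hTq⟩ := hdc
  obtain ⟨εp, hεp, p, kp, Tp, hp, hTp⟩ := h
  intro hHSC
  -- the exponent of the root is chosen so that all losses are small powers of `n`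
  obtain ⟨N, hN⟩ := exists_nat_gt (4 / min δ (min εq εp))
  have hmin : 0 < min δ (min εq εp) := lt_min hδ (lt_min hεq hεp)
  set r := N + 4 with hr
  have hrmin : 4 / (r : ℝ) ≤ min δ (min εq εp) := by
    have h1 : (N : ℝ) ≤ r := by rw [hr]; push_cast; linarith
    rw [div_lt_iff₀ hmin] at hN
    rw [div_le_iff₀ (by positivity)]
    nlinarith
  have hrδ : 4 / (r : ℝ) ≤ δ := hrmin.trans (min_le_left _ _)
  have hrq : 4 / (r : ℝ) ≤ εq := hrmin.trans ((min_le_right _ _).trans (min_le_left _ _))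
  have hrp : 4 / (r : ℝ) ≤ εp := hrmin.trans ((min_le_right _ _).trans (min_le_right _ _))
  obtain ⟨Wp, hWp⟩ := exists_usesBelow p
  obtain ⟨Wq, hWq⟩ := exists_usesBelow q
  set k₀ := 5 + 2 * kp + 2 * kq with hk₀
  refine hHSC (hsDim d δ r) (isOmegaLog_hsDim hd (by omega) hrδ) (1 / (2 * (r : ℝ)))
    (by positivity) ⟨mainProg r (Wq + 1) q Wp p, k₀ * (101 + 2 * r), _, ?_,
      isBigO_mainCost (δ := δ) (dd := d) (Wq := Wq + 1) (Wp := Wp) (by omega) hrq hrp hTq hTp⟩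
  refine solves_of_safe (by
    rw [ENNReal.div_le_iff (by norm_num) (by norm_num)]
    norm_num) fun x => ?_
  have hdim : hsDim d δ r x.n ≤ x.n ^ 2 :=
    (hsDim_le _ _ _ _).trans (Nat.pow_le_pow_left (Nat.log_le_self 2 x.n) 2)
  let E := instEnv x k₀ r (by omega) hdim
  have hloss : ∀ s, ¬ (hittingSet (hsDim d δ r)).Correct x s → 1 ≤ loss E s := by
    intro s hs
    have : ¬ (s.reg 0 ≠ 0 ↔ IsYes E) := by
      rw [isYes_instEnv]
      exact hs
    simp [loss, this]
  have h13 : (1 / 3 : ℝ≥0∞) ≤ 1 - 2 / 3 := by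
    refine le_of_eq (ENNReal.eq_sub_of_add_eq
      (ENNReal.div_lt_top (by norm_num) (by norm_num)).ne ?_)
    rw [ENNReal.div_add_div_same]
    norm_num
    exact ENNReal.div_self (by norm_num) (by norm_num)
  have hzero : ∀ M, 0 < M → State.zero.BoundedBy M := fun M hM => ⟨fun _ => hM, fun _ _ => hM⟩
  have hBpos : 0 < E.B := by have := E.le_B; omega
  refine ⟨loss E, hloss, ?_⟩
  have hOK : OK E.toEnv (loss E) [mainProg r (Wq + 1) q Wp p] State.zero
      (mainCost r (Wq + 1) Wp x.n (hsDim d δ r x.n) (Tq (2 * x.n)) (Tp (2 * x.n)) + 100)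
      (1 / 3) := by
    by_cases h0 : hsDim d δ r x.n = 0
    · exact (ok_mainProg_of_dim_eq_zero E h0 r (Wq + 1) q Wp p).mono (by omega) le_rfl
    · have hL : Large d δ r x.n := by
        by_contra hL
        exact h0 (by rw [hsDim, if_neg hL])
      have hslow : hsDim d δ r x.n = slowDim d x.n := by rw [hsDim, if_pos hL]
      let M : Matcher E d (fun n => 1 / (n : ℝ) ^ δ) (E.n / root r E.n) :=
        { p := p
          k := kp
          T := Tp
          W := Wp
          solves := hp
          uses := hWp
          pow_le := two_mul_add_two_pow_le x.n kp k₀ (by omega)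
          digits := by
            change 2 * x.n ≤ 2 ^ hsDim d δ r x.n
            rw [hslow]
            exact hL.digits
          dim := by
            change 3 * (3 * hsDim d δ r x.n + 1) ≤ _
            rw [hslow]
            exact hL.dim
          nonneg := by positivity
          approx := by
            change 1 / ((2 * x.n : ℕ) : ℝ) ^ δ * (2 * x.n : ℕ) *
              ((3 * hsDim d δ r x.n + 1 : ℕ) + 2) ≤ _
            rw [hslow]
            exact hL.approx
          pos := Nat.div_pos (root_le r x.n) (root_pos (by omega) hL.pos) }
      have h9 : 9 * E.n + 2 < E.B := by
        have h1 : (x.n + 2) ^ 5 ≤ (x.n + 2) ^ k₀ := Nat.pow_le_pow_right (by omega) (by omega)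
        have h2 : 2 ^ 4 ≤ (x.n + 2) ^ 4 := Nat.pow_le_pow_left (by omega) 4
        change 9 * x.n + 2 < (x.n + 2) ^ k₀
        rw [pow_succ] at h1
        nlinarith
      exact (ok_mainProg (E := E) h0 (by omega : 0 < r)
        (by change 2 * r + 1 ≤ 101 + 2 * r; omega) hL.pos M h9 hq
        (hWq.mono (Nat.le_succ _)) (Nat.succ_pos _)
        (two_mul_add_two_pow_le x.n kq k₀ (by omega))).mono (Nat.le_add_right _ _) le_rfl
  exact (hOK (hzero _ hBpos) State.zero (Sim.refl _) (hzero _ (hBpos.trans_le E.B_le))).mono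
    le_rfl h13
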